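/- Let $n\in\mathbb N$ and $m\in\mathbb R$. For an integer $k \ge 0$ and $X=\mathbb R^k$, let $S^m(X;\mathbb R^n)$ be the set of all $a\in C^\infty(X\times\mathbb R^n;\mathbb C)$ such that for all multi-indices $\alpha,\beta$ and every compact $K\subset X$ there is a constant $C$ with $$|\partial_x^\alpha\partial_\xi^\beta a(x,\xi)|\le C(1+|\xi|^2)^{(m-|\beta|)/2}\qquad (x\in K,\ \xi\in\mathbb R^n),$$ and let $S^{-\infty}=\bigcap_{m}S^m$. A linear operator $P$ from $C_0^\infty(\mathbb R^n)$ to functions on $\mathbb R^n$ belongs to $\Psi DO^m$ (where $m\in\mathbb R$ or $m=-\infty$) if there is an amplitude $a\in S^m(\mathbb R^n\times\mathbb R^n;\mathbb R^n)$ such that $$Pu(x)=(2\pi)^{-n}\iint e^{i\langle x-y,\xi\rangle}a(x,y,\xi)u(y)\,dy\,d\xi\qquad(u\in C_0^\infty(\mathbb R^n),\ x\in\mathbb R^n)$$ as an oscillatory integral, i.e. as the limit for $\varepsilon\to0^+$ of the integrals with the factor $\chi(\varepsilon\xi)$ inserted, for every $\chi\in C_0^\infty(\mathbb R^n)$ with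 $\chi=1$ near $0$. A function $p\in S^m(\mathbb R^n;\mathbb R^n)$ is a total left symbol of $P$ if $P$ differs from the operator with amplitude $p(x,\xi)$ by an operator with Schwartz kernel in $C^\infty(\mathbb R^n\times\mathbb R^n)$. The operator $P\in\Psi DO^m$ is classical, $P\in\Psi DO^m_{cl}$, if it has a total left symbol $p \in S^m$ for which there are functions $p_{m-j}(x,\xi)$, $j=0,1,2,\dots$, smooth on $\mathbb R^n\times(\mathbb R^n\setminus\{0\})$ and positively homogeneous of degree $m-j$ in $\xi$, with $$p-\sum_{j=0}^{N-1}(1-\phi(\xi))\,p_{m-j}\in S^{m-N}(\mathbb R^n;\mathbb R^n)\quad\text{for all }N\ge0,$$ where $\phi\in C_0^\infty(\mathbb R^n)$ is equal to $1$ near $0$; then $\sigma_m(P)=p_m$ is the principal symbol of $P$. The operator $P$ is self-adjoint if $\int P\varphi\,\overline\psi\,dx=\int\varphi\,\overline{P\psi}\,dx$ for all $\varphi,\psi\in C_0^\infty(\mathbb R^n)$, and properly supported if both projections from the support of its Schwartz kernel in $\mathbb R^n\times\mathbb R^n$ to $\mathbb R^n$ are proper. **Theorem 6.5.** Let $P\in\Psi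 DO^m_{cl}(\mathbb R^n)$ be self-adjoint with $\sigma_m(P)(x,\xi)>0$ for all $x\in\mathbb R^n$ and $\xi\in\mathbb R^n\setminus\{0\}$. Then there is a properly supported, self-adjoint $Q\in\Psi DO^{m/2}_{cl}(\mathbb R^n)$, mapping $C_0^\infty(\mathbb R^n)$ to itself, such that $$P-Q^2\in\Psi DO^{-\infty}(\mathbb R^n).$$ -/

import Mathlib

open scoped Distributions ContDiff Topology

/-- Euclidean space `ℝⁿ`. -/
abbrev Rn (n : ℕ) : Type := EuclideanSpace ℝ (Fin n)

/-- The space `C_0^∞(ℝⁿ)` of complex valued smooth compactly supported functions. -/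
abbrev TestFn (n : ℕ) : Type := 𝓓((⊤ : TopologicalSpace.Opens (Rn n)), ℂ)

/-- Linear operators from `C_0^∞(ℝⁿ)` to complex functions on `ℝⁿ`. (For a pseudo-differential
operator the values are automatically smooth functions.) -/
abbrev TestOp (n : ℕ) : Type := TestFn n →ₗ[ℂ] (Rn n → ℂ)

/-- The inclusion of `C_0^∞(ℝⁿ)` into the functions on `ℝⁿ`. -/
noncomputable def testIncl (n : ℕ) : TestOp n where
  toFun u := u
  map_add' _ _ := rfl
  map_smul' _ _ := rfl

/-- The symbol class `S^m(X; ℝⁿ)`: smooth functions `a(x, θ)` on `X × ℝⁿ` such that for all orders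
`j`, `k` of differentiation in `x` and in `θ`, and every compact `K ⊆ X`, there is a constant `C`
with `|D_x^j D_θ^k a(x, θ)| ≤ C ⟨θ⟩^(m - k)` for `x ∈ K` and all `θ`, where
`⟨θ⟩ = (1 + |θ|²)^(1/2)`. The derivatives are total (Fréchet) derivatives, whose norms are
equivalent to the maximum of the moduli of the partial derivatives of these orders. -/
def IsSymbol {X : Type*} [NormedAddCommGroup X] [NormedSpace ℝ X] {n : ℕ} (m : ℝ)
    (a : X → Rn n → ℂ) : Prop :=
  ContDiff ℝ ∞ (fun z : X × Rn n => a z.1 z.2) ∧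
    ∀ (j k : ℕ) (K : Set X), IsCompact K → ∃ C : ℝ, ∀ x ∈ K, ∀ θ : Rn n,
      ‖iteratedFDeriv ℝ j (fun x' => iteratedFDeriv ℝ k (a x') θ) x‖
        ≤ C * Real.sqrt (1 + ‖θ‖ ^ 2) ^ (m - k)

/-- The class `S^{-∞}`, the intersection of all `S^m`. -/
def IsSymbolNegInfty {X : Type*} [NormedAddCommGroup X] [NormedSpace ℝ X] {n : ℕ}
    (a : X → Rn n → ℂ) : Prop :=
  ∀ m : ℝ, IsSymbol m a

/-- A smooth compactly supported function on `ℝⁿ` that is equal to `1` near `0`. -/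
def IsCutoff {n : ℕ} (χ : Rn n → ℂ) : Prop :=
  ContDiff ℝ ∞ χ ∧ HasCompactSupport χ ∧ ∀ᶠ ξ in 𝓝 0, χ ξ = 1

/-- `P` is the operator with Schwartz kernel `(2π)^(-n) ∫ e^{i⟨x-y,ξ⟩} a(x, y, ξ) dξ`, an
oscillatory integral. That is, for every regularizing cutoff `χ`,
`(P u)(x) = lim_{ε → 0} (2π)^(-n) ∫∫ e^{i⟨x-y,ξ⟩} χ(ε ξ) a(x, y, ξ) u(y) dy dξ`. -/
def HasAmplitude {n : ℕ} (P : TestOp n) (a : Rn n × Rn n → Rn n → ℂ) : Prop :=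
  ∀ (u : TestFn n) (x : Rn n) (χ : Rn n → ℂ), IsCutoff χ →
    Filter.Tendsto
      (fun ε : ℝ => (((2 * Real.pi) ^ n : ℝ) : ℂ)⁻¹ *
        ∫ ξ : Rn n, ∫ y : Rn n,
          Complex.exp (Complex.I * ((inner ℝ (x - y) ξ : ℝ) : ℂ)) * χ (ε • ξ) * a (x, y) ξ * u y)
      (𝓝[>] 0) (𝓝 (P u x))

/-- `ΨDO^m(ℝⁿ)`: pseudo-differential operators of order `m`. -/
def PsiDO (n : ℕ) (m : ℝ) : Set (TestOp n) :=
  {P | ∃ a : Rn n × Rn n → Rn n → ℂ, IsSymbol m a ∧ HasAmplitude P a}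

/-- `ΨDO^{-∞}(ℝⁿ)`: pseudo-differential operators with amplitude in `S^{-∞}`. -/
def PsiDONegInfty (n : ℕ) : Set (TestOp n) :=
  {P | ∃ a : Rn n × Rn n → Rn n → ℂ, IsSymbolNegInfty a ∧ HasAmplitude P a}

/-- `P` has a Schwartz kernel in `C^∞(ℝⁿ × ℝⁿ)`. -/
def HasSmoothKernel {n : ℕ} (P : TestOp n) : Prop :=
  ∃ K : Rn n × Rn n → ℂ, ContDiff ℝ ∞ K ∧
    ∀ (u : TestFn n) (x : Rn n), P u x = ∫ y : Rn n, K (x, y) * u y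

/-- `p ∈ S^m(ℝⁿ; ℝⁿ)` is (a representative of) the total left symbol of `P`: up to a smooth term,
the Schwartz kernel of `P` is `(2π)^(-n) ∫ e^{i⟨x-y,ξ⟩} p(x, ξ) dξ`. -/
def IsTotalLeftSymbol {n : ℕ} (m : ℝ) (P : TestOp n) (p : Rn n → Rn n → ℂ) : Prop :=
  IsSymbol m p ∧ ∃ P₀ : TestOp n, HasAmplitude P₀ (fun z ξ => p z.1 ξ) ∧ HasSmoothKernel (P - P₀)

/-- The space `H^μ`: functions `b(x, ξ)` that are smooth on `ℝⁿ × (ℝⁿ - 0)` and homogeneous of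
degree `μ` in `ξ`. The value at `ξ = 0` is irrelevant. -/
def IsHomogeneousFn {n : ℕ} (μ : ℝ) (b : Rn n → Rn n → ℂ) : Prop :=
  ContDiffOn ℝ ∞ (fun z : Rn n × Rn n => b z.1 z.2) {z | z.2 ≠ 0} ∧
    ∀ (x ξ : Rn n) (t : ℝ), ξ ≠ 0 → 0 < t → b x (t • ξ) = ((t ^ μ : ℝ) : ℂ) * b x ξ

/-- The symbol `p` of order `m` has the classical expansion `∑ b_j`, where `b_j` is homogeneous of
degree `m - j`: for all `N`, `p - ∑_{j < N} (1 - φ) b_j ∈ S^{m-N}`. -/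
def HasClassicalExpansion {n : ℕ} (m : ℝ) (p : Rn n → Rn n → ℂ) (b : ℕ → Rn n → Rn n → ℂ) :
    Prop :=
  (∀ j : ℕ, IsHomogeneousFn (m - j) (b j)) ∧
    ∃ φ : Rn n → ℂ, IsCutoff φ ∧ ∀ N : ℕ,
      IsSymbol (m - N) (fun x ξ => p x ξ - ∑ j ∈ Finset.range N, (1 - φ ξ) * b j x ξ)

/-- `ΨDO_cl^m(ℝⁿ)`: classical pseudo-differential operators of order `m`, that is, those whose
total left symbol is classical. -/
def PsiDOcl (n : ℕ) (m : ℝ) : Set (TestOp n) :=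
  {P | P ∈ PsiDO n m ∧ ∃ (p : Rn n → Rn n → ℂ) (b : ℕ → Rn n → Rn n → ℂ),
    IsTotalLeftSymbol m P p ∧ HasClassicalExpansion m p b}

/-- `σ` is the principal symbol `σ_m(P)`: the leading term of the classical expansion of the total
left symbol of `P`. -/
def IsPrincipalSymbol {n : ℕ} (m : ℝ) (P : TestOp n) (σ : Rn n → Rn n → ℂ) : Prop :=
  ∃ (p : Rn n → Rn n → ℂ) (b : ℕ → Rn n → Rn n → ℂ),
    IsTotalLeftSymbol m P p ∧ HasClassicalExpansion m p b ∧ b 0 = σ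

/-- `P = P^*`, i.e. `∫ (P φ) ψ̄ dx = ∫ φ \overline{P ψ} dx` for all `φ, ψ ∈ C_0^∞(ℝⁿ)`. -/
def IsSelfAdjointOp {n : ℕ} (P : TestOp n) : Prop :=
  ∀ φ ψ : TestFn n,
    ∫ x : Rn n, P φ x * (starRingEnd ℂ) (ψ x) = ∫ x : Rn n, φ x * (starRingEnd ℂ) (P ψ x)

/-- The support of the Schwartz kernel of `P` (for operators with continuous values). A point
`(x, y)` lies outside of it when there are neighbourhoods `U` of `x` and `V` of `y` such that
`P u = 0` on `U` for all `u ∈ C_0^∞` with support in `V`. -/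
def kernelSupport {n : ℕ} (P : TestOp n) : Set (Rn n × Rn n) :=
  {z | ∀ U ∈ 𝓝 z.1, ∀ V ∈ 𝓝 z.2, ∃ u : TestFn n, tsupport u ⊆ V ∧ ∃ x ∈ U, P u x ≠ 0}

/-- `P` is properly supported: both projections from the support of its Schwartz kernel to `ℝⁿ`
are proper (preimages of compact sets are compact). -/
def IsProperlySupported {n : ℕ} (P : TestOp n) : Prop :=
  ∀ K : Set (Rn n), IsCompact K →
    IsCompact (kernelSupport P ∩ {z | z.1 ∈ K}) ∧ IsCompact (kernelSupport P ∩ {z | z.2 ∈ K})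

set_option linter.unusedSectionVars false

/-! The square root is built on the level of symbols, one order at a time. For a real symbol `q`
take the operator Q whose amplitude is ψ(y - x)(q(x,ξ) + q(y,ξ))/2, with ψ an even cutoff equal to 1
near 0. It is exactly self-adjoint and properly supported, and its left symbol `symL ψ q` equals `q`
modulo one order lower. Hence only `q` remains to be chosen so that P - Q² is smoothing.

Symbol calculus. Amplitudes are written as A((x,z),ξ) with displacement z = y - x. If A has compact
support in z, its operator has the left symbol `Ls 1 A` (`opA_leftA_Ls`). The family `Ls t A` joins
the restriction to z = 0 at t = 0 (Fourier inversion) to the left symbol at t = 1, and its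
t-derivative is `Ls t (mixedLap A)`, where `mixedLap` lowers the order by one. Taylor's formula in t
therefore replaces stationary phase and gives the full expansion (`isSymbol_LsRem`). Since Q = Q*,
the square Q² = QQ* has the amplitude L(x,ξ) times the conjugate of L(y,ξ), L being the left symbol
of Q (`opA_opA`); the left symbol of Q² is `prodL ψ χ q q`, which is q² modulo one order lower.

Iteration. Start from c, the square root of the principal symbol, cut off near ξ = 0. If p - `prodL
ψ χ q q` has order m - N with leading term s, adding d to `q` changes the product by 2cd modulo
lower order, so d = s/(2c) improves the error by one order (`exists_correction`). Self-adjointness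
of Q requires d, hence s, to be real. This is where self-adjointness of P enters: P - Q² has a real
quadratic form, and testing it on φ(x)e^{it⟨x,ξ⟩} as t → ∞ shows that s is real for large ξ
(`im_eq_zero_of_symmetric`). The corrections are summed by Borel's construction
(`exists_asymptotic_sum`), whose sum is again real.

The smooth kernel by which P differs from its left quantization is carried as an amplitude in S^{-∞}
(`exists_amplitude_of_kernel`), so that all identities between operators are exact. Symbol estimates
are mostly proved by coinduction (`isSymbol_of_closed`): it suffices to bound the members of a class
closed under derivatives. -/

/-- The weight `⟨θ⟩ = (1 + |θ|²)^(1/2)`. -/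
noncomputable def jb {n : ℕ} (θ : Rn n) : ℝ := Real.sqrt (1 + ‖θ‖ ^ 2)

/-! ### The weight ⟨θ⟩ and Peetre's inequality. -/

section Weight

variable {n : ℕ}

theorem one_le_jb (θ : Rn n) : 1 ≤ jb θ := by
  rw [jb, Real.one_le_sqrt]; nlinarith [sq_nonneg ‖θ‖]

theorem jb_pos (θ : Rn n) : 0 < jb θ := one_pos.trans_le (one_le_jb θ)

theorem jb_sq (θ : Rn n) : jb θ ^ 2 = 1 + ‖θ‖ ^ 2 := Real.sq_sqrt (by positivity)

theorem norm_le_jb (θ : Rn n) : ‖θ‖ ≤ jb θ := Real.le_sqrt_of_sq_le (by linarith)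

theorem jb_le_one_add_norm (θ : Rn n) : jb θ ≤ 1 + ‖θ‖ := by
  rw [jb, Real.sqrt_le_left (by positivity)]; nlinarith [norm_nonneg θ]

theorem continuous_jb : Continuous (jb : Rn n → ℝ) := by
  unfold jb; fun_prop

theorem continuous_jb_rpow (m : ℝ) : Continuous (fun θ : Rn n => jb θ ^ m) :=
  continuous_jb.rpow_const fun θ => Or.inl (jb_pos θ).ne'

theorem jb_rpow_pos (θ : Rn n) (m : ℝ) : 0 < jb θ ^ m := Real.rpow_pos_of_pos (jb_pos θ) m

theorem jb_neg (θ : Rn n) : jb (-θ) = jb θ := by simp [jb]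

theorem jb_add_le (ξ η : Rn n) : jb (ξ + η) ≤ 2 * jb ξ * jb η := by
  have h1 := jb_le_one_add_norm (ξ + η)
  have h2 := norm_add_le ξ η
  nlinarith [norm_le_jb ξ, norm_le_jb η, one_le_jb ξ, one_le_jb η,
    mul_nonneg (sub_nonneg.2 (one_le_jb ξ)) (sub_nonneg.2 (one_le_jb η)), norm_nonneg ξ,
    norm_nonneg η, jb_sq ξ, jb_sq η, sq_nonneg (‖ξ‖ * ‖η‖ - 1),
    mul_le_mul (norm_le_jb ξ) (norm_le_jb η) (norm_nonneg _) (jb_pos _).le]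

theorem jb_smul_le (t : ℝ) (ζ : Rn n) : jb (t • ζ) ≤ (1 + |t|) * jb ζ := by
  rw [jb, Real.sqrt_le_left (by have := jb_pos ζ; positivity), mul_pow, jb_sq, norm_smul,
    Real.norm_eq_abs]
  nlinarith [abs_nonneg t, sq_nonneg ‖ζ‖, mul_nonneg (abs_nonneg t) (sq_nonneg ‖ζ‖),
    sq_nonneg (|t|)]

/-- Peetre's inequality. -/
theorem jb_rpow_add_le (m : ℝ) (ξ η : Rn n) :
    jb (ξ + η) ^ m ≤ 2 ^ |m| * jb ξ ^ m * jb η ^ |m| := by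
  have pξ := jb_pos ξ
  have pη := jb_pos η
  have ps := jb_pos (ξ + η)
  rcases le_total 0 m with hm | hm
  · rw [abs_of_nonneg hm, ← Real.mul_rpow two_pos.le pξ.le,
      ← Real.mul_rpow (by positivity) pη.le]
    exact Real.rpow_le_rpow ps.le (jb_add_le ξ η) hm
  -- For negative exponents the inequality is applied to ξ = (ξ + η) - η and inverted.
  · have h := jb_add_le (ξ + η) (-η)
    rw [add_neg_cancel_right, jb_neg] at h
    have h' := Real.rpow_le_rpow pξ.le h (neg_nonneg.2 hm)
    rw [Real.mul_rpow (by positivity) pη.le, Real.mul_rpow two_pos.le ps.le,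
      Real.rpow_neg pξ.le, Real.rpow_neg ps.le] at h'
    rw [abs_of_nonpos hm]
    have p1 := jb_rpow_pos ξ m
    have p2 := jb_rpow_pos (ξ + η) m
    calc jb (ξ + η) ^ m = jb (ξ + η) ^ m * ((jb ξ ^ m)⁻¹ * jb ξ ^ m) := by
          rw [inv_mul_cancel₀ p1.ne', mul_one]
      _ ≤ jb (ξ + η) ^ m * ((2 ^ (-m) * (jb (ξ + η) ^ m)⁻¹ * jb η ^ (-m)) * jb ξ ^ m) := by
          gcongr
      _ = _ := by field_simp

theorem jb_rpow_le_rpow (θ : Rn n) {m m' : ℝ} (h : m ≤ m') : jb θ ^ m ≤ jb θ ^ m' :=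
  Real.rpow_le_rpow_of_exponent_le (one_le_jb θ) h

theorem integrable_jb_rpow {s : ℝ} (hs : (n : ℝ) < s) :
    MeasureTheory.Integrable (fun θ : Rn n => jb θ ^ (-s)) := by
  have h := integrable_rpow_neg_one_add_norm_sq (E := Rn n) (μ := MeasureTheory.volume) (r := s)
    (by simpa using hs)
  refine h.congr (Filter.Eventually.of_forall fun θ => ?_)
  simp only [jb]
  rw [Real.sqrt_eq_rpow, ← Real.rpow_mul (by positivity)]
  ring_nf

end Weight

/-! ### Partial derivatives of functions of two variables. -/

section IteratedParam

variable {X Θ F G : Type*} [NormedAddCommGroup X] [NormedSpace ℝ X] [NormedAddCommGroup Θ]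
  [NormedSpace ℝ Θ] [NormedAddCommGroup F] [NormedSpace ℝ F] [NormedAddCommGroup G]
  [NormedSpace ℝ G]

theorem ContDiff.fderiv_snd {a : X → Θ → F} (ha : ContDiff ℝ ∞ fun z : X × Θ => a z.1 z.2) :
    ContDiff ℝ ∞ fun z : X × Θ => fderiv ℝ (a z.1) z.2 := by
  refine ContDiff.fderiv (f := fun z : X × Θ => a z.1) (m := ∞) ?_ contDiff_snd (by simp)
  exact ha.comp ((contDiff_fst.fst).prodMk contDiff_snd)

theorem ContDiff.fderiv_fst {a : X → Θ → F} (ha : ContDiff ℝ ∞ fun z : X × Θ => a z.1 z.2) :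
    ContDiff ℝ ∞ fun z : X × Θ => fderiv ℝ (fun x => a x z.2) z.1 := by
  refine ContDiff.fderiv (f := fun (z : X × Θ) x => a x z.2) (m := ∞) ?_ contDiff_fst (by simp)
  exact ha.comp (contDiff_snd.prodMk contDiff_fst.snd)

theorem ContDiff.iteratedFDeriv_snd {a : X → Θ → F}
    (ha : ContDiff ℝ ∞ fun z : X × Θ => a z.1 z.2) (k : ℕ) :
    ContDiff ℝ ∞ fun z : X × Θ => iteratedFDeriv ℝ k (a z.1) z.2 := by
  induction k with
  | zero =>
    simp only [iteratedFDeriv_zero_eq_comp]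
    exact (LinearIsometryEquiv.contDiff _).comp ha
  | succ k ih =>
    simp only [iteratedFDeriv_succ_eq_comp_left]
    exact (LinearIsometryEquiv.contDiff _).comp
      (ContDiff.fderiv_snd (a := fun x θ => iteratedFDeriv ℝ k (a x) θ) ih)

theorem ContDiff.slice_fst {a : X → Θ → F} (ha : ContDiff ℝ ∞ fun z : X × Θ => a z.1 z.2) (θ : Θ) :
    ContDiff ℝ ∞ fun x => a x θ := ha.comp (contDiff_id.prodMk contDiff_const)

theorem ContDiff.slice_snd {a : X → Θ → F} (ha : ContDiff ℝ ∞ fun z : X × Θ => a z.1 z.2) (x : X) :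
    ContDiff ℝ ∞ (a x) := ha.comp (contDiff_const.prodMk contDiff_id)

theorem fderiv_comp_prodMk_left {g : X × Θ → F} (hg : Differentiable ℝ g) (x v : X) (θ : Θ) :
    fderiv ℝ (fun x => g (x, θ)) x v = fderiv ℝ g (x, θ) (v, 0) := by
  have h : HasFDerivAt (fun x => g (x, θ)) _ x :=
    (hg (x, θ)).hasFDerivAt.comp x (hasFDerivAt_prodMk_left x θ)
  rw [h.fderiv]; simp

theorem fderiv_comp_prodMk_right {g : X × Θ → F} (hg : Differentiable ℝ g) (x : X) (θ w : Θ) :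
    fderiv ℝ (fun θ => g (x, θ)) θ w = fderiv ℝ g (x, θ) (0, w) := by
  have h : HasFDerivAt (fun θ => g (x, θ)) _ θ :=
    (hg (x, θ)).hasFDerivAt.comp θ (hasFDerivAt_prodMk_right x θ)
  rw [h.fderiv]; simp

theorem fderiv_slice_fst {a : X → Θ → F} (ha : ContDiff ℝ ∞ fun z : X × Θ => a z.1 z.2)
    (x : X) (θ : Θ) (v : X) :
    fderiv ℝ (fun x => a x θ) x v = fderiv ℝ (fun z : X × Θ => a z.1 z.2) (x, θ) (v, 0) :=
  fderiv_comp_prodMk_left (ha.differentiable (by simp)) x v θ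

theorem fderiv_slice_snd {a : X → Θ → F} (ha : ContDiff ℝ ∞ fun z : X × Θ => a z.1 z.2)
    (x : X) (θ : Θ) (w : Θ) :
    fderiv ℝ (a x) θ w = fderiv ℝ (fun z : X × Θ => a z.1 z.2) (x, θ) (0, w) :=
  fderiv_comp_prodMk_right (ha.differentiable (by simp)) x θ w

/-- Both sides are the second derivative of the joint function, in the directions (v,0) and (0,w),
so symmetry of second derivatives applies. -/
theorem fderiv_fderiv_slice_comm {a : X → Θ → F} (ha : ContDiff ℝ ∞ fun z : X × Θ => a z.1 z.2)
    (v : X) (x : X) (θ : Θ) :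
    fderiv ℝ (fun θ => fderiv ℝ (fun x => a x θ) x v) θ =
      fderiv ℝ (fun x => fderiv ℝ (a x) θ) x v := by
  ext w
  have hd : Differentiable ℝ (fderiv ℝ fun z : X × Θ => a z.1 z.2) :=
    (ha.fderiv_right (m := ∞) (by simp)).differentiable (by simp)
  have key : ∀ u u' : X × Θ, fderiv ℝ (fun z => fderiv ℝ (fun z : X × Θ => a z.1 z.2) z u') (x, θ) u
      = fderiv ℝ (fderiv ℝ fun z : X × Θ => a z.1 z.2) (x, θ) u u' := by
    intro u u'
    rw [((hd (x, θ)).hasFDerivAt.clm_apply (hasFDerivAt_const u' (x, θ))).fderiv]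
    simp
  have hd' : ∀ u' : X × Θ,
      Differentiable ℝ (fun z => fderiv ℝ (fun z : X × Θ => a z.1 z.2) z u') :=
    fun u' => hd.clm_apply (differentiable_const u')
  have e1 : fderiv ℝ (fun θ => fderiv ℝ (fun x => a x θ) x v) θ w =
      fderiv ℝ (fderiv ℝ fun z : X × Θ => a z.1 z.2) (x, θ) (0, w) (v, 0) := by
    rw [funext fun θ => fderiv_slice_fst ha x θ v, ← key,
      ← fderiv_comp_prodMk_right (hd' (v, 0))]
  have e2 : fderiv ℝ (fun x => fderiv ℝ (a x) θ) x v w =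
      fderiv ℝ (fderiv ℝ fun z : X × Θ => a z.1 z.2) (x, θ) (v, 0) (0, w) := by
    have hx : DifferentiableAt ℝ (fun x => fderiv ℝ (a x) θ) x :=
      ((ContDiff.fderiv_snd ha).slice_fst (a := fun x θ => fderiv ℝ (a x) θ) θ).differentiable
        (by simp) x
    have h3 := (hx.hasFDerivAt.clm_apply (hasFDerivAt_const w x)).fderiv
    have h4 := congrArg (fun L : X →L[ℝ] F => L v) h3
    rw [← key, ← fderiv_comp_prodMk_left (hd' (0, w)),
      ← funext fun x => fderiv_slice_snd ha x θ w]
    simpa using h4.symm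
  rw [e1, e2]
  have h2 : minSmoothness ℝ 2 ≤ (∞ : WithTop ℕ∞) := by
    rw [minSmoothness_of_isRCLikeNormedField]; exact WithTop.coe_le_coe.2 le_top
  exact (ha.contDiffAt.isSymmSndFDerivAt h2) _ _

end IteratedParam

/-! ### Directional derivatives in the base and in the fiber. -/

section Derivatives

variable {X : Type*} [NormedAddCommGroup X] [NormedSpace ℝ X] {n : ℕ}

/-- Joint smoothness of a function `a(x, θ)`. -/
abbrev Smooth2 (a : X → Rn n → ℂ) : Prop := ContDiff ℝ ∞ fun z : X × Rn n => a z.1 z.2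

/-- The derivative of `a(x, θ)` in `x` in the direction `v`. -/
noncomputable def dX (v : X) (a : X → Rn n → ℂ) : X → Rn n → ℂ :=
  fun x θ => fderiv ℝ (fun x' => a x' θ) x v

/-- The derivative of `a(x, θ)` in `θ` in the direction `w`. -/
noncomputable def dT (w : Rn n) (a : X → Rn n → ℂ) : X → Rn n → ℂ :=
  fun x θ => fderiv ℝ (a x) θ w

variable {a b : X → Rn n → ℂ}

theorem Smooth2.dX (ha : Smooth2 a) (v : X) : Smooth2 (dX v a) :=
  (ContDiff.fderiv_fst ha).clm_apply contDiff_const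

theorem Smooth2.dT (ha : Smooth2 a) (w : Rn n) : Smooth2 (dT w a) :=
  (ContDiff.fderiv_snd ha).clm_apply contDiff_const

theorem Smooth2.fst (ha : Smooth2 a) (θ : Rn n) : ContDiff ℝ ∞ fun x => a x θ := ha.slice_fst θ

theorem Smooth2.snd (ha : Smooth2 a) (x : X) : ContDiff ℝ ∞ (a x) := ha.slice_snd x

theorem Smooth2.continuous (ha : Smooth2 a) : Continuous fun z : X × Rn n => a z.1 z.2 :=
  ContDiff.continuous ha

theorem Smooth2.dX_eq (ha : Smooth2 a) (v : X) (x : X) (θ : Rn n) :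
    _root_.dX v a x θ = fderiv ℝ (fun z : X × Rn n => a z.1 z.2) (x, θ) (v, 0) :=
  fderiv_slice_fst ha x θ v

theorem Smooth2.dT_eq (ha : Smooth2 a) (w : Rn n) (x : X) (θ : Rn n) :
    _root_.dT w a x θ = fderiv ℝ (fun z : X × Rn n => a z.1 z.2) (x, θ) (0, w) :=
  fderiv_slice_snd ha x θ w

theorem fderiv_fderiv_comm {E : Type*} [NormedAddCommGroup E] [NormedSpace ℝ E] {f : E → ℂ}
    (hf : ContDiff ℝ ∞ f) (v w x : E) :
    fderiv ℝ (fun y => fderiv ℝ f y v) x w = fderiv ℝ (fun y => fderiv ℝ f y w) x v := by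
  have hd : Differentiable ℝ (fderiv ℝ f) :=
    (hf.fderiv_right (m := ∞) (by simp)).differentiable (by simp)
  have key : ∀ u u' : E, fderiv ℝ (fun z => fderiv ℝ f z u') x u = fderiv ℝ (fderiv ℝ f) x u u' := by
    intro u u'
    rw [((hd x).hasFDerivAt.clm_apply (hasFDerivAt_const u' x)).fderiv]
    simp
  have h2 : minSmoothness ℝ 2 ≤ (∞ : WithTop ℕ∞) := by
    rw [minSmoothness_of_isRCLikeNormedField]; exact WithTop.coe_le_coe.2 le_top
  rw [key, key]
  exact (hf.contDiffAt.isSymmSndFDerivAt h2) _ _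

theorem Smooth2.dX_dX_comm (ha : Smooth2 a) (v v' : X) :
    _root_.dX v (_root_.dX v' a) = _root_.dX v' (_root_.dX v a) := by
  funext x θ
  exact fderiv_fderiv_comm (ha.fst θ) v' v x

theorem Smooth2.dT_dT_comm (ha : Smooth2 a) (w w' : Rn n) :
    _root_.dT w (_root_.dT w' a) = _root_.dT w' (_root_.dT w a) := by
  funext x θ
  exact fderiv_fderiv_comm (ha.snd x) w' w θ

theorem Smooth2.dX_dT_comm (ha : Smooth2 a) (v : X) (w : Rn n) :
    _root_.dX v (_root_.dT w a) = _root_.dT w (_root_.dX v a) := by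
  funext x θ
  have h := fderiv_fderiv_comm ha ((0, w) : X × Rn n) (v, 0) (x, θ)
  have h1 : (fun z : X × Rn n => _root_.dX v a z.1 z.2) =
      fun z => fderiv ℝ (fun z : X × Rn n => a z.1 z.2) z (v, 0) := by
    funext z; exact ha.dX_eq v z.1 z.2
  have h2 : (fun z : X × Rn n => _root_.dT w a z.1 z.2) =
      fun z => fderiv ℝ (fun z : X × Rn n => a z.1 z.2) z (0, w) := by
    funext z; exact ha.dT_eq w z.1 z.2
  rw [(ha.dT w).dX_eq, (ha.dX v).dT_eq, h1, h2, h]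

end Derivatives

/-! ### From partial derivatives to iterated Fréchet derivatives. -/

section IteratedBounds

variable {E F : Type} [NormedAddCommGroup E] [NormedSpace ℝ E] [NormedAddCommGroup F]
  [NormedSpace ℝ F]

/-- The derivative of `f` is the sum of its partial derivatives times the coordinate functionals.
The maps `Λ i` depend neither on `f` nor on `x`, so bounds on partial derivatives become bounds on
Fréchet derivatives. -/
theorem exists_iteratedFDeriv_succ_eq_sum [FiniteDimensional ℝ E] (k : ℕ) :
    ∃ Λ : Fin (Module.finrank ℝ E) → ((E [×k]→L[ℝ] F) →L[ℝ] (E [×(k + 1)]→L[ℝ] F)),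
      ∀ f : E → F, ContDiff ℝ ∞ f → ∀ x, iteratedFDeriv ℝ (k + 1) f x =
        ∑ i, Λ i (iteratedFDeriv ℝ k (fun y => fderiv ℝ f y (Module.finBasis ℝ E i)) x) := by
  set b := Module.finBasis ℝ E
  let L : Fin (Module.finrank ℝ E) → (F →L[ℝ] (E →L[ℝ] F)) := fun i =>
    ContinuousLinearMap.smulRightL ℝ E F (LinearMap.toContinuousLinearMap (b.coord i))
  let ρ : (E [×k]→L[ℝ] (E →L[ℝ] F)) →L[ℝ] (E [×(k + 1)]→L[ℝ] F) :=
    (continuousMultilinearCurryRightEquiv' ℝ k E F).symm.toContinuousLinearEquiv.toContinuousLinearMap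
  refine ⟨fun i => ρ ∘L (ContinuousLinearMap.compContinuousMultilinearMapL ℝ (fun _ : Fin k => E) F
          (E →L[ℝ] F) (L i)), fun f hf x => ?_⟩
  have hf' : ContDiff ℝ ∞ (fderiv ℝ f) := hf.fderiv_right (by simp)
  have h1 : (fun y => fderiv ℝ f y) = fun y => ∑ i, (L i ∘ fun y => fderiv ℝ f y (b i)) y := by
    funext y
    ext v
    conv_lhs => rw [← b.sum_repr v]
    simp only [map_sum, map_smul]
    simp [L]
  have hi : ∀ i, ContDiff ℝ ∞ fun y => fderiv ℝ f y (b i) := fun i => hf'.clm_apply contDiff_const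
  have h2 : iteratedFDeriv ℝ (k + 1) f x = ρ (iteratedFDeriv ℝ k (fun y => fderiv ℝ f y) x) :=
    iteratedFDeriv_succ_eq_comp_right
  rw [h2, h1, iteratedFDeriv_fun_sum_apply]
  · rw [map_sum]
    refine Finset.sum_congr rfl fun i _ => ?_
    rw [(L i).iteratedFDeriv_comp_left ((hi i).contDiffAt) (by exact_mod_cast le_top)]
    rfl
  · intro i _
    exact (((L i).contDiff.comp (hi i)).of_le (by exact_mod_cast le_top)).contDiffAt

/-- The codomain is quantified inside the induction because the step replaces `F` by `Θ →L[ℝ] F`. -/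
theorem ContDiff.iteratedFDeriv_fst_comm {X Θ : Type} [NormedAddCommGroup X] [NormedSpace ℝ X]
    [NormedAddCommGroup Θ] [NormedSpace ℝ Θ] (k : ℕ) :
    ∀ {F : Type} [NormedAddCommGroup F] [NormedSpace ℝ F] {a : X → Θ → F},
      (ContDiff ℝ ∞ fun z : X × Θ => a z.1 z.2) → ∀ (v x : X) (θ : Θ),
      iteratedFDeriv ℝ k (fun θ => fderiv ℝ (fun x => a x θ) x v) θ =
        fderiv ℝ (fun x => iteratedFDeriv ℝ k (a x) θ) x v := by
  induction k with
  | zero =>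
    intro F _ _ a ha v x θ
    simp only [iteratedFDeriv_zero_eq_comp, Function.comp_apply]
    have := (continuousMultilinearCurryFin0 ℝ Θ F).symm.toContinuousLinearEquiv.comp_fderiv
      (f := fun x => a x θ) (x := x)
    exact (congrArg (fun L : X →L[ℝ] _ => L v) this).symm
  | succ k ih =>
    intro F _ _ a ha v x θ
    simp only [iteratedFDeriv_succ_eq_comp_right, Function.comp_apply]
    have h1 := fun θ => fderiv_fderiv_slice_comm ha v x θ
    have h2 := ih (a := fun x θ => fderiv ℝ (a x) θ) (ContDiff.fderiv_snd ha) v x θ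
    have := (continuousMultilinearCurryRightEquiv' ℝ k Θ F).symm.toContinuousLinearEquiv.comp_fderiv
      (f := fun x => iteratedFDeriv ℝ k (fun θ => fderiv ℝ (a x) θ) θ) (x := x)
    simp only [h1, h2]
    exact (congrArg (fun L : X →L[ℝ] _ => L v) this).symm

end IteratedBounds

/-! ### Symbol estimates through directional derivatives. -/

section SymB

variable {X : Type} [NormedAddCommGroup X] [NormedSpace ℝ X] {n : ℕ}

/-- `a(x, θ)` is `O(⟨θ⟩^m)`, locally uniformly in `x`. -/
def SymBound (m : ℝ) (a : X → Rn n → ℂ) : Prop :=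
  ∀ r : ℝ, ∃ C : ℝ, ∀ x θ, ‖x‖ ≤ r → ‖a x θ‖ ≤ C * jb θ ^ m

/-- The symbol estimates of order `m` for the directional derivatives of order up to `N`. -/
def SymB : ℕ → ℝ → (X → Rn n → ℂ) → Prop
  | 0, m, a => SymBound m a
  | N + 1, m, a => SymBound m a ∧ (∀ v, SymB N m (dX v a)) ∧ ∀ w, SymB N (m - 1) (dT w a)

variable {a : X → Rn n → ℂ} {m : ℝ}

theorem IsSymbol.smooth (h : IsSymbol m a) : Smooth2 a := h.1

/-- A directional derivative is a fixed continuous linear image of the Fréchet derivative of one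
order more, and inherits its bound. -/
theorem IsSymbol.dX (h : IsSymbol m a) (v : X) : IsSymbol m (dX v a) := by
  refine ⟨h.smooth.dX v, fun j k K hK => ?_⟩
  obtain ⟨C, hC⟩ := h.2 (j + 1) k K hK
  refine ⟨‖ContinuousLinearMap.apply ℝ ((Rn n) [×k]→L[ℝ] ℂ) v‖ * C, fun x hx θ => ?_⟩
  have e : (fun x' => iteratedFDeriv ℝ k (_root_.dX v a x') θ) =
      ContinuousLinearMap.apply ℝ ((Rn n) [×k]→L[ℝ] ℂ) v ∘
        fderiv ℝ (fun x => iteratedFDeriv ℝ k (a x) θ) := by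
    funext x'
    exact ContDiff.iteratedFDeriv_fst_comm k h.smooth v x' θ
  have hs : ContDiff ℝ ∞ (fderiv ℝ (fun x => iteratedFDeriv ℝ k (a x) θ)) :=
    ((ContDiff.iteratedFDeriv_snd h.smooth k).slice_fst
      (a := fun x θ => iteratedFDeriv ℝ k (a x) θ) θ).fderiv_right (by simp)
  rw [e, mul_assoc]
  refine (ContinuousLinearMap.norm_iteratedFDeriv_comp_left _ (hs.contDiffAt)
    (by exact_mod_cast le_top)).trans ?_
  rw [norm_iteratedFDeriv_fderiv]
  gcongr
  exact hC x hx θ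

theorem IsSymbol.dT (h : IsSymbol m a) (w : Rn n) : IsSymbol (m - 1) (dT w a) := by
  refine ⟨h.smooth.dT w, fun j k K hK => ?_⟩
  obtain ⟨C, hC⟩ := h.2 j (k + 1) K hK
  let Λ := (ContinuousLinearMap.compContinuousMultilinearMapL ℝ (fun _ : Fin k => Rn n)
    (Rn n →L[ℝ] ℂ) ℂ (ContinuousLinearMap.apply ℝ ℂ w)) ∘L
      (continuousMultilinearCurryRightEquiv' ℝ k (Rn n) ℂ).toContinuousLinearEquiv.toContinuousLinearMap
  refine ⟨‖Λ‖ * C, fun x hx θ => ?_⟩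
  have e : (fun x' => iteratedFDeriv ℝ k (_root_.dT w a x') θ) =
      Λ ∘ fun x' => iteratedFDeriv ℝ (k + 1) (a x') θ := by
    funext x'
    have h1 : _root_.dT w a x' = ContinuousLinearMap.apply ℝ ℂ w ∘ fderiv ℝ (a x') := rfl
    have hs : ContDiff ℝ ∞ (fderiv ℝ (a x')) := (h.smooth.snd x').fderiv_right (by simp)
    rw [h1, ContinuousLinearMap.iteratedFDeriv_comp_left _ hs.contDiffAt
      (by exact_mod_cast le_top)]
    simp [Λ, iteratedFDeriv_succ_eq_comp_right]
  have hs : ContDiff ℝ ∞ (fun x => iteratedFDeriv ℝ (k + 1) (a x) θ) :=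
    (ContDiff.iteratedFDeriv_snd h.smooth (k + 1)).slice_fst
      (a := fun x θ => iteratedFDeriv ℝ (k + 1) (a x) θ) θ
  rw [e, mul_assoc]
  refine (ContinuousLinearMap.norm_iteratedFDeriv_comp_left _ (hs.contDiffAt)
    (by exact_mod_cast le_top)).trans ?_
  gcongr
  have := hC x hx θ
  rwa [show m - ((k + 1 : ℕ) : ℝ) = m - 1 - k by push_cast; ring] at this

variable [FiniteDimensional ℝ X]

theorem IsSymbol.symBound (h : IsSymbol m a) : SymBound m a := by
  intro r
  have : ProperSpace X := FiniteDimensional.proper ℝ X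
  obtain ⟨C, hC⟩ := h.2 0 0 (Metric.closedBall 0 r) (isCompact_closedBall 0 r)
  refine ⟨C, fun x θ hx => ?_⟩
  simpa [jb] using hC x (by simpa using hx) θ

theorem IsSymbol.symB (h : IsSymbol m a) (N : ℕ) : SymB N m a := by
  induction N generalizing m a with
  | zero => exact h.symBound
  | succ N ih => exact ⟨h.symBound, fun v => ih (h.dX v), fun w => ih (h.dT w)⟩

theorem exists_bound_iteratedFDeriv_of_closed {S : ℝ → (X → Rn n → ℂ) → Prop}
    (hs : ∀ m a, S m a → Smooth2 a) (hb : ∀ m a, S m a → SymBound m a)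
    (hX : ∀ m a, S m a → ∀ i, S m (dX (Module.finBasis ℝ X i) a))
    (h : S m a) (j : ℕ) (r : ℝ) :
    ∃ C : ℝ, ∀ x θ, ‖x‖ ≤ r → ‖iteratedFDeriv ℝ j (fun x' => a x' θ) x‖ ≤ C * jb θ ^ m := by
  induction j generalizing a with
  | zero => simpa using hb m a h r
  | succ j ih =>
    obtain ⟨Λ, hΛ⟩ := exists_iteratedFDeriv_succ_eq_sum (E := X) (F := ℂ) j
    choose C hC using fun i => ih (hX m a h i)
    refine ⟨∑ i, ‖Λ i‖ * C i, fun x θ hx => ?_⟩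
    rw [hΛ _ ((hs m a h).fst θ), Finset.sum_mul]
    refine (norm_sum_le _ _).trans (Finset.sum_le_sum fun i _ => ?_)
    refine ((Λ i).le_opNorm _).trans ?_
    rw [mul_assoc]
    gcongr
    exact hC i x θ hx

/-- Each θ-derivative is expanded in partial derivatives, which stay in the class with order lowered
by one; the x-derivatives are then handled by `exists_bound_iteratedFDeriv_of_closed`. -/
theorem exists_bound_iteratedFDeriv_iteratedFDeriv_of_closed {S : ℝ → (X → Rn n → ℂ) → Prop}
    (hs : ∀ m a, S m a → Smooth2 a) (hb : ∀ m a, S m a → SymBound m a)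
    (hX : ∀ m a, S m a → ∀ i, S m (dX (Module.finBasis ℝ X i) a))
    (hT : ∀ m a, S m a → ∀ i, S (m - 1) (dT (Module.finBasis ℝ (Rn n) i) a))
    (h : S m a) (j k : ℕ) (r : ℝ) :
    ∃ C : ℝ, ∀ x θ, ‖x‖ ≤ r →
      ‖iteratedFDeriv ℝ j (fun x' => iteratedFDeriv ℝ k (a x') θ) x‖ ≤ C * jb θ ^ (m - k) := by
  induction k generalizing a m with
  | zero =>
    obtain ⟨C, hC⟩ := exists_bound_iteratedFDeriv_of_closed hs hb hX h j r
    refine ⟨C, fun x θ hx => ?_⟩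
    simp only [iteratedFDeriv_zero_eq_comp, Function.comp_apply]
    have := (continuousMultilinearCurryFin0 ℝ (Rn n) ℂ).symm.norm_iteratedFDeriv_comp_left
      (fun x' => a x' θ) x j
    simp only [Function.comp_def] at this
    rw [this]
    simpa using hC x θ hx
  | succ k ih =>
    obtain ⟨Λ, hΛ⟩ := exists_iteratedFDeriv_succ_eq_sum (E := Rn n) (F := ℂ) k
    choose C hC using fun i => ih (hT m a h i)
    refine ⟨∑ i, ‖Λ i‖ * C i, fun x θ hx => ?_⟩
    have ha := hs m a h
    have hd : ∀ i, ContDiff ℝ ∞ fun x' =>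
        iteratedFDeriv ℝ k (dT (Module.finBasis ℝ (Rn n) i) a x') θ := fun i =>
      (ContDiff.iteratedFDeriv_snd (ha.dT _) k).slice_fst
        (a := fun x θ => iteratedFDeriv ℝ k (dT _ a x) θ) θ
    have e : (fun x' => iteratedFDeriv ℝ (k + 1) (a x') θ) = fun x' => ∑ i, (Λ i ∘ fun x' =>
        iteratedFDeriv ℝ k (dT (Module.finBasis ℝ (Rn n) i) a x') θ) x' := by
      funext x'
      exact hΛ _ (ha.snd x') θ
    rw [e, Finset.sum_mul, iteratedFDeriv_fun_sum_apply]
    · refine (norm_sum_le _ _).trans (Finset.sum_le_sum fun i _ => ?_)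
      refine (ContinuousLinearMap.norm_iteratedFDeriv_comp_left _ (hd i).contDiffAt
        (by exact_mod_cast le_top)).trans ?_
      rw [mul_assoc]
      gcongr
      have := hC i x θ hx
      rwa [show m - 1 - (k : ℝ) = m - ((k + 1 : ℕ) : ℝ) by push_cast; ring] at this
    · intro i _
      exact (((Λ i).contDiff.comp (hd i)).of_le (by exact_mod_cast le_top)).contDiffAt

/-- Coinduction for symbols: a class of functions of given orders whose members satisfy the symbol
estimate of order zero and that is closed under derivatives consists of symbols. -/
theorem isSymbol_of_closed_basis {S : ℝ → (X → Rn n → ℂ) → Prop}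
    (hs : ∀ m a, S m a → Smooth2 a) (hb : ∀ m a, S m a → SymBound m a)
    (hX : ∀ m a, S m a → ∀ i, S m (dX (Module.finBasis ℝ X i) a))
    (hT : ∀ m a, S m a → ∀ i, S (m - 1) (dT (Module.finBasis ℝ (Rn n) i) a))
    (h : S m a) : IsSymbol m a := by
  refine ⟨hs m a h, fun j k K hK => ?_⟩
  obtain ⟨r, hr⟩ := hK.isBounded.exists_norm_le
  obtain ⟨C, hC⟩ := exists_bound_iteratedFDeriv_iteratedFDeriv_of_closed hs hb hX hT h j k r
  exact ⟨C, fun x hx θ => hC x θ (hr x hx)⟩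

theorem isSymbol_of_symB (ha : Smooth2 a) (h : ∀ N, SymB N m a) : IsSymbol m a :=
  isSymbol_of_closed_basis (S := fun m a => Smooth2 a ∧ ∀ N, SymB N m a) (fun _ _ h => h.1)
    (fun _ _ h => h.2 0) (fun _ _ h _ => ⟨h.1.dX _, fun N => (h.2 (N + 1)).2.1 _⟩)
    (fun _ _ h _ => ⟨h.1.dT _, fun N => (h.2 (N + 1)).2.2 _⟩) ⟨ha, h⟩

theorem isSymbol_of_closed {S : ℝ → (X → Rn n → ℂ) → Prop}
    (hs : ∀ m a, S m a → Smooth2 a) (hb : ∀ m a, S m a → SymBound m a)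
    (hX : ∀ m a, S m a → ∀ v, S m (dX v a)) (hT : ∀ m a, S m a → ∀ w, S (m - 1) (dT w a))
    (h : S m a) : IsSymbol m a :=
  isSymbol_of_closed_basis hs hb (fun m a h _ => hX m a h _) (fun m a h _ => hT m a h _) h

end SymB

/-! ### Leibniz rules, finite-order estimates and eventually homogeneous functions. -/

section Algebra

variable {X X' : Type} [NormedAddCommGroup X] [NormedSpace ℝ X] [NormedAddCommGroup X']
  [NormedSpace ℝ X'] {n : ℕ}

/-- The complex conjugate of a symbol. -/
def cj (a : X → Rn n → ℂ) : X → Rn n → ℂ := fun x θ => (starRingEnd ℂ) (a x θ)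

/-- The pullback of a symbol under a linear map of the base. -/
def pull (L : X' →L[ℝ] X) (a : X → Rn n → ℂ) : X' → Rn n → ℂ := fun x θ => a (L x) θ

/-- A function of `x` as a symbol. -/
def base (n : ℕ) (f : X → ℂ) : X → Rn n → ℂ := fun x _ => f x

/-- A function of `θ` as a symbol. -/
def fiber (X : Type) (f : Rn n → ℂ) : X → Rn n → ℂ := fun _ θ => f θ

variable {a b : X → Rn n → ℂ} {m m' : ℝ}

theorem Smooth2.diff_fst (ha : Smooth2 a) (x : X) (θ : Rn n) :
    DifferentiableAt ℝ (fun x => a x θ) x := (ha.fst θ).differentiable (by simp) x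

theorem Smooth2.diff_snd (ha : Smooth2 a) (x : X) (θ : Rn n) : DifferentiableAt ℝ (a x) θ :=
  (ha.snd x).differentiable (by simp) θ

theorem Smooth2.add (ha : Smooth2 a) (hb : Smooth2 b) : Smooth2 (a + b) := ContDiff.add ha hb

theorem Smooth2.neg (ha : Smooth2 a) : Smooth2 (-a) := ContDiff.neg ha

theorem Smooth2.sub (ha : Smooth2 a) (hb : Smooth2 b) : Smooth2 (a - b) := ContDiff.sub ha hb

theorem Smooth2.mul (ha : Smooth2 a) (hb : Smooth2 b) : Smooth2 (a * b) := ContDiff.mul ha hb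

theorem Smooth2.cj (ha : Smooth2 a) : Smooth2 (cj a) :=
  Complex.conjCLE.contDiff.comp ha

theorem Smooth2.pull (ha : Smooth2 a) (L : X' →L[ℝ] X) : Smooth2 (pull L a) :=
  ContDiff.comp ha ((L.contDiff.comp contDiff_fst).prodMk contDiff_snd)

theorem smooth2_base {f : X → ℂ} (hf : ContDiff ℝ ∞ f) : Smooth2 (base n f) := hf.comp contDiff_fst

theorem smooth2_fiber {f : Rn n → ℂ} (hf : ContDiff ℝ ∞ f) : Smooth2 (fiber X f) :=
  hf.comp contDiff_snd

theorem smooth2_zero : Smooth2 (0 : X → Rn n → ℂ) := contDiff_const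

theorem Smooth2.const_smul (ha : Smooth2 a) (c : ℂ) : Smooth2 (c • a) :=
  ContDiff.const_smul c ha

theorem Smooth2.sum {ι : Type*} {s : Finset ι} {f : ι → X → Rn n → ℂ}
    (h : ∀ i ∈ s, Smooth2 (f i)) : Smooth2 (∑ i ∈ s, f i) := by
  classical
  induction s using Finset.induction_on with
  | empty => simpa using smooth2_zero
  | insert i s hi ih =>
    rw [Finset.sum_insert hi]
    exact (h i (by simp)).add (ih fun j hj => h j (by simp [hj]))

theorem dX_add (ha : Smooth2 a) (hb : Smooth2 b) (v : X) : dX v (a + b) = dX v a + dX v b := by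
  funext x θ
  have := fderiv_add (ha.diff_fst x θ) (hb.diff_fst x θ)
  exact congrArg (fun L : X →L[ℝ] ℂ => L v) this

theorem dT_add (ha : Smooth2 a) (hb : Smooth2 b) (w : Rn n) : dT w (a + b) = dT w a + dT w b := by
  funext x θ
  have := fderiv_add (ha.diff_snd x θ) (hb.diff_snd x θ)
  exact congrArg (fun L : Rn n →L[ℝ] ℂ => L w) this

theorem dX_const_smul (ha : Smooth2 a) (c : ℂ) (v : X) : dX v (c • a) = c • dX v a := by
  funext x θ
  have := fderiv_const_smul (ha.diff_fst x θ) c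
  exact congrArg (fun L : X →L[ℝ] ℂ => L v) this

theorem dT_const_smul (ha : Smooth2 a) (c : ℂ) (w : Rn n) : dT w (c • a) = c • dT w a := by
  funext x θ
  have := fderiv_const_smul (ha.diff_snd x θ) c
  exact congrArg (fun L : Rn n →L[ℝ] ℂ => L w) this

theorem dX_zero (v : X) : dX v (0 : X → Rn n → ℂ) = 0 := by
  funext x θ; simp [dX]

theorem dT_zero (w : Rn n) : dT w (0 : X → Rn n → ℂ) = 0 := by
  funext x θ; simp [dT]

theorem neg_eq_smul (a : X → Rn n → ℂ) : -a = (-1 : ℂ) • a := by simp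

theorem dX_neg (ha : Smooth2 a) (v : X) : dX v (-a) = -dX v a := by
  rw [neg_eq_smul, dX_const_smul ha, ← neg_eq_smul]

theorem dT_neg (ha : Smooth2 a) (w : Rn n) : dT w (-a) = -dT w a := by
  rw [neg_eq_smul, dT_const_smul ha, ← neg_eq_smul]

theorem dX_sub (ha : Smooth2 a) (hb : Smooth2 b) (v : X) : dX v (a - b) = dX v a - dX v b := by
  rw [sub_eq_add_neg, dX_add ha hb.neg, dX_neg hb, sub_eq_add_neg]

theorem dT_sub (ha : Smooth2 a) (hb : Smooth2 b) (w : Rn n) : dT w (a - b) = dT w a - dT w b := by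
  rw [sub_eq_add_neg, dT_add ha hb.neg, dT_neg hb, sub_eq_add_neg]

theorem dX_sum {ι : Type*} {s : Finset ι} {f : ι → X → Rn n → ℂ}
    (h : ∀ i ∈ s, Smooth2 (f i)) (v : X) : dX v (∑ i ∈ s, f i) = ∑ i ∈ s, dX v (f i) := by
  classical
  induction s using Finset.induction_on with
  | empty => simpa using dX_zero v
  | insert i s hi ih =>
    rw [Finset.sum_insert hi, Finset.sum_insert hi, dX_add (h i (by simp))
      (Smooth2.sum fun j hj => h j (by simp [hj])), ih fun j hj => h j (by simp [hj])]

theorem dT_sum {ι : Type*} {s : Finset ι} {f : ι → X → Rn n → ℂ}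
    (h : ∀ i ∈ s, Smooth2 (f i)) (w : Rn n) : dT w (∑ i ∈ s, f i) = ∑ i ∈ s, dT w (f i) := by
  classical
  induction s using Finset.induction_on with
  | empty => simpa using dT_zero w
  | insert i s hi ih =>
    rw [Finset.sum_insert hi, Finset.sum_insert hi, dT_add (h i (by simp))
      (Smooth2.sum fun j hj => h j (by simp [hj])), ih fun j hj => h j (by simp [hj])]

theorem dX_mul (ha : Smooth2 a) (hb : Smooth2 b) (v : X) :
    dX v (a * b) = dX v a * b + a * dX v b := by
  funext x θ
  have := fderiv_mul (ha.diff_fst x θ) (hb.diff_fst x θ)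
  refine (congrArg (fun L : X →L[ℝ] ℂ => L v) this).trans ?_
  simp only [dX, Pi.add_apply, Pi.mul_apply, add_apply,
    smul_apply, smul_eq_mul]
  ring

theorem dT_mul (ha : Smooth2 a) (hb : Smooth2 b) (w : Rn n) :
    dT w (a * b) = dT w a * b + a * dT w b := by
  funext x θ
  have := fderiv_mul (ha.diff_snd x θ) (hb.diff_snd x θ)
  refine (congrArg (fun L : Rn n →L[ℝ] ℂ => L w) this).trans ?_
  simp only [dT, Pi.add_apply, Pi.mul_apply, add_apply,
    smul_apply, smul_eq_mul]
  ring

theorem dX_cj (a : X → Rn n → ℂ) (v : X) : dX v (cj a) = cj (dX v a) := by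
  funext x θ
  have := Complex.conjCLE.comp_fderiv (f := fun x => a x θ) (x := x)
  exact congrArg (fun L : X →L[ℝ] ℂ => L v) this

theorem dT_cj (a : X → Rn n → ℂ) (w : Rn n) : dT w (cj a) = cj (dT w a) := by
  funext x θ
  have := Complex.conjCLE.comp_fderiv (f := a x) (x := θ)
  exact congrArg (fun L : Rn n →L[ℝ] ℂ => L w) this

theorem dX_pull (ha : Smooth2 a) (L : X' →L[ℝ] X) (v : X') :
    dX v (pull L a) = pull L (dX (L v) a) := by
  funext x θ
  have h := (ha.diff_fst (L x) θ).hasFDerivAt.comp x L.hasFDerivAt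
  exact congrArg (fun L : X' →L[ℝ] ℂ => L v) h.fderiv

theorem dT_pull (L : X' →L[ℝ] X) (w : Rn n) : dT w (pull L a) = pull L (dT w a) := rfl

theorem dX_base (f : X → ℂ) (v : X) : dX v (base n f) = base n (fun x => fderiv ℝ f x v) := rfl

theorem dT_base (f : X → ℂ) (w : Rn n) : dT w (base n f) = 0 := by
  funext x θ; simp only [dT]; exact congrArg (fun L : Rn n →L[ℝ] ℂ => L w) (fderiv_const_apply (f x))

theorem SymBound.mono (h : SymBound m a) (hm : m ≤ m') : SymBound m' a := by
  intro r
  obtain ⟨C, hC⟩ := h r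
  refine ⟨|C|, fun x θ hx => (hC x θ hx).trans ?_⟩
  have := jb_rpow_pos θ m
  exact mul_le_mul (le_abs_self C) (jb_rpow_le_rpow θ hm) this.le (abs_nonneg C)

theorem SymBound.add (ha : SymBound m a) (hb : SymBound m b) : SymBound m (a + b) := by
  intro r
  obtain ⟨C, hC⟩ := ha r
  obtain ⟨D, hD⟩ := hb r
  refine ⟨C + D, fun x θ hx => ?_⟩
  rw [add_mul]
  exact (norm_add_le _ _).trans (add_le_add (hC x θ hx) (hD x θ hx))

theorem SymBound.mul (ha : SymBound m a) (hb : SymBound m' b) : SymBound (m + m') (a * b) := by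
  intro r
  obtain ⟨C, hC⟩ := ha r
  obtain ⟨D, hD⟩ := hb r
  refine ⟨C * D, fun x θ hx => ?_⟩
  rw [Real.rpow_add (jb_pos θ)]
  have := mul_le_mul (hC x θ hx) (hD x θ hx) (norm_nonneg _) ((norm_nonneg _).trans (hC x θ hx))
  rw [Pi.mul_apply, Pi.mul_apply, norm_mul]
  linarith

theorem SymB.mono {N : ℕ} (h : SymB N m a) (hm : m ≤ m') : SymB N m' a := by
  induction N generalizing m m' a with
  | zero => exact SymBound.mono h hm
  | succ N ih => exact ⟨h.1.mono hm, fun v => ih (h.2.1 v) hm, fun w => ih (h.2.2 w) (by linarith)⟩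

theorem SymB.of_succ {N : ℕ} (h : SymB (N + 1) m a) : SymB N m a := by
  induction N generalizing m a with
  | zero => exact h.1
  | succ N ih => exact ⟨h.1, fun v => ih (h.2.1 v), fun w => ih (h.2.2 w)⟩

theorem SymB.add {N : ℕ} (sa : Smooth2 a) (sb : Smooth2 b) (ha : SymB N m a) (hb : SymB N m b) :
    SymB N m (a + b) := by
  induction N generalizing m a b with
  | zero => exact SymBound.add ha hb
  | succ N ih =>
    refine ⟨ha.1.add hb.1, fun v => ?_, fun w => ?_⟩
    · rw [dX_add sa sb]; exact ih (sa.dX v) (sb.dX v) (ha.2.1 v) (hb.2.1 v)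
    · rw [dT_add sa sb]; exact ih (sa.dT w) (sb.dT w) (ha.2.2 w) (hb.2.2 w)

/-- Leibniz and induction on `N`: the factor that is not differentiated loses one level through
`SymB.of_succ`. -/
theorem SymB.mul {N : ℕ} (sa : Smooth2 a) (sb : Smooth2 b) (ha : SymB N m a) (hb : SymB N m' b) :
    SymB N (m + m') (a * b) := by
  induction N generalizing m m' a b with
  | zero => exact SymBound.mul ha hb
  | succ N ih =>
    refine ⟨ha.1.mul hb.1, fun v => ?_, fun w => ?_⟩
    · rw [dX_mul sa sb]
      exact SymB.add ((sa.dX v).mul sb) (sa.mul (sb.dX v))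
        (ih (sa.dX v) sb (ha.2.1 v) hb.of_succ) (ih sa (sb.dX v) ha.of_succ (hb.2.1 v))
    · rw [dT_mul sa sb]
      have h1 := ih (sa.dT w) sb (ha.2.2 w) hb.of_succ
      have h2 := ih sa (sb.dT w) ha.of_succ (hb.2.2 w)
      rw [show m - 1 + m' = m + m' - 1 by ring] at h1
      rw [show m + (m' - 1) = m + m' - 1 by ring] at h2
      exact SymB.add ((sa.dT w).mul sb) (sa.mul (sb.dT w)) h1 h2

theorem SymB.cj {N : ℕ} (ha : SymB N m a) : SymB N m (cj a) := by
  induction N generalizing m a with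
  | zero => simpa [SymB, SymBound, _root_.cj] using ha
  | succ N ih =>
    refine ⟨by simpa [SymBound, _root_.cj] using ha.1, fun v => ?_, fun w => ?_⟩
    · rw [dX_cj]; exact ih (ha.2.1 v)
    · rw [dT_cj]; exact ih (ha.2.2 w)

theorem SymBound.pull (ha : SymBound m a) (L : X' →L[ℝ] X) : SymBound m (pull L a) := by
  intro r
  obtain ⟨C, hC⟩ := ha (‖L‖ * r)
  exact ⟨C, fun x θ hx => hC _ θ ((L.le_opNorm x).trans (by gcongr))⟩

theorem SymB.pull {N : ℕ} (sa : Smooth2 a) (ha : SymB N m a) (L : X' →L[ℝ] X) :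
    SymB N m (pull L a) := by
  induction N generalizing m a with
  | zero => exact SymBound.pull ha L
  | succ N ih =>
    refine ⟨ha.1.pull L, fun v => ?_, fun w => ?_⟩
    · rw [dX_pull sa]; exact ih (sa.dX _) (ha.2.1 (L v))
    · rw [dT_pull]; exact ih (sa.dT w) (ha.2.2 w)

/-- Smooth functions that are homogeneous of degree `μ` in `ξ` for large `ξ`. -/
def EvHom (μ : ℝ) (s : X → Rn n → ℂ) : Prop :=
  Smooth2 s ∧ ∃ ρ : ℝ, 0 < ρ ∧ ∀ x ξ (t : ℝ), ρ < ‖ξ‖ → 1 ≤ t →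
    s x (t • ξ) = ((t ^ μ : ℝ) : ℂ) * s x ξ

theorem EvHom.smooth (h : EvHom m a) : Smooth2 a := h.1

/-- A function of bounded support in ξ is eventually homogeneous of every degree, since both sides
vanish. With `EvHom.isSymbol` this is the standard way below to see that an error is in S^{-∞}. -/
theorem EvHom.of_support (ha : Smooth2 a) {ρ : ℝ} (hρ : 0 < ρ)
    (h : ∀ x ξ, ρ < ‖ξ‖ → a x ξ = 0) : EvHom m a := by
  refine ⟨ha, ρ, hρ, fun x ξ t hξ ht => ?_⟩
  rw [h x ξ hξ, h x (t • ξ), mul_zero]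
  rw [norm_smul, Real.norm_eq_abs, abs_of_nonneg (by linarith)]
  nlinarith [norm_nonneg ξ]

theorem EvHom.dX (h : EvHom m a) (v : X) : EvHom m (dX v a) := by
  obtain ⟨hs, ρ, hρ, h⟩ := h
  refine ⟨hs.dX v, ρ, hρ, fun x ξ t hξ ht => ?_⟩
  have e : (fun x => a x (t • ξ)) = fun x => ((t ^ m : ℝ) : ℂ) • a x ξ := by
    funext x; exact h x ξ t hξ ht
  have := fderiv_const_smul (hs.diff_fst x ξ) ((t ^ m : ℝ) : ℂ)
  simp only [_root_.dX, e]
  exact congrArg (fun L : X →L[ℝ] ℂ => L v) this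

/-- Differentiating s(x,tθ) = t^m s(x,θ) in θ produces an extra factor t on the left. -/
theorem EvHom.dT (h : EvHom m a) (w : Rn n) : EvHom (m - 1) (dT w a) := by
  obtain ⟨hs, ρ, hρ, h⟩ := h
  refine ⟨hs.dT w, ρ, hρ, fun x ξ t hξ ht => ?_⟩
  have ht0 : 0 < t := by linarith
  have e : (fun θ => a x (t • θ)) =ᶠ[𝓝 ξ] fun θ => ((t ^ m : ℝ) : ℂ) • a x θ := by
    filter_upwards [(isOpen_lt continuous_const continuous_norm).mem_nhds hξ] with θ hθ
    exact h x θ t hθ ht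
  have h1 : HasFDerivAt (fun θ => a x (t • θ)) _ ξ :=
    HasFDerivAt.comp ξ (hs.diff_snd x (t • ξ)).hasFDerivAt
    ((hasFDerivAt_id ξ).const_smul t)
  have h2 := (hs.diff_snd x ξ).hasFDerivAt.const_smul ((t ^ m : ℝ) : ℂ)
  have h3 := congrArg (fun L : Rn n →L[ℝ] ℂ => L w) (h1.unique (h2.congr_of_eventuallyEq e))
  simp only [ContinuousLinearMap.comp_apply, smul_apply,
    ContinuousLinearMap.id_apply, map_smul, Complex.real_smul, smul_eq_mul] at h3
  have ht' : (t : ℂ) ≠ 0 := by exact_mod_cast ht0.ne'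
  change fderiv ℝ (a x) (t • ξ) w = ((t ^ (m - 1) : ℝ) : ℂ) * fderiv ℝ (a x) ξ w
  rw [Real.rpow_sub_one ht0.ne']
  push_cast
  field_simp
  rw [mul_comm, h3]

end Algebra

/-! ### The algebra of symbols. -/

section SymbolAlgebra

variable {X X' : Type} [NormedAddCommGroup X] [NormedSpace ℝ X] [FiniteDimensional ℝ X]
  [NormedAddCommGroup X'] [NormedSpace ℝ X'] [FiniteDimensional ℝ X'] {n : ℕ}
  {a b : X → Rn n → ℂ} {m m' : ℝ}

theorem IsSymbol.mono (h : IsSymbol m a) (hm : m ≤ m') : IsSymbol m' a :=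
  isSymbol_of_symB h.smooth fun N => (h.symB N).mono hm

theorem IsSymbol.add (ha : IsSymbol m a) (hb : IsSymbol m b) : IsSymbol m (a + b) :=
  isSymbol_of_symB (ha.smooth.add hb.smooth) fun N => (ha.symB N).add ha.smooth hb.smooth (hb.symB N)

theorem IsSymbol.mul (ha : IsSymbol m a) (hb : IsSymbol m' b) : IsSymbol (m + m') (a * b) :=
  isSymbol_of_symB (ha.smooth.mul hb.smooth) fun N => (ha.symB N).mul ha.smooth hb.smooth (hb.symB N)

theorem IsSymbol.cj (ha : IsSymbol m a) : IsSymbol m (cj a) :=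
  isSymbol_of_symB ha.smooth.cj fun N => (ha.symB N).cj

theorem IsSymbol.pull (ha : IsSymbol m a) (L : X' →L[ℝ] X) : IsSymbol m (pull L a) :=
  isSymbol_of_symB (ha.smooth.pull L) fun N => (ha.symB N).pull ha.smooth L

theorem isSymbol_zero : IsSymbol m (0 : X → Rn n → ℂ) :=
  isSymbol_of_closed (S := fun _ a => a = 0) (by rintro _ _ rfl; exact smooth2_zero)
    (by rintro _ _ rfl r; exact ⟨0, by simp⟩) (by rintro _ _ rfl v; exact dX_zero v)
    (by rintro _ _ rfl w; exact dT_zero w) rfl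

theorem isSymbol_base {f : X → ℂ} (hf : ContDiff ℝ ∞ f) : IsSymbol 0 (base n f) := by
  refine isSymbol_of_closed
    (S := fun m a => a = 0 ∨ (m = 0 ∧ ∃ f : X → ℂ, ContDiff ℝ ∞ f ∧ a = base n f)) ?_ ?_ ?_ ?_
    (Or.inr ⟨rfl, f, hf, rfl⟩)
  · rintro m a (rfl | ⟨rfl, f, hf, rfl⟩)
    exacts [smooth2_zero, smooth2_base hf]
  · rintro m a (rfl | ⟨rfl, f, hf, rfl⟩)
    · exact isSymbol_zero.symBound
    · intro r
      have : ProperSpace X := FiniteDimensional.proper ℝ X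
      obtain ⟨C, hC⟩ := (isCompact_closedBall (0 : X) r).exists_bound_of_continuousOn
        hf.continuous.continuousOn
      exact ⟨C, fun x θ hx => by simpa [base] using hC x (by simpa using hx)⟩
  · rintro m a (rfl | ⟨rfl, f, hf, rfl⟩) v
    · exact Or.inl (dX_zero v)
    · exact Or.inr ⟨rfl, _, (hf.fderiv_right (m := ∞) (by simp)).clm_apply contDiff_const,
        dX_base f v⟩
  · rintro m a (rfl | ⟨rfl, f, hf, rfl⟩) w
    · exact Or.inl (dT_zero w)
    · exact Or.inl (dT_base f w)

theorem IsSymbol.base_mul (ha : IsSymbol m a) {f : X → ℂ} (hf : ContDiff ℝ ∞ f) :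
    IsSymbol m (base n f * a) := by
  simpa using (isSymbol_base (n := n) hf).mul ha

theorem IsSymbol.const_smul (ha : IsSymbol m a) (c : ℂ) : IsSymbol m (c • a) :=
  ha.base_mul (f := fun _ => c) contDiff_const

theorem IsSymbol.neg (ha : IsSymbol m a) : IsSymbol m (-a) := by
  rw [neg_eq_smul]; exact ha.const_smul _

theorem IsSymbol.sub (ha : IsSymbol m a) (hb : IsSymbol m b) : IsSymbol m (a - b) := by
  rw [sub_eq_add_neg]; exact ha.add hb.neg

theorem IsSymbol.sum {ι : Type*} {s : Finset ι} {f : ι → X → Rn n → ℂ}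
    (h : ∀ i ∈ s, IsSymbol m (f i)) : IsSymbol m (∑ i ∈ s, f i) := by
  classical
  induction s using Finset.induction_on with
  | empty => simpa using isSymbol_zero
  | insert i s hi ih =>
    rw [Finset.sum_insert hi]
    exact (h i (by simp)).add (ih fun j hj => h j (by simp [hj]))

/-- For |θ| ≤ 2ρ the bound is compactness; a larger θ is t times a point of the sphere of radius 2ρ,
and homogeneity transports the bound. The radius 2ρ is used because homogeneity is only known
strictly outside radius ρ. -/
theorem EvHom.symBound (h : EvHom m a) : SymBound m a := by
  obtain ⟨hs, ρ, hρ, h⟩ := h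
  intro r
  have : ProperSpace X := FiniteDimensional.proper ℝ X
  obtain ⟨M, hM⟩ := ((isCompact_closedBall (0 : X) r).prod
    (isCompact_closedBall (0 : Rn n) (2 * ρ))).exists_bound_of_continuousOn
    (f := fun z : X × Rn n => ((jb z.2 ^ (-m) : ℝ) : ℂ) * a z.1 z.2)
    ((Complex.continuous_ofReal.comp ((continuous_jb_rpow (-m)).comp continuous_snd)).mul
      hs.continuous).continuousOn
  have hM' : ∀ x θ, ‖x‖ ≤ r → ‖θ‖ ≤ 2 * ρ → ‖a x θ‖ ≤ M * jb θ ^ m := by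
    intro x θ hx hθ
    have := hM (x, θ) ⟨by simpa using hx, by simpa using hθ⟩
    rw [norm_mul, Complex.norm_real, Real.norm_of_nonneg (jb_rpow_pos _ _).le,
      Real.rpow_neg (jb_pos _).le, inv_mul_le_iff₀ (jb_rpow_pos _ _)] at this
    linarith
  set c : ℝ := Real.sqrt (1 + (2 * ρ) ^ 2) / (2 * ρ) with hc
  have hc1 : 1 ≤ c := by
    rw [hc, one_le_div (by positivity)]
    exact Real.le_sqrt_of_sq_le (by linarith)
  -- The constant `c` compares t⟨u0⟩ with ⟨tu0⟩ when |u0| = 2ρ and t ≥ 1; the exponent |m| covers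
  -- both signs of m.
  refine ⟨|M| * c ^ |m|, fun x θ hx => ?_⟩
  have hcm : 1 ≤ c ^ |m| := Real.one_le_rpow hc1 (abs_nonneg m)
  have pθ := jb_rpow_pos θ m
  by_cases hθ : ‖θ‖ ≤ 2 * ρ
  · refine (hM' x θ hx hθ).trans ?_
    gcongr
    exact (le_abs_self M).trans (le_mul_of_one_le_right (abs_nonneg M) hcm)
  · push Not at hθ
    set t : ℝ := ‖θ‖ / (2 * ρ) with ht
    have ht1 : 1 ≤ t := by rw [ht, one_le_div (by positivity)]; exact hθ.le
    have ht0 : 0 < t := by linarith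
    set u0 : Rn n := t⁻¹ • θ with hu0
    have hun : ‖u0‖ = 2 * ρ := by
      have : 0 < ‖θ‖ := by linarith
      rw [hu0, norm_smul, norm_inv, Real.norm_of_nonneg ht0.le, ht]
      field_simp
    have hθu0 : θ = t • u0 := by rw [hu0, smul_smul, mul_inv_cancel₀ ht0.ne', one_smul]
    have h1 := h x u0 t (by rw [hun]; linarith) ht1
    rw [← hθu0] at h1
    rw [h1, norm_mul, Complex.norm_real, Real.norm_of_nonneg (by positivity)]
    have h2 := hM' x u0 hx hun.le
    have hju0 : jb u0 = c * (2 * ρ) := by rw [hc, jb, hun]; field_simp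
    have pu0 := jb_pos u0
    have l1 : jb θ ≤ t * jb u0 := by
      rw [jb, Real.sqrt_le_left (by positivity), mul_pow, jb_sq, hθu0, norm_smul,
        Real.norm_of_nonneg ht0.le]
      nlinarith
    have l2 : t * jb u0 ≤ c * jb θ := by
      have := norm_le_jb θ
      rw [hθu0, norm_smul, Real.norm_of_nonneg ht0.le, hun, ← hθu0] at this
      rw [hju0]; nlinarith
    have l3 : (t * jb u0) ^ m ≤ c ^ |m| * jb θ ^ m := by
      rcases le_total 0 m with hm | hm
      · rw [abs_of_nonneg hm, ← Real.mul_rpow (by linarith) (jb_pos θ).le]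
        exact Real.rpow_le_rpow (by positivity) l2 hm
      · refine (Real.rpow_le_rpow_of_nonpos (jb_pos θ) l1 hm).trans ?_
        exact le_mul_of_one_le_left pθ.le hcm
    calc t ^ m * ‖a x u0‖ ≤ t ^ m * (M * jb u0 ^ m) := by gcongr
      _ ≤ t ^ m * (|M| * jb u0 ^ m) := by
        have := le_abs_self M
        have := jb_rpow_pos u0 m
        gcongr
      _ = |M| * (t * jb u0) ^ m := by rw [Real.mul_rpow ht0.le pu0.le]; ring
      _ ≤ |M| * (c ^ |m| * jb θ ^ m) := by gcongr
      _ = _ := by ring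

theorem EvHom.isSymbol (h : EvHom m a) : IsSymbol m a :=
  isSymbol_of_closed (S := EvHom) (fun _ _ h => h.smooth) (fun _ _ h => h.symBound)
    (fun _ _ h v => h.dX v) (fun _ _ h w => h.dT w) h

end SymbolAlgebra

/-! ### The algebra of eventually homogeneous functions. -/

section EvHomAlgebra

variable {X X' : Type} [NormedAddCommGroup X] [NormedSpace ℝ X] [NormedAddCommGroup X']
  [NormedSpace ℝ X'] {n : ℕ} {a b : X → Rn n → ℂ} {m m' : ℝ}

theorem evHom_zero : EvHom m (0 : X → Rn n → ℂ) := ⟨smooth2_zero, 1, one_pos, by simp⟩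

theorem EvHom.add (ha : EvHom m a) (hb : EvHom m b) : EvHom m (a + b) := by
  obtain ⟨sa, ρ, hρ, ha⟩ := ha
  obtain ⟨sb, ρ', hρ', hb⟩ := hb
  refine ⟨sa.add sb, max ρ ρ', by positivity, fun x ξ t hξ ht => ?_⟩
  simp only [Pi.add_apply]
  rw [ha x ξ t ((le_max_left _ _).trans_lt hξ) ht, hb x ξ t ((le_max_right _ _).trans_lt hξ) ht,
    mul_add]

theorem EvHom.mul (ha : EvHom m a) (hb : EvHom m' b) : EvHom (m + m') (a * b) := by
  obtain ⟨sa, ρ, hρ, ha⟩ := ha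
  obtain ⟨sb, ρ', hρ', hb⟩ := hb
  refine ⟨sa.mul sb, max ρ ρ', by positivity, fun x ξ t hξ ht => ?_⟩
  simp only [Pi.mul_apply]
  rw [ha x ξ t ((le_max_left _ _).trans_lt hξ) ht, hb x ξ t ((le_max_right _ _).trans_lt hξ) ht,
    Real.rpow_add (by linarith)]
  push_cast
  ring

theorem EvHom.cj (ha : EvHom m a) : EvHom m (cj a) := by
  obtain ⟨sa, ρ, hρ, ha⟩ := ha
  refine ⟨sa.cj, ρ, hρ, fun x ξ t hξ ht => ?_⟩
  simp only [_root_.cj]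
  rw [ha x ξ t hξ ht, map_mul, Complex.conj_ofReal]

theorem EvHom.pull (ha : EvHom m a) (L : X' →L[ℝ] X) : EvHom m (pull L a) := by
  obtain ⟨sa, ρ, hρ, ha⟩ := ha
  exact ⟨sa.pull L, ρ, hρ, fun x ξ t hξ ht => ha (L x) ξ t hξ ht⟩

theorem evHom_base {f : X → ℂ} (hf : ContDiff ℝ ∞ f) : EvHom 0 (base n f) :=
  ⟨smooth2_base hf, 1, one_pos, by simp [base]⟩

theorem EvHom.base_mul (ha : EvHom m a) {f : X → ℂ} (hf : ContDiff ℝ ∞ f) :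
    EvHom m (base n f * a) := by
  simpa using (evHom_base (n := n) hf).mul ha

theorem EvHom.const_smul (ha : EvHom m a) (c : ℂ) : EvHom m (c • a) :=
  ha.base_mul (f := fun _ => c) contDiff_const

end EvHomAlgebra

/-! ### Symbols with finite classical expansions. -/

section Classical

variable {X X' : Type} [NormedAddCommGroup X] [NormedSpace ℝ X] [FiniteDimensional ℝ X]
  [NormedAddCommGroup X'] [NormedSpace ℝ X'] [FiniteDimensional ℝ X'] {n : ℕ}

/-- Symbols that have a classical expansion with `N` terms. -/
def Cl : ℕ → ℝ → (X → Rn n → ℂ) → Prop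
  | 0, m, p => IsSymbol m p
  | N + 1, m, p => ∃ s, EvHom m s ∧ Cl N (m - 1) (p - s)

variable {p q : X → Rn n → ℂ} {m m' : ℝ} {N : ℕ}

theorem Cl.isSymbol (h : Cl N m p) : IsSymbol m p := by
  induction N generalizing m p with
  | zero => exact h
  | succ N ih =>
    obtain ⟨s, hs, h⟩ := h
    simpa using hs.isSymbol.add ((ih h).mono (by linarith))

theorem cl_zero : Cl N m (0 : X → Rn n → ℂ) := by
  induction N generalizing m with
  | zero => exact isSymbol_zero
  | succ N ih => exact ⟨0, evHom_zero, by simpa using ih⟩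

theorem EvHom.cl (h : EvHom m p) : Cl N m p := by
  cases N with
  | zero => exact h.isSymbol
  | succ N => exact ⟨p, h, by simpa using cl_zero⟩

theorem Cl.succ_order (h : Cl N m p) : Cl (N + 1) (m + 1) p :=
  ⟨0, evHom_zero, by simpa using h⟩

theorem Cl.of_succ (h : Cl (N + 1) m p) : Cl N m p := by
  induction N generalizing m p with
  | zero => exact h.isSymbol
  | succ N ih =>
    obtain ⟨s, hs, h⟩ := h
    exact ⟨s, hs, ih h⟩

theorem Cl.of_le {N' : ℕ} (h : Cl N m p) (hN : N' ≤ N) : Cl N' m p := by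
  induction N, hN using Nat.le_induction with
  | base => exact h
  | succ N _ ih => exact ih h.of_succ

theorem Cl.mono_one (h : Cl N m p) : Cl N (m + 1) p := h.succ_order.of_succ

/-- Allowing order higher by k costs nothing: k zero leading terms are inserted. -/
theorem Cl.of_sub_nat {k : ℕ} (h : Cl N (m - k) p) : Cl (N + k) m p := by
  induction k generalizing N m with
  | zero => simpa using h
  | succ k ih =>
    have h1 : Cl (N + 1) (m - k) p := by
      have := h.succ_order
      rwa [show m - ((k + 1 : ℕ) : ℝ) + 1 = m - k by push_cast; ring] at this
    have := ih h1
    rwa [show N + 1 + k = N + (k + 1) by ring] at this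

theorem IsSymbol.cl (h : IsSymbol (m - N) p) : Cl N m p := by
  have h0 : Cl 0 (m - N) p := h
  simpa using h0.of_sub_nat

theorem Cl.add (hp : Cl N m p) (hq : Cl N m q) : Cl N m (p + q) := by
  induction N generalizing m p q with
  | zero => exact IsSymbol.add hp hq
  | succ N ih =>
    obtain ⟨s, hs, h⟩ := hp
    obtain ⟨s', hs', h'⟩ := hq
    refine ⟨s + s', hs.add hs', ?_⟩
    rw [add_sub_add_comm]
    exact ih h h'

theorem Cl.mul (hp : Cl N m p) (hq : Cl N m' q) : Cl N (m + m') (p * q) := by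
  induction N generalizing m m' p q with
  | zero => exact IsSymbol.mul hp hq
  | succ N ih =>
    obtain ⟨s, hs, h⟩ := hp
    obtain ⟨s', hs', h'⟩ := hq
    refine ⟨s * s', hs.mul hs', ?_⟩
    have e : p * q - s * s' = s * (q - s') + (p - s) * s' + (p - s) * (q - s') := by ring
    rw [e]
    have h1 := ih hs.cl h'
    have h2 := ih h hs'.cl
    -- The product of the two remainders has order m + m' - 2, one better than needed.
    have h3 := (ih h h').mono_one
    rw [show m + (m' - 1) = m + m' - 1 by ring] at h1
    rw [show m - 1 + m' = m + m' - 1 by ring] at h2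
    rw [show m - 1 + (m' - 1) + 1 = m + m' - 1 by ring] at h3
    exact (h1.add h2).add h3

theorem Cl.cj (hp : Cl N m p) : Cl N m (cj p) := by
  induction N generalizing m p with
  | zero => exact IsSymbol.cj hp
  | succ N ih =>
    obtain ⟨s, hs, h⟩ := hp
    refine ⟨_, hs.cj, ?_⟩
    have e : _root_.cj p - _root_.cj s = _root_.cj (p - s) := by
      funext x θ; simp [_root_.cj]
    rw [e]
    exact ih h

theorem Cl.pull (hp : Cl N m p) (L : X' →L[ℝ] X) : Cl N m (pull L p) := by
  induction N generalizing m p with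
  | zero => exact IsSymbol.pull hp L
  | succ N ih =>
    obtain ⟨s, hs, h⟩ := hp
    exact ⟨_, hs.pull L, ih h⟩

theorem Cl.dX (hp : Cl N m p) (v : X) : Cl N m (dX v p) := by
  induction N generalizing m p with
  | zero => exact IsSymbol.dX hp v
  | succ N ih =>
    have sp := hp.isSymbol.smooth
    obtain ⟨s, hs, h⟩ := hp
    exact ⟨_, hs.dX v, by rw [← dX_sub sp hs.smooth]; exact ih h⟩

theorem Cl.dT (hp : Cl N m p) (w : Rn n) : Cl N (m - 1) (dT w p) := by
  induction N generalizing m p with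
  | zero => exact IsSymbol.dT hp w
  | succ N ih =>
    have sp := hp.isSymbol.smooth
    obtain ⟨s, hs, h⟩ := hp
    exact ⟨_, hs.dT w, by rw [← dT_sub sp hs.smooth]; exact ih h⟩

theorem Cl.base_mul (ha : Cl N m p) {f : X → ℂ} (hf : ContDiff ℝ ∞ f) :
    Cl N m (base n f * p) := by
  simpa using ((evHom_base (n := n) hf).cl (N := N)).mul ha

theorem Cl.const_smul (ha : Cl N m p) (c : ℂ) : Cl N m (c • p) :=
  ha.base_mul (f := fun _ => c) contDiff_const

theorem Cl.sub (hp : Cl N m p) (hq : Cl N m q) : Cl N m (p - q) := by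
  rw [sub_eq_add_neg, neg_eq_smul]; exact hp.add (hq.const_smul _)

theorem Cl.sum {ι : Type*} {s : Finset ι} {f : ι → X → Rn n → ℂ}
    (h : ∀ i ∈ s, Cl N m (f i)) : Cl N m (∑ i ∈ s, f i) := by
  classical
  induction s using Finset.induction_on with
  | empty => simpa using cl_zero
  | insert i s hi ih =>
    rw [Finset.sum_insert hi]
    exact (h i (by simp)).add (ih fun j hj => h j (by simp [hj]))

/-- A classical symbol of order `m` that is a symbol of order `m - 1` is classical of this order. -/
theorem Cl.of_isSymbol_sub_one (h : Cl (N + 1) m p) (hp : IsSymbol (m - 1) p) :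
    Cl N (m - 1) p := by
  obtain ⟨s, hs, h⟩ := h
  have h1 : IsSymbol (m - 1) s := by simpa using hp.sub h.isSymbol
  obtain ⟨ss, ρ, hρ, hom⟩ := hs
  -- The leading term is homogeneous of degree m for large ξ, yet of order m - 1. Along the ray
  -- through ξ this keeps t|s(x,ξ)| bounded for all t ≥ 1, so s(x,ξ) = 0.
  have h2 : ∀ x ξ, ρ < ‖ξ‖ → s x ξ = 0 := by
    intro x ξ hξ
    obtain ⟨C, hC⟩ := h1.symBound ‖x‖
    set D := |C| * (jb ξ ^ |m - 1| * ‖ξ‖ ^ (-|m - 1|) * jb ξ ^ |m - 1|) with hD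
    have hξ0 : 0 < ‖ξ‖ := hρ.trans hξ
    have key : ∀ t : ℝ, 1 ≤ t → t * ‖s x ξ‖ ≤ D := by
      intro t ht
      have ht0 : 0 < t := by linarith
      have h3 := hC x (t • ξ) le_rfl
      rw [hom x ξ t hξ ht, norm_mul, Complex.norm_real, Real.norm_of_nonneg (by positivity)] at h3
      have l1 : jb (t • ξ) ≤ t * jb ξ := by
        have := jb_pos ξ
        rw [jb, Real.sqrt_le_left (by positivity), mul_pow, jb_sq, norm_smul,
          Real.norm_of_nonneg ht0.le]
        nlinarith
      have l2 : t * ‖ξ‖ ≤ jb (t • ξ) := by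
        have := norm_le_jb (t • ξ)
        rwa [norm_smul, Real.norm_of_nonneg ht0.le] at this
      have hpj := jb_pos ξ
      have one_j : 1 ≤ jb ξ ^ |m - 1| := Real.one_le_rpow (one_le_jb ξ) (abs_nonneg _)
      have one_q : 1 ≤ jb ξ ^ |m - 1| * ‖ξ‖ ^ (-|m - 1|) := by
        rw [Real.rpow_neg hξ0.le, ← div_eq_mul_inv, one_le_div (by positivity)]
        exact Real.rpow_le_rpow hξ0.le (norm_le_jb ξ) (abs_nonneg _)
      have l3 : jb (t • ξ) ^ (m - 1) ≤
          t ^ (m - 1) * (jb ξ ^ |m - 1| * ‖ξ‖ ^ (-|m - 1|) * jb ξ ^ |m - 1|) := by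
        rcases le_total 0 (m - 1) with hm | hm
        · refine (Real.rpow_le_rpow (jb_pos _).le l1 hm).trans ?_
          rw [Real.mul_rpow ht0.le hpj.le, abs_of_nonneg hm] at *
          gcongr
          nlinarith
        · refine (Real.rpow_le_rpow_of_nonpos (by positivity) l2 hm).trans ?_
          rw [Real.mul_rpow ht0.le hξ0.le]
          gcongr
          rw [abs_of_nonpos hm] at *
          rw [neg_neg] at *
          have p1 : 0 < ‖ξ‖ ^ (m - 1) := by positivity
          nlinarith [mul_le_mul one_j one_j zero_le_one (by positivity), mul_pos p1 p1]
      have h4 : t ^ m = t ^ (m - 1) * t := by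
        rw [Real.rpow_sub_one ht0.ne', div_mul_cancel₀ _ ht0.ne']
      have pt : 0 < t ^ (m - 1) := by positivity
      have h5 : t ^ (m - 1) * (t * ‖s x ξ‖) ≤ t ^ (m - 1) * D := by
        calc t ^ (m - 1) * (t * ‖s x ξ‖) = t ^ m * ‖s x ξ‖ := by rw [h4]; ring
          _ ≤ C * jb (t • ξ) ^ (m - 1) := h3
          _ ≤ |C| * jb (t • ξ) ^ (m - 1) := by
            have := le_abs_self C
            have := jb_rpow_pos (t • ξ) (m - 1)
            gcongr
          _ ≤ |C| * (t ^ (m - 1) * (jb ξ ^ |m - 1| * ‖ξ‖ ^ (-|m - 1|) * jb ξ ^ |m - 1|)) := by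
            gcongr
          _ = t ^ (m - 1) * D := by rw [hD]; ring
      exact le_of_mul_le_mul_left h5 pt
    by_contra hne
    have hn : 0 < ‖s x ξ‖ := norm_pos_iff.2 hne
    have h6 := key (max 1 ((D + 1) / ‖s x ξ‖)) (le_max_left _ _)
    have h7 : (D + 1) / ‖s x ξ‖ * ‖s x ξ‖ ≤ max 1 ((D + 1) / ‖s x ξ‖) * ‖s x ξ‖ := by
      gcongr; exact le_max_right _ _
    rw [div_mul_cancel₀ _ hn.ne'] at h7
    linarith
  -- Having bounded support in ξ, s may be put back as a term of degree m - 1.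
  have h3 : EvHom (m - 1) s := EvHom.of_support ss hρ h2
  have h4 : Cl (N + 1) m p := ⟨s, EvHom.of_support ss hρ h2, h⟩
  have := h.add (h3.cl (N := N))
  simpa using this

end Classical

/-! ### Differentiation under the integral sign. -/

section ParamIntegral

open MeasureTheory

/-- Only directional derivatives need to be dominated, locally near each parameter; a basis of the
finite-dimensional parameter space turns these bounds into a bound on the operator norm. -/
theorem differentiable_param_integral {E : Type*} [NormedAddCommGroup E] [NormedSpace ℝ E]
    [FiniteDimensional ℝ E] {n : ℕ} {F : E → Rn n → ℂ}
    (hc : Continuous fun z : E × Rn n => F z.1 z.2)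
    (hd : ∀ a, Differentiable ℝ fun p => F p a) (hi : ∀ p, Integrable (F p))
    (hb : ∀ p₀ v, ∃ bound : Rn n → ℝ, Integrable bound ∧ ∀ p, ‖p - p₀‖ < 1 → ∀ a,
      ‖fderiv ℝ (fun p => F p a) p v‖ ≤ bound a) :
    Differentiable ℝ (fun p => ∫ a, F p a) ∧
      ∀ p v, fderiv ℝ (fun p => ∫ a, F p a) p v = ∫ a, fderiv ℝ (fun p => F p a) p v := by
  borelize E
  have : SecondCountableTopology (E →L[ℝ] ℂ) := by
    have : ProperSpace (E →L[ℝ] ℂ) := FiniteDimensional.proper ℝ _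
    infer_instance
  obtain ⟨C, hC0, hC⟩ := (Module.finBasis ℝ E).exists_opNorm_le (F := ℂ)
  have hmeas : ∀ p, AEStronglyMeasurable (fun a => fderiv ℝ (fun p => F p a) p)
      (volume : Measure (Rn n)) := by
    intro p
    have h1 := measurable_fderiv_with_param ℝ (f := fun (a : Rn n) (p : E) => F p a)
      (hc.comp continuous_swap)
    exact (h1.comp (measurable_id.prodMk measurable_const)).aestronglyMeasurable
  have hb' : ∀ p₀, ∃ bound : Rn n → ℝ, Integrable bound ∧ ∀ p, ‖p - p₀‖ < 1 → ∀ a,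
      ‖fderiv ℝ (fun p => F p a) p‖ ≤ bound a := by
    intro p₀
    choose bd hbi hbd using fun i => hb p₀ (Module.finBasis ℝ E i)
    refine ⟨fun a => C * ∑ i, bd i a,
      (integrable_finsetSum _ fun i _ => hbi i).const_mul C, fun p hp a => ?_⟩
    have hnn : ∀ i, 0 ≤ bd i a := fun i => (norm_nonneg _).trans (hbd i p hp a)
    refine hC (Finset.sum_nonneg fun i _ => hnn i) fun i => (hbd i p hp a).trans ?_
    exact Finset.single_le_sum (f := fun i => bd i a) (fun i _ => hnn i) (Finset.mem_univ i)
  have key : ∀ p, HasFDerivAt (fun p => ∫ a, F p a) (∫ a, fderiv ℝ (fun p => F p a) p) p ∧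
      Integrable fun a => fderiv ℝ (fun p => F p a) p := by
    intro p
    obtain ⟨bd, hbi, hbd⟩ := hb' p
    refine ⟨hasFDerivAt_integral_of_dominated_of_fderiv_le (bound := bd)
      (Metric.ball_mem_nhds p one_pos) (Filter.Eventually.of_forall fun q => (hi q).1) (hi p)
      (hmeas p) (Filter.Eventually.of_forall fun a q hq => hbd q (by
        simpa [dist_eq_norm] using hq) a) hbi
      (Filter.Eventually.of_forall fun a q _ => (hd a q).hasFDerivAt), ?_⟩
    exact hbi.mono' (hmeas p) (Filter.Eventually.of_forall fun a => hbd p (by simp) a)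
  refine ⟨fun p => (key p).1.differentiableAt, fun p v => ?_⟩
  rw [(key p).1.fderiv, ContinuousLinearMap.integral_apply (key p).2]

end ParamIntegral

/-! ### Amplitudes in displacement form and their Fourier transform in z. -/

section Amplitude

open MeasureTheory FourierTransform

variable {n : ℕ}

/-- An amplitude `A((x, z), ξ)` has support in `z` that is compact, locally uniformly in `x`. -/
def ZSupp (A : Rn n × Rn n → Rn n → ℂ) : Prop :=
  ∀ r : ℝ, ∃ R : ℝ, ∀ x z ξ, ‖x‖ < r → R < ‖z‖ → A (x, z) ξ = 0

/-- Amplitudes `A((x, z), ξ)` of order `m`, where `z` is the displacement `y - x`. -/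
structure Amp (m : ℝ) (A : Rn n × Rn n → Rn n → ℂ) : Prop where
  isSymbol : IsSymbol m A
  zSupp : ZSupp A

variable {A B : Rn n × Rn n → Rn n → ℂ} {m m' : ℝ}

theorem ZSupp.dX (h : ZSupp A) (v : Rn n × Rn n) : ZSupp (dX v A) := by
  intro r
  obtain ⟨R, hR⟩ := h r
  refine ⟨R, fun x z ξ hx hz => ?_⟩
  have : (fun p => A p ξ) =ᶠ[𝓝 (x, z)] fun _ => 0 := by
    have ho : IsOpen {p : Rn n × Rn n | ‖p.1‖ < r ∧ R < ‖p.2‖} :=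
      (isOpen_lt (continuous_norm.comp continuous_fst) continuous_const).inter
        (isOpen_lt continuous_const (continuous_norm.comp continuous_snd))
    filter_upwards [ho.mem_nhds (show (x, z) ∈ _ from ⟨hx, hz⟩)] with p hp
    exact hR p.1 p.2 ξ hp.1 hp.2
  simp only [_root_.dX]
  rw [this.fderiv_eq]
  simp

theorem ZSupp.dT (h : ZSupp A) (w : Rn n) : ZSupp (dT w A) := by
  intro r
  obtain ⟨R, hR⟩ := h r
  refine ⟨R, fun x z ξ hx hz => ?_⟩
  have : A (x, z) = fun _ => 0 := funext fun ξ => hR x z ξ hx hz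
  simp [_root_.dT, this]

theorem ZSupp.add (hA : ZSupp A) (hB : ZSupp B) : ZSupp (A + B) := by
  intro r
  obtain ⟨R, hR⟩ := hA r
  obtain ⟨R', hR'⟩ := hB r
  refine ⟨max R R', fun x z ξ hx hz => ?_⟩
  simp [hR x z ξ hx ((le_max_left _ _).trans_lt hz), hR' x z ξ hx ((le_max_right _ _).trans_lt hz)]

theorem ZSupp.mul_left (hA : ZSupp A) (B : Rn n × Rn n → Rn n → ℂ) : ZSupp (B * A) := by
  intro r
  obtain ⟨R, hR⟩ := hA r
  exact ⟨R, fun x z ξ hx hz => by simp [hR x z ξ hx hz]⟩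

theorem ZSupp.const_smul (hA : ZSupp A) (c : ℂ) : ZSupp (c • A) := by
  intro r
  obtain ⟨R, hR⟩ := hA r
  exact ⟨R, fun x z ξ hx hz => by simp [hR x z ξ hx hz]⟩

theorem zSupp_zero : ZSupp (0 : Rn n × Rn n → Rn n → ℂ) := fun _ => ⟨0, by simp⟩

theorem ZSupp.sum {ι : Type*} {s : Finset ι} {f : ι → Rn n × Rn n → Rn n → ℂ}
    (h : ∀ i ∈ s, ZSupp (f i)) : ZSupp (∑ i ∈ s, f i) := by
  classical
  induction s using Finset.induction_on with
  | empty => simpa using zSupp_zero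
  | insert i s hi ih =>
    rw [Finset.sum_insert hi]
    exact (h i (by simp)).add (ih fun j hj => h j (by simp [hj]))

theorem Amp.smooth (h : Amp m A) : Smooth2 A := h.isSymbol.smooth

theorem Amp.dX (h : Amp m A) (v : Rn n × Rn n) : Amp m (dX v A) := ⟨h.1.dX v, h.2.dX v⟩

theorem Amp.dT (h : Amp m A) (w : Rn n) : Amp (m - 1) (dT w A) := ⟨h.1.dT w, h.2.dT w⟩

theorem Amp.add (hA : Amp m A) (hB : Amp m B) : Amp m (A + B) := ⟨hA.1.add hB.1, hA.2.add hB.2⟩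

theorem Amp.const_smul (hA : Amp m A) (c : ℂ) : Amp m (c • A) :=
  ⟨hA.1.const_smul c, hA.2.const_smul c⟩

theorem Amp.mono (hA : Amp m A) (h : m ≤ m') : Amp m' A := ⟨hA.1.mono h, hA.2⟩

/-- The Fourier transform of an amplitude in the displacement. -/
noncomputable def hatA (A : Rn n × Rn n → Rn n → ℂ) (x ζ η : Rn n) : ℂ :=
  𝓕 (fun z => A (x, z) η) ζ

theorem hatA_eq (A : Rn n × Rn n → Rn n → ℂ) (x ζ η : Rn n) :
    hatA A x ζ η =
      ∫ z, Complex.exp (↑(-2 * Real.pi * inner ℝ z ζ) * Complex.I) • A (x, z) η :=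
  Real.fourier_eq' _ _

theorem Smooth2.continuous_disp (hA : Smooth2 A) (x η : Rn n) : Continuous fun z => A (x, z) η :=
  hA.continuous.comp ((continuous_const.prodMk continuous_id).prodMk continuous_const)

theorem ZSupp.hasCompactSupport (h : ZSupp A) (x η : Rn n) :
    HasCompactSupport fun z => A (x, z) η := by
  obtain ⟨R, hR⟩ := h (‖x‖ + 1)
  refine HasCompactSupport.intro (isCompact_closedBall (0 : Rn n) R) fun z hz => ?_
  exact hR x z η (by linarith) (by simpa using hz)

theorem integrable_disp (hA : Smooth2 A) (h : ZSupp A) (x η : Rn n) :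
    Integrable fun z => A (x, z) η :=
  (hA.continuous_disp x η).integrable_of_hasCompactSupport (h.hasCompactSupport x η)

theorem norm_hatA_le (hb : SymBound m A) (h : ZSupp A) (r : ℝ) :
    ∃ C : ℝ, 0 ≤ C ∧ ∀ x ζ η, ‖x‖ ≤ r → ‖hatA A x ζ η‖ ≤ C * jb η ^ m := by
  obtain ⟨R, hR⟩ := h (r + 1)
  obtain ⟨C, hC⟩ := hb (max r R)
  refine ⟨|C| * volume.real (Metric.closedBall (0 : Rn n) R), by positivity,
    fun x ζ η hx => ?_⟩
  have h1 : ‖hatA A x ζ η‖ ≤ ∫ z, ‖A (x, z) η‖ :=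
    VectorFourier.norm_fourierIntegral_le_integral_norm _ _ _ _ _
  have h2 : ∫ z, ‖A (x, z) η‖ = ∫ z in Metric.closedBall (0 : Rn n) R, ‖A (x, z) η‖ := by
    refine (setIntegral_eq_integral_of_forall_compl_eq_zero fun z hz => ?_).symm
    rw [hR x z η (by linarith) (by simpa using hz), norm_zero]
  have h3 : ‖∫ z in Metric.closedBall (0 : Rn n) R, ‖A (x, z) η‖‖ ≤
      (|C| * jb η ^ m) * volume.real (Metric.closedBall (0 : Rn n) R) := by
    refine norm_setIntegral_le_of_norm_le_const measure_closedBall_lt_top fun z hz => ?_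
    rw [norm_norm]
    refine (hC (x, z) η ?_).trans ?_
    · rw [Prod.norm_def]
      exact max_le_max hx (by simpa using hz)
    · have := jb_rpow_pos η m
      gcongr
      exact le_abs_self C
  rw [h2] at h1
  refine h1.trans ((le_abs_self _).trans (h3.trans (le_of_eq (by ring))))

/-- Integration by parts in z, with no boundary terms because of `ZSupp`. -/
theorem hatA_dX (hA : Smooth2 A) (h : ZSupp A) (w x ζ η : Rn n) :
    hatA (dX (0, w) A) x ζ η = (2 * Real.pi * Complex.I * (inner ℝ w ζ : ℝ)) * hatA A x ζ η := by
  have hcd : ContDiff ℝ ∞ fun z => A (x, z) η :=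
    (hA.fst η).comp (contDiff_const.prodMk contDiff_id)
  have hd : Differentiable ℝ fun z => A (x, z) η := hcd.differentiable (by simp)
  have hfd : ∀ z w, fderiv ℝ (fun z => A (x, z) η) z w = dX (0, w) A (x, z) η := fun z w =>
    (fderiv_comp_prodMk_right (g := fun p : Rn n × Rn n => A p η)
      ((hA.fst η).differentiable (by simp)) x z w)
  have hi : Integrable (fderiv ℝ fun z => A (x, z) η) := by
    exact (hcd.continuous_fderiv (by simp)).integrable_of_hasCompactSupport ((h.hasCompactSupport x η).fderiv (𝕜 := ℝ))
  have h1 := Real.fourier_fderiv (integrable_disp hA h x η) hd hi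
  have h2 := congrArg (fun L : Rn n → (Rn n →L[ℝ] ℂ) => L ζ w) h1
  simp only [VectorFourier.fourierSMulRight_apply] at h2
  rw [Real.fourier_continuousLinearMap_apply hi] at h2
  simp only [hfd] at h2
  rw [hatA, h2, hatA]
  have h3 : (-innerSL ℝ) ζ w = -(inner ℝ w ζ : ℝ) := congrArg Neg.neg (real_inner_comm w ζ)
  rw [h3]
  simp only [smul_eq_mul, Complex.real_smul]
  push_cast
  ring

/-- Since ⟨ζ⟩² = 1 + Σ ζ_i², every factor ⟨ζ⟩² is paid for by at most two z-derivatives of the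
amplitude, which do not change its order in η. -/
theorem norm_hatA_decay_even (h : Amp m A) (M : ℕ) (r : ℝ) :
    ∃ C : ℝ, 0 ≤ C ∧ ∀ x ζ η, ‖x‖ ≤ r → (jb ζ ^ 2) ^ M * ‖hatA A x ζ η‖ ≤ C * jb η ^ m := by
  induction M generalizing A with
  | zero => simpa using norm_hatA_le h.1.symBound h.2 r
  | succ M ih =>
    obtain ⟨C₀, h0, hC₀⟩ := ih h
    let e : Fin n → Rn n := fun i => EuclideanSpace.basisFun (Fin n) ℝ i
    choose C hCn hC using fun i => ih ((h.dX (0, e i)).dX (0, e i))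
    refine ⟨C₀ + ∑ i, C i, add_nonneg h0 (Finset.sum_nonneg fun i _ => hCn i),
      fun x ζ η hx => ?_⟩
    have h1 : ∀ i, (ζ i) ^ 2 * ‖hatA A x ζ η‖ ≤
        ‖hatA (dX (0, e i) (dX (0, e i) A)) x ζ η‖ := by
      intro i
      rw [hatA_dX (h.dX _).smooth (h.dX _).zSupp, hatA_dX h.smooth h.zSupp, ← mul_assoc, norm_mul]
      have : (inner ℝ (e i) ζ : ℝ) = ζ i := by
        simp [e, EuclideanSpace.inner_single_left]
      rw [this]
      gcongr
      have h4 : ‖(2 * Real.pi * Complex.I * (ζ i : ℂ)) * (2 * Real.pi * Complex.I * (ζ i : ℂ))‖ =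
          (4 * Real.pi ^ 2) * (ζ i) ^ 2 := by
        simp only [norm_mul, Complex.norm_I, Complex.norm_real, Complex.norm_ofNat,
          Real.norm_eq_abs, abs_of_pos Real.pi_pos]
        rw [← sq_abs (ζ i)]; ring
      rw [h4]
      have := Real.pi_gt_three
      -- The factor (2π)² from the two derivatives is at least 1 and is discarded.
      have h5 : 1 ≤ 4 * Real.pi ^ 2 := by nlinarith
      exact le_mul_of_one_le_left (sq_nonneg _) h5
    have h2 : jb ζ ^ 2 = 1 + ∑ i, (ζ i) ^ 2 := by
      rw [jb_sq, EuclideanSpace.norm_sq_eq]; simp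
    calc (jb ζ ^ 2) ^ (M + 1) * ‖hatA A x ζ η‖
        = (jb ζ ^ 2) ^ M * ‖hatA A x ζ η‖ +
          ∑ i, (jb ζ ^ 2) ^ M * ((ζ i) ^ 2 * ‖hatA A x ζ η‖) := by
          rw [← Finset.mul_sum, ← Finset.sum_mul, pow_succ]; nth_rw 2 [h2]; ring
      _ ≤ C₀ * jb η ^ m + ∑ i, C i * jb η ^ m := by
          refine add_le_add (hC₀ x ζ η hx) (Finset.sum_le_sum fun i _ => ?_)
          refine le_trans ?_ (hC i x ζ η hx)
          gcongr
          exact h1 i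
      _ = _ := by rw [add_mul, Finset.sum_mul]

theorem norm_hatA_decay (h : Amp m A) (L r : ℝ) :
    ∃ C : ℝ, 0 ≤ C ∧ ∀ x ζ η, ‖x‖ ≤ r → ‖hatA A x ζ η‖ ≤ C * jb ζ ^ (-L) * jb η ^ m := by
  obtain ⟨M, hM⟩ := exists_nat_ge L
  obtain ⟨C, hC0, hC⟩ := norm_hatA_decay_even h M r
  refine ⟨C, hC0, fun x ζ η hx => ?_⟩
  have h1 := hC x ζ η hx
  have pζ := jb_pos ζ
  have h2 : jb ζ ^ L ≤ (jb ζ ^ 2) ^ M := by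
    rw [← pow_mul, ← Real.rpow_natCast]
    refine jb_rpow_le_rpow ζ (hM.trans ?_)
    push_cast; linarith [Nat.cast_nonneg (α := ℝ) M]
  have pL := jb_rpow_pos ζ L
  rw [Real.rpow_neg pζ.le]
  have h3 : jb ζ ^ L * ‖hatA A x ζ η‖ ≤ C * jb η ^ m :=
    (mul_le_mul_of_nonneg_right h2 (norm_nonneg _)).trans h1
  rw [← le_div_iff₀' pL] at h3
  exact h3.trans (le_of_eq (by field_simp))

/-- By Peetre's inequality the shift of η = ξ by 2πtζ costs ⟨ζ⟩^{|m|}, so decay of order L + |m| in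
ζ is requested. -/
theorem norm_hatA_shift_le (h : Amp m A) (L r T : ℝ) :
    ∃ C : ℝ, 0 ≤ C ∧ ∀ x ζ ξ (t : ℝ), ‖x‖ ≤ r → |t| ≤ T →
      ‖hatA A x ζ (ξ + (2 * Real.pi * t) • ζ)‖ ≤ C * jb ξ ^ m * jb ζ ^ (-L) := by
  obtain ⟨C, hC0, hC⟩ := norm_hatA_decay h (L + |m|) r
  refine ⟨C * (2 ^ |m| * (1 + 2 * Real.pi * |T|) ^ |m|), by positivity,
    fun x ζ ξ t hx ht => ?_⟩
  have pζ := jb_pos ζ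
  have pξ := jb_rpow_pos ξ m
  have pL := jb_rpow_pos ζ (-(L + |m|))
  have h1 := jb_rpow_add_le m ξ ((2 * Real.pi * t) • ζ)
  have h2 : jb ((2 * Real.pi * t) • ζ) ≤ (1 + 2 * Real.pi * |T|) * jb ζ := by
    refine (jb_smul_le _ _).trans ?_
    rw [abs_mul, abs_of_pos (by positivity : 0 < 2 * Real.pi)]
    have := ht.trans (le_abs_self T)
    gcongr
  have h3 : jb ((2 * Real.pi * t) • ζ) ^ |m| ≤ (1 + 2 * Real.pi * |T|) ^ |m| * jb ζ ^ |m| := by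
    rw [← Real.mul_rpow (by positivity) pζ.le]
    exact Real.rpow_le_rpow (jb_pos _).le h2 (abs_nonneg m)
  calc _ ≤ C * jb ζ ^ (-(L + |m|)) * jb (ξ + (2 * Real.pi * t) • ζ) ^ m := hC x ζ _ hx
    _ ≤ C * jb ζ ^ (-(L + |m|)) *
        (2 ^ |m| * jb ξ ^ m * ((1 + 2 * Real.pi * |T|) ^ |m| * jb ζ ^ |m|)) := by
        gcongr
        exact h1.trans (by gcongr)
    _ = C * (2 ^ |m| * (1 + 2 * Real.pi * |T|) ^ |m|) * jb ξ ^ m *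
        (jb ζ ^ (-(L + |m|)) * jb ζ ^ |m|) := by ring
    _ = _ := by rw [← Real.rpow_add pζ]; ring_nf

end Amplitude

/-! ### The left symbol as an absolutely convergent integral. -/

section Reduction

open MeasureTheory FourierTransform

variable {n : ℕ} {A B : Rn n × Rn n → Rn n → ℂ} {m m' : ℝ}

theorem norm_fourierKernel (z ζ : Rn n) :
    ‖Complex.exp (↑(-2 * Real.pi * inner ℝ z ζ) * Complex.I)‖ = 1 :=
  Complex.norm_exp_ofReal_mul_I _

/-- Near a fixed x the support radius in z is uniform, so locally this is an integral of a
continuous function over a fixed ball. -/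
theorem continuous_hatA (hA : Smooth2 A) (h : ZSupp A) :
    Continuous fun p : Rn n × Rn n × Rn n => hatA A p.1 p.2.1 p.2.2 := by
  rw [continuous_iff_continuousAt]
  intro p₀
  obtain ⟨R, hR⟩ := h (‖p₀.1‖ + 1)
  have hc : Continuous fun p : Rn n × Rn n × Rn n => ∫ z in Metric.closedBall (0 : Rn n) R,
      Complex.exp (↑(-2 * Real.pi * inner ℝ z p.2.1) * Complex.I) • A (p.1, z) p.2.2 := by
    refine continuous_parametric_integral_of_continuous (f := fun (p : Rn n × Rn n × Rn n) z =>
      Complex.exp (↑(-2 * Real.pi * inner ℝ z p.2.1) * Complex.I) • A (p.1, z) p.2.2) ?_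
      (isCompact_closedBall (0 : Rn n) R)
    have h1 : Continuous fun q : (Rn n × Rn n × Rn n) × Rn n =>
        Complex.exp (↑(-2 * Real.pi * inner ℝ q.2 q.1.2.1) * Complex.I) := by fun_prop
    exact h1.smul (hA.continuous.comp
      (g := fun z : (Rn n × Rn n) × Rn n => A z.1 z.2)
      (f := fun q : (Rn n × Rn n × Rn n) × Rn n => ((q.1.1, q.2), q.1.2.2)) (by fun_prop))
  refine hc.continuousAt.congr ?_
  have ho : IsOpen {p : Rn n × Rn n × Rn n | ‖p.1‖ < ‖p₀.1‖ + 1} :=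
    isOpen_lt (continuous_norm.comp continuous_fst) continuous_const
  filter_upwards [ho.mem_nhds (show ‖p₀.1‖ < ‖p₀.1‖ + 1 from lt_add_one _)] with p hp
  rw [hatA_eq]
  refine setIntegral_eq_integral_of_forall_compl_eq_zero fun z hz => ?_
  rw [hR p.1 z p.2.2 hp (by simpa using hz), smul_zero]

theorem integrable_kernel_smul_disp (hA : Smooth2 A) (h : ZSupp A) (x ζ η : Rn n) :
    Integrable fun z => Complex.exp (↑(-2 * Real.pi * inner ℝ z ζ) * Complex.I) • A (x, z) η := by
  have hc : Continuous fun z : Rn n => Complex.exp (↑(-2 * Real.pi * inner ℝ z ζ) * Complex.I) := by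
    fun_prop
  exact (hc.smul (hA.continuous_disp x η)).integrable_of_hasCompactSupport
    ((h.hasCompactSupport x η).smul_left)

theorem hatA_add (hA : Amp m A) (hB : Amp m' B) (x ζ η : Rn n) :
    hatA (A + B) x ζ η = hatA A x ζ η + hatA B x ζ η := by
  rw [hatA_eq, hatA_eq, hatA_eq, ← integral_add
    (integrable_kernel_smul_disp hA.smooth hA.zSupp x ζ η)
    (integrable_kernel_smul_disp hB.smooth hB.zSupp x ζ η)]
  simp [mul_add]

theorem hatA_const_smul (c : ℂ) (x ζ η : Rn n) : hatA (c • A) x ζ η = c * hatA A x ζ η := by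
  rw [hatA_eq, hatA_eq, ← integral_const_mul]
  congr 1
  funext z
  simp only [Pi.smul_apply, smul_eq_mul]
  ring

theorem hatA_zero (x ζ η : Rn n) : hatA (0 : Rn n × Rn n → Rn n → ℂ) x ζ η = 0 := by
  rw [hatA_eq]; simp

theorem fderiv_disp (hA : Smooth2 A) (z : Rn n) (p v : Rn n × Rn n) :
    HasFDerivAt (fun p : Rn n × Rn n => A (p.1, z) p.2)
      (fderiv ℝ (fun p : Rn n × Rn n => A (p.1, z) p.2) p) p ∧
    fderiv ℝ (fun p : Rn n × Rn n => A (p.1, z) p.2) p v =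
      dX (v.1, 0) A (p.1, z) p.2 + dT v.2 A (p.1, z) p.2 := by
  have hf : HasFDerivAt (fun p : Rn n × Rn n => p.1) (ContinuousLinearMap.fst ℝ _ _) p :=
    hasFDerivAt_fst
  have hs : HasFDerivAt (fun p : Rn n × Rn n => p.2) (ContinuousLinearMap.snd ℝ _ _) p :=
    hasFDerivAt_snd
  have h1 : HasFDerivAt (fun p : Rn n × Rn n => (((p.1, z), p.2) : (Rn n × Rn n) × Rn n)) _ p :=
    (hf.prodMk (hasFDerivAt_const z p)).prodMk hs
  have h2 : HasFDerivAt (fun p : Rn n × Rn n => A (p.1, z) p.2) _ p :=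
    HasFDerivAt.comp (g := fun q : (Rn n × Rn n) × Rn n => A q.1 q.2)
      (f := fun p : Rn n × Rn n => ((p.1, z), p.2)) p ((ContDiff.differentiable hA (by simp))
      ((p.1, z), p.2)).hasFDerivAt h1
  refine ⟨h2.differentiableAt.hasFDerivAt, ?_⟩
  rw [h2.fderiv, hA.dX_eq, hA.dT_eq, ← map_add]
  simp

theorem differentiable_hatA (hA : Amp m A) (ζ : Rn n) :
    Differentiable ℝ (fun p : Rn n × Rn n => hatA A p.1 ζ p.2) ∧ ∀ p v,
      fderiv ℝ (fun p : Rn n × Rn n => hatA A p.1 ζ p.2) p v =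
        hatA (dX (v.1, 0) A) p.1 ζ p.2 + hatA (dT v.2 A) p.1 ζ p.2 := by
  set F : Rn n × Rn n → Rn n → ℂ := fun p z =>
    Complex.exp (↑(-2 * Real.pi * inner ℝ z ζ) * Complex.I) • A (p.1, z) p.2 with hF
  have hFd : ∀ z p, HasFDerivAt (fun p => F p z)
      (Complex.exp (↑(-2 * Real.pi * inner ℝ z ζ) * Complex.I) •
        fderiv ℝ (fun p : Rn n × Rn n => A (p.1, z) p.2) p) p := fun z p =>
    (fderiv_disp hA.smooth z p 0).1.const_smul
      (Complex.exp (↑(-2 * Real.pi * inner ℝ z ζ) * Complex.I))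
  have hFv : ∀ z p v, fderiv ℝ (fun p => F p z) p v =
      Complex.exp (↑(-2 * Real.pi * inner ℝ z ζ) * Complex.I) •
        (dX (v.1, 0) A + dT v.2 A) (p.1, z) p.2 := by
    intro z p v
    rw [(hFd z p).fderiv, smul_apply, (fderiv_disp hA.smooth z p v).2]
    rfl
  have hsm : ∀ v : Rn n × Rn n, Smooth2 (dX (v.1, 0) A + dT v.2 A) := fun v =>
    (hA.smooth.dX _).add (hA.smooth.dT _)
  have hzs : ∀ v : Rn n × Rn n, ZSupp (dX (v.1, 0) A + dT v.2 A) := fun v =>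
    (hA.zSupp.dX _).add (hA.zSupp.dT _)
  have key := differentiable_param_integral (F := F) ?_ (fun z p => (hFd z p).differentiableAt)
    (fun p => integrable_kernel_smul_disp hA.smooth hA.zSupp p.1 ζ p.2) ?_
  · have e : (fun p : Rn n × Rn n => hatA A p.1 ζ p.2) = fun p => ∫ z, F p z := by
      funext p; exact hatA_eq A p.1 ζ p.2
    rw [e]
    refine ⟨key.1, fun p v => ?_⟩
    rw [key.2, ← hatA_add ((hA.dX (v.1, 0)).mono (le_max_left m (m - 1)))
      ((hA.dT v.2).mono (le_max_right m (m - 1))), hatA_eq]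
    simp only [hFv]
  · refine Continuous.smul (f := fun q : (Rn n × Rn n) × Rn n =>
      Complex.exp (↑(-2 * Real.pi * inner ℝ q.2 ζ) * Complex.I)) (by fun_prop) (hA.smooth.continuous.comp
      (g := fun z : (Rn n × Rn n) × Rn n => A z.1 z.2)
      (f := fun q : (Rn n × Rn n) × Rn n => ((q.1.1, q.2), q.1.2)) (by fun_prop))
  · intro p₀ v
    obtain ⟨R, hR⟩ := hzs v (‖p₀‖ + 2)
    obtain ⟨M, hM⟩ := ((isCompact_closedBall p₀ 1).prod
      (isCompact_closedBall (0 : Rn n) R)).exists_bound_of_continuousOn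
      (f := fun q : (Rn n × Rn n) × Rn n => (dX (v.1, 0) A + dT v.2 A) (q.1.1, q.2) q.1.2)
      (((hsm v).continuous.comp
        (g := fun z : (Rn n × Rn n) × Rn n => (dX (v.1, 0) A + dT v.2 A) z.1 z.2)
        (f := fun q : (Rn n × Rn n) × Rn n => ((q.1.1, q.2), q.1.2)) (by fun_prop))).continuousOn
    refine ⟨(Metric.closedBall (0 : Rn n) R).indicator fun _ => M,
      (integrable_indicator_iff Metric.isClosed_closedBall.measurableSet).2
        (integrableOn_const measure_closedBall_lt_top.ne), fun p hp z => ?_⟩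
    rw [hFv, norm_smul, norm_fourierKernel, one_mul]
    by_cases hz : z ∈ Metric.closedBall (0 : Rn n) R
    · rw [Set.indicator_of_mem hz]
      exact hM (p, z) ⟨by simpa [dist_eq_norm] using hp.le, hz⟩
    · rw [Set.indicator_of_notMem hz, hR p.1 z p.2 ?_ (by simpa using hz), norm_zero]
      have h1 : ‖p.1‖ ≤ ‖p‖ := norm_fst_le p
      have h2 : ‖p‖ ≤ ‖p - p₀‖ + ‖p₀‖ := norm_le_norm_sub_add p p₀
      linarith

/-- The family `∫∫ e^{-2πi⟨z,ζ⟩} A(x, z, ξ + 2πtζ) dz dζ`, whose value at `t = 1` is the left symbol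
of the operator with amplitude `A`. -/
noncomputable def Ls (t : ℝ) (A : Rn n × Rn n → Rn n → ℂ) (x ξ : Rn n) : ℂ :=
  ∫ ζ, hatA A x ζ (ξ + (2 * Real.pi * t) • ζ)

theorem continuous_hatA_shift (hA : Amp m A) :
    Continuous fun q : (ℝ × Rn n × Rn n) × Rn n =>
      hatA A q.1.2.1 q.2 (q.1.2.2 + (2 * Real.pi * q.1.1) • q.2) :=
  (continuous_hatA hA.smooth hA.zSupp).comp
    (g := fun p : Rn n × Rn n × Rn n => hatA A p.1 p.2.1 p.2.2)
    (f := fun q : (ℝ × Rn n × Rn n) × Rn n =>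
      (q.1.2.1, q.2, q.1.2.2 + (2 * Real.pi * q.1.1) • q.2)) (by fun_prop)

theorem integrable_jb_nat (n : ℕ) : Integrable fun ζ : Rn n => jb ζ ^ (-((n : ℝ) + 1)) :=
  integrable_jb_rpow (by linarith)

theorem integrable_hatA_shift (hA : Amp m A) (t : ℝ) (x ξ : Rn n) :
    Integrable fun ζ => hatA A x ζ (ξ + (2 * Real.pi * t) • ζ) := by
  obtain ⟨C, -, hC⟩ := norm_hatA_shift_le hA (n + 1) ‖x‖ |t|
  have hc : Continuous fun ζ => hatA A x ζ (ξ + (2 * Real.pi * t) • ζ) :=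
    (continuous_hatA_shift hA).comp (f := fun ζ => ((t, x, ξ), ζ)) (by fun_prop)
  exact ((integrable_jb_nat n).const_mul (C * jb ξ ^ m)).mono' hc.aestronglyMeasurable
    (Filter.Eventually.of_forall fun ζ => hC x ζ ξ t le_rfl le_rfl)

theorem norm_Ls_le (hA : Amp m A) (r T : ℝ) :
    ∃ C : ℝ, ∀ x ξ (t : ℝ), ‖x‖ ≤ r → |t| ≤ T → ‖Ls t A x ξ‖ ≤ C * jb ξ ^ m := by
  obtain ⟨C, -, hC⟩ := norm_hatA_shift_le hA (n + 1) r T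
  refine ⟨C * ∫ ζ : Rn n, jb ζ ^ (-((n : ℝ) + 1)), fun x ξ t hx ht => ?_⟩
  refine (norm_integral_le_of_norm_le ((integrable_jb_nat n).const_mul (C * jb ξ ^ m))
    (Filter.Eventually.of_forall fun ζ => hC x ζ ξ t hx ht)).trans (le_of_eq ?_)
  rw [integral_const_mul]; ring

theorem Ls_add (hA : Amp m A) (hB : Amp m' B) (t : ℝ) : Ls t (A + B) = Ls t A + Ls t B := by
  funext x ξ
  simp only [Ls, Pi.add_apply]
  rw [← integral_add (integrable_hatA_shift hA t x ξ) (integrable_hatA_shift hB t x ξ)]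
  congr 1
  funext ζ
  exact hatA_add hA hB _ _ _

theorem Ls_const_smul (c : ℂ) (t : ℝ) : Ls t (c • A) = c • Ls t A := by
  funext x ξ
  simp only [Ls, Pi.smul_apply, smul_eq_mul]
  rw [← integral_const_mul]
  congr 1
  funext ζ
  exact hatA_const_smul _ _ _ _

theorem Ls_zero (t : ℝ) : Ls t (0 : Rn n × Rn n → Rn n → ℂ) = 0 := by
  funext x ξ
  simp [Ls, hatA_zero]

theorem differentiable_Ls (hA : Amp m A) (t : ℝ) :
    Differentiable ℝ (fun p : Rn n × Rn n => Ls t A p.1 p.2) ∧ ∀ p v,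
      fderiv ℝ (fun p : Rn n × Rn n => Ls t A p.1 p.2) p v =
        Ls t (dX (v.1, 0) A) p.1 p.2 + Ls t (dT v.2 A) p.1 p.2 := by
  set F : Rn n × Rn n → Rn n → ℂ := fun p ζ => hatA A p.1 ζ (p.2 + (2 * Real.pi * t) • ζ) with hF
  have hFd : ∀ ζ p, HasFDerivAt (fun p => F p ζ)
      (fderiv ℝ (fun p : Rn n × Rn n => hatA A p.1 ζ p.2) (p.1, p.2 + (2 * Real.pi * t) • ζ)) p := by
    intro ζ p
    have hf : HasFDerivAt (fun p : Rn n × Rn n => p.1) (ContinuousLinearMap.fst ℝ _ _) p :=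
      hasFDerivAt_fst
    have hs : HasFDerivAt (fun p : Rn n × Rn n => p.2) (ContinuousLinearMap.snd ℝ _ _) p :=
      hasFDerivAt_snd
    have h1 : HasFDerivAt (fun p : Rn n × Rn n => (p.1, p.2 + (2 * Real.pi * t) • ζ))
        (ContinuousLinearMap.id ℝ (Rn n × Rn n)) p :=
      hf.prodMk (hs.add_const _)
    have h2 : HasFDerivAt (fun p => F p ζ) _ p :=
      HasFDerivAt.comp (g := fun p : Rn n × Rn n => hatA A p.1 ζ p.2)
        (f := fun p : Rn n × Rn n => (p.1, p.2 + (2 * Real.pi * t) • ζ)) p ((differentiable_hatA hA ζ).1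
        (p.1, p.2 + (2 * Real.pi * t) • ζ)).hasFDerivAt h1
    simpa using h2
  have hFv : ∀ ζ p v, fderiv ℝ (fun p => F p ζ) p v =
      hatA (dX (v.1, 0) A) p.1 ζ (p.2 + (2 * Real.pi * t) • ζ) +
        hatA (dT v.2 A) p.1 ζ (p.2 + (2 * Real.pi * t) • ζ) := by
    intro ζ p v
    rw [(hFd ζ p).fderiv, (differentiable_hatA hA ζ).2]
  have key := differentiable_param_integral (F := F)
    ((continuous_hatA_shift hA).comp
      (f := fun q : (Rn n × Rn n) × Rn n => ((t, q.1.1, q.1.2), q.2)) (by fun_prop))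
    (fun z p => (hFd z p).differentiableAt) (fun p => integrable_hatA_shift hA t p.1 p.2) ?_
  · refine ⟨key.1, fun p v => ?_⟩
    have h1 := key.2 p v
    simp only [hFv] at h1
    rw [integral_add (integrable_hatA_shift (hA.dX _) t _ _)
      (integrable_hatA_shift (hA.dT _) t _ _)] at h1
    exact h1
  · intro p₀ v
    obtain ⟨C, hC0, hC⟩ := norm_hatA_shift_le (hA.dX (v.1, 0)) (n + 1) (‖p₀‖ + 1) |t|
    obtain ⟨D, hD0, hD⟩ := norm_hatA_shift_le (hA.dT v.2) (n + 1) (‖p₀‖ + 1) |t|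
    obtain ⟨S, hS⟩ := (isCompact_closedBall p₀ 1).exists_bound_of_continuousOn
      (f := fun p : Rn n × Rn n => (jb p.2 ^ m : ℝ))
      ((continuous_jb_rpow m).comp continuous_snd).continuousOn
    obtain ⟨S', hS'⟩ := (isCompact_closedBall p₀ 1).exists_bound_of_continuousOn
      (f := fun p : Rn n × Rn n => (jb p.2 ^ (m - 1) : ℝ))
      ((continuous_jb_rpow (m - 1)).comp continuous_snd).continuousOn
    refine ⟨fun ζ => (C * S + D * S') * jb ζ ^ (-((n : ℝ) + 1)),
      (integrable_jb_nat n).const_mul _, fun p hp ζ => ?_⟩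
    have hp' : p ∈ Metric.closedBall p₀ 1 := by simpa [dist_eq_norm] using hp.le
    have hx : ‖p.1‖ ≤ ‖p₀‖ + 1 := by
      have h1 : ‖p.1‖ ≤ ‖p‖ := norm_fst_le p
      have h2 : ‖p‖ ≤ ‖p - p₀‖ + ‖p₀‖ := norm_le_norm_sub_add p p₀
      linarith
    rw [hFv]
    change _ ≤ (C * S + D * S') * jb ζ ^ (-((n : ℝ) + 1))
    rw [add_mul]
    have pζ := (jb_rpow_pos ζ (-((n : ℝ) + 1))).le
    refine (norm_add_le _ _).trans (add_le_add ((hC p.1 ζ p.2 t hx le_rfl).trans ?_)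
      ((hD p.1 ζ p.2 t hx le_rfl).trans ?_))
    · gcongr
      exact (Real.le_norm_self _).trans (hS p hp')
    · gcongr
      exact (Real.le_norm_self _).trans (hS' p hp')

end Reduction

/-! ### Taylor expansion of the left symbol in the parameter t. -/

section Expansion

open MeasureTheory FourierTransform

variable {n : ℕ} {A B : Rn n × Rn n → Rn n → ℂ} {m m' : ℝ}

theorem dX_Ls (hA : Amp m A) (t : ℝ) (v : Rn n) : dX v (Ls t A) = Ls t (dX (v, 0) A) := by
  funext x ξ
  have h := (differentiable_Ls hA t).2 (x, ξ) (v, 0)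
  have h0 : dT (0 : Rn n) A = 0 := by funext x θ; simp [dT]
  rw [← fderiv_comp_prodMk_left (differentiable_Ls hA t).1] at h
  simp only [h0, Ls_zero, Pi.zero_apply, add_zero] at h
  exact h

theorem dT_Ls (hA : Amp m A) (t : ℝ) (w : Rn n) : dT w (Ls t A) = Ls t (dT w A) := by
  funext x ξ
  have h := (differentiable_Ls hA t).2 (x, ξ) (0, w)
  have h0 : dX ((0, 0) : Rn n × Rn n) A = 0 := by
    funext x θ; exact map_zero (fderiv ℝ (fun x' => A x' θ) x)
  rw [← fderiv_comp_prodMk_right (differentiable_Ls hA t).1] at h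
  simp only [h0, Ls_zero, Pi.zero_apply, zero_add] at h
  exact h

/-- The derivative of `Ls t A` is a sum of functions `Ls t B` with B again an amplitude, so the
order of differentiability can be raised indefinitely. -/
theorem smooth2_Ls (hA : Amp m A) (t : ℝ) : Smooth2 (Ls t A) := by
  refine contDiff_infty.2 fun N => ?_
  induction N generalizing m A with
  | zero => exact contDiff_zero.2 (differentiable_Ls hA t).1.continuous
  | succ N ih =>
    rw [show ((N + 1 : ℕ) : WithTop ℕ∞) = (N : WithTop ℕ∞) + 1 by push_cast; rfl,
      contDiff_succ_iff_fderiv_apply]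
    refine ⟨(differentiable_Ls hA t).1, by simp, fun v => ?_⟩
    simp only [(differentiable_Ls hA t).2 _ v]
    exact (ih (hA.dX _)).add (ih (hA.dT _))

/-- The operator `-i ∑ ∂_{z_j} ∂_{ξ_j}` on amplitudes. -/
noncomputable def mixedLap (A : Rn n × Rn n → Rn n → ℂ) : Rn n × Rn n → Rn n → ℂ :=
  (-Complex.I) • ∑ i, dX (0, EuclideanSpace.basisFun (Fin n) ℝ i)
    (dT (EuclideanSpace.basisFun (Fin n) ℝ i) A)

/-- The restriction of an amplitude to the diagonal `y = x`. -/
noncomputable abbrev diagPart (A : Rn n × Rn n → Rn n → ℂ) : Rn n → Rn n → ℂ :=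
  pull (ContinuousLinearMap.inl ℝ (Rn n) (Rn n)) A

theorem Amp.sum {ι : Type*} {s : Finset ι} {f : ι → Rn n × Rn n → Rn n → ℂ}
    (h : ∀ i ∈ s, Amp m (f i)) : Amp m (∑ i ∈ s, f i) :=
  ⟨IsSymbol.sum fun i hi => (h i hi).1, ZSupp.sum fun i hi => (h i hi).2⟩

theorem Amp.mixedLap (hA : Amp m A) : Amp (m - 1) (mixedLap A) :=
  (Amp.sum fun _ _ => (hA.dT _).dX _).const_smul _

theorem mixedLap_dX (hA : Smooth2 A) (v : Rn n × Rn n) :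
    mixedLap (dX v A) = dX v (mixedLap A) := by
  rw [mixedLap, mixedLap, dX_const_smul (Smooth2.sum fun i _ => (hA.dT _).dX _),
    dX_sum fun i _ => (hA.dT _).dX _]
  congr 2
  funext i
  rw [← hA.dX_dT_comm, (hA.dT _).dX_dX_comm]

theorem mixedLap_dT (hA : Smooth2 A) (w : Rn n) :
    mixedLap (dT w A) = dT w (mixedLap A) := by
  rw [mixedLap, mixedLap, dT_const_smul (Smooth2.sum fun i _ => (hA.dT _).dX _),
    dT_sum fun i _ => (hA.dT _).dX _]
  congr 2
  funext i
  rw [hA.dT_dT_comm, (hA.dT _).dX_dT_comm]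

theorem hatA_sum {ι : Type*} {s : Finset ι} {f : ι → Rn n × Rn n → Rn n → ℂ}
    (h : ∀ i ∈ s, Amp m (f i)) (x ζ η : Rn n) :
    hatA (∑ i ∈ s, f i) x ζ η = ∑ i ∈ s, hatA (f i) x ζ η := by
  classical
  induction s using Finset.induction_on with
  | empty => simp [hatA_zero]
  | insert i s hi ih =>
    rw [Finset.sum_insert hi, Finset.sum_insert hi, hatA_add (h i (by simp))
      (Amp.sum fun j hj => h j (by simp [hj])), ih fun j hj => h j (by simp [hj])]

/-- The chain rule gives 2πζ·∂_ξ, and on the Fourier side 2πζ_j is -i∂_{z_j}; together this is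
`mixedLap`. Formally `Ls t A` is the restriction to z = 0 of exp(t `mixedLap`) A. -/
theorem hasDerivAt_hatA_shift (hA : Amp m A) (x ζ ξ : Rn n) (t : ℝ) :
    HasDerivAt (fun t : ℝ => hatA A x ζ (ξ + (2 * Real.pi * t) • ζ))
      (hatA (mixedLap A) x ζ (ξ + (2 * Real.pi * t) • ζ)) t := by
  have h1 : HasDerivAt (fun t : ℝ => ((x, ξ + (2 * Real.pi * t) • ζ) : Rn n × Rn n))
      (0, (2 * Real.pi) • ζ) t := by
    refine (hasDerivAt_const t x).prodMk (HasDerivAt.const_add ξ ?_)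
    have := ((hasDerivAt_id t).const_mul (2 * Real.pi)).smul_const ζ
    simpa using this
  have h2 := HasFDerivAt.comp_hasDerivAt (f := fun t : ℝ =>
    ((x, ξ + (2 * Real.pi * t) • ζ) : Rn n × Rn n)) t
    (l := fun p : Rn n × Rn n => hatA A p.1 ζ p.2)
    ((differentiable_hatA hA ζ).1 (x, ξ + (2 * Real.pi * t) • ζ)).hasFDerivAt h1
  refine HasDerivAt.congr_deriv h2 ?_
  set L := fderiv ℝ (fun p : Rn n × Rn n => hatA A p.1 ζ p.2) (x, ξ + (2 * Real.pi * t) • ζ)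
    with hL
  have hLi : ∀ i, L (0, EuclideanSpace.basisFun (Fin n) ℝ i) =
      hatA (dT (EuclideanSpace.basisFun (Fin n) ℝ i) A) x ζ (ξ + (2 * Real.pi * t) • ζ) := by
    intro i
    rw [hL, (differentiable_hatA hA ζ).2]
    have h0 : dX ((0, 0) : Rn n × Rn n) A = 0 := by
      funext x θ; exact map_zero (fderiv ℝ (fun x' => A x' θ) x)
    simp [h0, hatA_zero]
  have e : ((0, (2 * Real.pi) • ζ) : Rn n × Rn n) =
      ∑ i, (2 * Real.pi * ζ i) • ((0, EuclideanSpace.basisFun (Fin n) ℝ i) : Rn n × Rn n) := by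
    have h3 : ζ = ∑ i, ζ i • EuclideanSpace.basisFun (Fin n) ℝ i := by
      have := (EuclideanSpace.basisFun (Fin n) ℝ).sum_repr ζ
      simpa using this.symm
    ext1
    · rw [Prod.fst_sum]; simp
    · rw [Prod.snd_sum]
      conv_lhs => rw [h3, Finset.smul_sum]
      simp [smul_smul]
  rw [e, map_sum, mixedLap, hatA_const_smul, hatA_sum fun i _ => (hA.dT _).dX _, Finset.mul_sum]
  refine Finset.sum_congr rfl fun i _ => ?_
  have h4 : (inner ℝ (EuclideanSpace.basisFun (Fin n) ℝ i) ζ : ℝ) = ζ i := by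
    simp [EuclideanSpace.inner_single_left]
  rw [map_smul, hLi, hatA_dX (hA.dT _).smooth (hA.dT _).zSupp, h4, Complex.real_smul]
  push_cast
  linear_combination (2 * Real.pi * (ζ i : ℂ) * hatA (dT (EuclideanSpace.basisFun (Fin n) ℝ i) A)
    x ζ (ξ + (2 * Real.pi * t) • ζ)) * Complex.I_mul_I

theorem hasDerivAt_Ls (hA : Amp m A) (x ξ : Rn n) (t : ℝ) :
    HasDerivAt (fun t : ℝ => Ls t A x ξ) (Ls t (mixedLap A) x ξ) t := by
  have hd := fun ζ (t : ℝ) => hasDerivAt_hatA_shift hA x ζ ξ t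
  have key := differentiable_param_integral
    (F := fun (t : ℝ) ζ => hatA A x ζ (ξ + (2 * Real.pi * t) • ζ))
    ((continuous_hatA_shift hA).comp (f := fun q : ℝ × Rn n => ((q.1, x, ξ), q.2)) (by fun_prop))
    (fun ζ t => (hd ζ t).differentiableAt) (fun t => integrable_hatA_shift hA t x ξ) ?_
  · have h1 := (key.1 t).hasDerivAt
    refine h1.congr_deriv ?_
    rw [← fderiv_apply_one_eq_deriv, key.2]
    simp only [fderiv_apply_one_eq_deriv, (hd _ _).deriv]
    rfl
  · intro t₀ v
    obtain ⟨C, -, hC⟩ := norm_hatA_shift_le hA.mixedLap (n + 1) ‖x‖ (|t₀| + 1)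
    refine ⟨fun ζ => |v| * (C * jb ξ ^ (m - 1) * jb ζ ^ (-((n : ℝ) + 1))),
      ((integrable_jb_nat n).const_mul _).const_mul _, fun t ht ζ => ?_⟩
    rw [(hd ζ t).hasFDerivAt.fderiv]
    simp only [ContinuousLinearMap.toSpanSingleton_apply, norm_smul, Real.norm_eq_abs]
    refine mul_le_mul_of_nonneg_left (hC x ζ ξ t le_rfl ?_) (abs_nonneg v)
    rw [Real.norm_eq_abs] at ht
    have := abs_sub_abs_le_abs_sub t t₀
    linarith

/-- At t = 0 the integral over ζ is Fourier inversion in z, evaluated at z = 0. -/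
theorem Ls_zero_left (hA : Amp m A) : Ls 0 A = diagPart A := by
  funext x ξ
  have hi := integrable_hatA_shift hA 0 x ξ
  simp only [mul_zero, zero_smul, add_zero] at hi
  have h := (hA.smooth.continuous_disp x ξ).fourierInv_fourier_eq
    (integrable_disp hA.smooth hA.zSupp x ξ) hi
  have h0 := congrFun h 0
  rw [Real.fourierInv_eq'] at h0
  simp only [inner_zero_right, mul_zero, Complex.ofReal_zero, zero_mul, Complex.exp_zero,
    one_smul] at h0
  simp only [Ls, mul_zero, zero_smul, add_zero]
  exact h0

theorem Amp.iterate_mixedLap (hA : Amp m A) (k : ℕ) : Amp (m - k) (_root_.mixedLap^[k] A) := by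
  induction k with
  | zero => simpa using hA
  | succ k ih =>
    rw [Function.iterate_succ_apply']
    have := ih.mixedLap
    rwa [show m - ((k + 1 : ℕ) : ℝ) = m - k - 1 by push_cast; ring]

theorem iterate_mixedLap_dX (hA : Amp m A) (v : Rn n × Rn n) (k : ℕ) :
    mixedLap^[k] (dX v A) = dX v (mixedLap^[k] A) := by
  induction k with
  | zero => rfl
  | succ k ih =>
    rw [Function.iterate_succ_apply', Function.iterate_succ_apply', ih,
      mixedLap_dX (hA.iterate_mixedLap k).smooth]

theorem iterate_mixedLap_dT (hA : Amp m A) (w : Rn n) (k : ℕ) :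
    mixedLap^[k] (dT w A) = dT w (mixedLap^[k] A) := by
  induction k with
  | zero => rfl
  | succ k ih =>
    rw [Function.iterate_succ_apply', Function.iterate_succ_apply', ih,
      mixedLap_dT (hA.iterate_mixedLap k).smooth]

/-- The remainder of order `N` of the expansion of `Ls t A`. -/
noncomputable def LsRem (N : ℕ) (t : ℝ) (A : Rn n × Rn n → Rn n → ℂ) : Rn n → Rn n → ℂ :=
  Ls t A - ∑ k ∈ Finset.range N, ((t ^ k / k.factorial : ℝ) : ℂ) • diagPart (mixedLap^[k] A)

theorem smooth2_term (hA : Amp m A) (k : ℕ) (c : ℂ) :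
    Smooth2 (c • diagPart (mixedLap^[k] A)) :=
  ((hA.iterate_mixedLap k).smooth.pull _).const_smul _

theorem dX_LsRem (hA : Amp m A) (N : ℕ) (t : ℝ) (v : Rn n) :
    dX v (LsRem N t A) = LsRem N t (dX (v, 0) A) := by
  rw [LsRem, dX_sub (smooth2_Ls hA t) (Smooth2.sum fun k _ => smooth2_term hA k _), dX_Ls hA,
    dX_sum fun k _ => smooth2_term hA k _, LsRem]
  congr 2
  funext k
  rw [dX_const_smul ((hA.iterate_mixedLap k).smooth.pull _), dX_pull (hA.iterate_mixedLap k).smooth,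
    iterate_mixedLap_dX hA]
  rfl

theorem dT_LsRem (hA : Amp m A) (N : ℕ) (t : ℝ) (w : Rn n) :
    dT w (LsRem N t A) = LsRem N t (dT w A) := by
  rw [LsRem, dT_sub (smooth2_Ls hA t) (Smooth2.sum fun k _ => smooth2_term hA k _), dT_Ls hA,
    dT_sum fun k _ => smooth2_term hA k _, LsRem]
  congr 2
  funext k
  rw [dT_const_smul ((hA.iterate_mixedLap k).smooth.pull _), dT_pull, iterate_mixedLap_dT hA]

/-- Differentiating in t removes the constant term of the Taylor polynomial and shifts the others,
so the remainder of level N + 1 of A differentiates to that of level N of `mixedLap A`. -/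
theorem hasDerivAt_LsRem (hA : Amp m A) (N : ℕ) (x ξ : Rn n) (t : ℝ) :
    HasDerivAt (fun t : ℝ => LsRem (N + 1) t A x ξ) (LsRem N t (mixedLap A) x ξ) t := by
  simp only [LsRem, Pi.sub_apply, Finset.sum_apply, Pi.smul_apply]
  refine (hasDerivAt_Ls hA x ξ t).sub ?_
  simp only [Finset.sum_range_succ' _ N]
  have h0 : ∀ t : ℝ, (((t ^ 0 / (Nat.factorial 0 : ℝ) : ℝ)) : ℂ) •
      diagPart (mixedLap^[0] A) x ξ = diagPart A x ξ := by intro t; simp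
  simp only [h0]
  refine HasDerivAt.add_const _ (HasDerivAt.fun_sum fun k _ => ?_)
  have h1 : HasDerivAt (fun t : ℝ => t ^ (k + 1) / ((k + 1).factorial : ℝ))
      (t ^ k / (k.factorial : ℝ)) t := by
    refine ((hasDerivAt_pow (k + 1) t).div_const _).congr_deriv ?_
    rw [Nat.factorial_succ]
    push_cast
    have : (k.factorial : ℝ) ≠ 0 := by exact_mod_cast k.factorial_ne_zero
    have : (k : ℝ) + 1 ≠ 0 := by positivity
    field_simp
  exact h1.ofReal_comp.smul_const _

theorem LsRem_succ_zero (hA : Amp m A) (N : ℕ) : LsRem (N + 1) 0 A = 0 := by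
  rw [LsRem, Finset.sum_range_succ', Ls_zero_left hA]
  simp

/-- Mean value inequality on [0,1]: the remainder vanishes at t = 0 when its level is positive, and
each level gains one order from `mixedLap`. -/
theorem norm_LsRem_le (hA : Amp m A) (N : ℕ) (r : ℝ) :
    ∃ C : ℝ, ∀ x ξ (t : ℝ), ‖x‖ ≤ r → 0 ≤ t → t ≤ 1 → ‖LsRem N t A x ξ‖ ≤ C * jb ξ ^ (m - N) := by
  induction N generalizing m A with
  | zero =>
    obtain ⟨C, hC⟩ := norm_Ls_le hA r 1
    refine ⟨C, fun x ξ t hx h0 h1 => ?_⟩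
    simpa [LsRem] using hC x ξ t hx (by rwa [abs_of_nonneg h0])
  | succ N ih =>
    obtain ⟨C, hC⟩ := ih hA.mixedLap
    refine ⟨C, fun x ξ t hx h0 h1 => ?_⟩
    have h2 := norm_image_sub_le_of_norm_deriv_le_segment' (a := (0 : ℝ)) (b := 1)
      (f := fun t : ℝ => LsRem (N + 1) t A x ξ) (f' := fun t => LsRem N t (mixedLap A) x ξ)
      (C := C * jb ξ ^ (m - 1 - N))
      (fun s _ => (hasDerivAt_LsRem hA N x ξ s).hasDerivWithinAt)
      (fun s hs => hC x ξ s hx hs.1 hs.2.le) t ⟨h0, h1⟩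
    rw [LsRem_succ_zero hA] at h2
    simp only [Pi.zero_apply, sub_zero] at h2
    have h3 : 0 ≤ C * jb ξ ^ (m - 1 - N) :=
      (norm_nonneg _).trans (hC x ξ 0 hx le_rfl zero_le_one)
    rw [show m - ((N + 1 : ℕ) : ℝ) = m - 1 - N by push_cast; ring]
    nlinarith

/-- Derivatives in x and ξ commute with taking remainders, so the sup bound for all amplitudes
suffices. Members of the class of order μ come from amplitudes of order μ + N. -/
theorem isSymbol_LsRem (hA : Amp m A) (N : ℕ) : IsSymbol (m - N) (LsRem N 1 A) := by
  refine isSymbol_of_closed (S := fun μ f => ∃ A, Amp (μ + N) A ∧ f = LsRem N 1 A) ?_ ?_ ?_ ?_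
    ⟨A, by simpa using hA, rfl⟩
  · rintro μ _ ⟨A, hA, rfl⟩
    exact (smooth2_Ls hA 1).sub (Smooth2.sum fun k _ => smooth2_term hA k _)
  · rintro μ _ ⟨A, hA, rfl⟩ r
    obtain ⟨C, hC⟩ := norm_LsRem_le hA N r
    exact ⟨C, fun x ξ hx => by simpa using hC x ξ 1 hx zero_le_one le_rfl⟩
  · rintro μ _ ⟨A, hA, rfl⟩ v
    exact ⟨_, hA.dX _, dX_LsRem hA N 1 v⟩
  · rintro μ _ ⟨A, hA, rfl⟩ w
    refine ⟨_, ?_, dT_LsRem hA N 1 w⟩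
    have := hA.dT w
    rwa [show μ - 1 + (N : ℝ) = μ + N - 1 by ring]

theorem isSymbol_Ls (hA : Amp m A) : IsSymbol m (Ls 1 A) := by
  simpa [LsRem] using isSymbol_LsRem hA 0

theorem isSymbol_Ls_sub_diagPart (hA : Amp m A) : IsSymbol (m - 1) (Ls 1 A - diagPart A) := by
  simpa [LsRem] using isSymbol_LsRem hA 1

theorem Cl.mixedLap {N : ℕ} (hA : Cl N m A) : Cl N (m - 1) (mixedLap A) :=
  (Cl.sum fun _ _ => (hA.dT _).dX _).const_smul _

theorem Cl.iterate_mixedLap {N : ℕ} (hA : Cl N m A) (k : ℕ) : Cl N m (_root_.mixedLap^[k] A) := by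
  induction k with
  | zero => simpa using hA
  | succ k ih =>
    rw [Function.iterate_succ_apply']
    simpa using ih.mixedLap.mono_one

/-- The first N Taylor terms are classical, and the remainder has order m - N. -/
theorem Cl.Ls {N : ℕ} (hA : Cl N m A) (hz : ZSupp A) : Cl N m (Ls 1 A) := by
  have h1 := (isSymbol_LsRem ⟨hA.isSymbol, hz⟩ N).cl
  have h2 : Cl N m (∑ k ∈ Finset.range N, (((1 : ℝ) ^ k / k.factorial : ℝ) : ℂ) •
      diagPart (_root_.mixedLap^[k] A)) :=
    Cl.sum fun k _ => ((hA.iterate_mixedLap k).pull _).const_smul _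
  have := h1.add h2
  rwa [LsRem, sub_add_cancel] at this

end Expansion

/-! ### Operators on test functions and oscillatory integrals. -/

section Operators

open MeasureTheory FourierTransform

variable {n : ℕ} {A B : Rn n × Rn n → Rn n → ℂ} {m m' : ℝ} {u v : Rn n → ℂ}

/-- The character `x ↦ e^{2πi⟨x,ζ⟩}`. -/
noncomputable def ch (ζ x : Rn n) : ℂ := Complex.exp (↑(2 * Real.pi * inner ℝ x ζ) * Complex.I)

theorem norm_ch (ζ x : Rn n) : ‖ch ζ x‖ = 1 := Complex.norm_exp_ofReal_mul_I _

theorem ch_add (ζ x y : Rn n) : ch ζ (x + y) = ch ζ x * ch ζ y := by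
  rw [ch, ch, ch, ← Complex.exp_add, inner_add_left]
  congr 1; push_cast; ring

theorem ch_add_left (ζ η x : Rn n) : ch (ζ + η) x = ch ζ x * ch η x := by
  rw [ch, ch, ch, ← Complex.exp_add, inner_add_right]
  congr 1; push_cast; ring

theorem ch_neg (ζ x : Rn n) : ch ζ (-x) = (starRingEnd ℂ) (ch ζ x) := by
  rw [ch, ch, ← Complex.exp_conj, inner_neg_left, map_mul, Complex.conj_ofReal, Complex.conj_I]
  congr 1; push_cast; ring

theorem ch_neg_left (ζ x : Rn n) : ch (-ζ) x = ch ζ (-x) := by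
  rw [ch, ch, inner_neg_left, inner_neg_right]

theorem ch_zero (ζ : Rn n) : ch ζ 0 = 1 := by simp [ch]

theorem ch_mul_ch_neg (ζ x : Rn n) : ch ζ x * ch ζ (-x) = 1 := by
  rw [← ch_add, add_neg_cancel, ch_zero]

theorem contDiff_ch (ζ : Rn n) : ContDiff ℝ ∞ (ch ζ) := by
  have h1 : ContDiff ℝ ∞ fun x : Rn n => ((2 * Real.pi * inner ℝ x ζ : ℝ) : ℂ) :=
    Complex.ofRealCLM.contDiff.comp (contDiff_const.mul (contDiff_id.inner ℝ contDiff_const))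
  exact (h1.mul contDiff_const).cexp

theorem fourier_eq_ch (f : Rn n → ℂ) (ζ : Rn n) : 𝓕 f ζ = ∫ z, ch ζ (-z) * f z := by
  rw [Real.fourier_eq']
  simp [ch]

theorem hatA_eq_ch (A : Rn n × Rn n → Rn n → ℂ) (x ζ η : Rn n) :
    hatA A x ζ η = ∫ z, ch ζ (-z) * A (x, z) η := fourier_eq_ch _ _

/-- Functions in `C_0^∞(ℝⁿ)`. -/
structure IsTest (u : Rn n → ℂ) : Prop where
  smooth : ContDiff ℝ ∞ u
  cpt : HasCompactSupport u

theorem isTest_coe (u : TestFn n) : IsTest (u : Rn n → ℂ) := ⟨u.contDiff, u.hasCompactSupport⟩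

/-- The bundled test function. -/
def IsTest.toTestFn (hu : IsTest u) : TestFn n := ⟨u, hu.smooth, hu.cpt, Set.subset_univ _⟩

theorem IsTest.coe_toTestFn (hu : IsTest u) : (hu.toTestFn : Rn n → ℂ) = u := rfl

theorem IsTest.exists_radius (hu : IsTest u) : ∃ M, 0 ≤ M ∧ ∀ x, M < ‖x‖ → u x = 0 := by
  obtain ⟨M, hM⟩ := hu.cpt.isCompact.isBounded.subset_closedBall (0 : Rn n)
  refine ⟨|M|, abs_nonneg M, fun x hx => image_eq_zero_of_notMem_tsupport fun h => ?_⟩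
  have := hM h
  rw [mem_closedBall_zero_iff] at this
  linarith [le_abs_self M]

theorem isTest_of_radius (hu : ContDiff ℝ ∞ u) {M : ℝ} (h : ∀ x, M < ‖x‖ → u x = 0) : IsTest u :=
  ⟨hu, HasCompactSupport.intro (isCompact_closedBall (0 : Rn n) M) fun x hx =>
    h x (by simpa using hx)⟩

theorem IsTest.mul (hu : IsTest u) (hv : ContDiff ℝ ∞ v) : IsTest (u * v) :=
  ⟨hu.smooth.mul hv, hu.cpt.mul_right⟩

theorem IsTest.conj (hu : IsTest u) : IsTest (fun x => (starRingEnd ℂ) (u x)) :=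
  ⟨Complex.conjCLE.contDiff.comp hu.smooth, hu.cpt.comp_left (map_zero _)⟩

theorem IsTest.integrable (hu : IsTest u) : Integrable u :=
  hu.smooth.continuous.integrable_of_hasCompactSupport hu.cpt

/-- The function `(x, z) ↦ u(x + z)` as an amplitude. -/
def shiftA (u : Rn n → ℂ) : Rn n × Rn n → Rn n → ℂ := base n fun p => u (p.1 + p.2)

theorem IsTest.amp_shiftA (hu : IsTest u) : Amp 0 (shiftA u) := by
  refine ⟨isSymbol_base (hu.smooth.comp (contDiff_fst.add contDiff_snd)), fun r => ?_⟩
  obtain ⟨M, -, hM⟩ := hu.exists_radius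
  refine ⟨M + r, fun x z ξ hx hz => hM _ ?_⟩
  have := norm_sub_le (x + z) x
  rw [add_sub_cancel_left] at this
  linarith

theorem Amp.mul_symbol (hA : Amp m A) (hB : IsSymbol m' B) : Amp (m + m') (A * B) :=
  ⟨hA.1.mul hB, by rw [mul_comm]; exact hA.2.mul_left B⟩

theorem IsTest.amp_mul (hu : IsTest u) (hA : IsSymbol m A) : Amp m (shiftA u * A) := by
  simpa using hu.amp_shiftA.mul_symbol hA

/-- The operator `u ↦ ∫∫ e^{-2πi⟨z,ζ⟩} A(x, z, 2πζ) u(x + z) dz dζ`. -/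
noncomputable def opA (A : Rn n × Rn n → Rn n → ℂ) (u : Rn n → ℂ) (x : Rn n) : ℂ :=
  Ls 1 (shiftA u * A) x 0

theorem opA_eq (A : Rn n × Rn n → Rn n → ℂ) (u : Rn n → ℂ) (x : Rn n) :
    opA A u x = ∫ ζ, hatA (shiftA u * A) x ζ ((2 * Real.pi) • ζ) := by simp [opA, Ls]

/-- The factor u(x + z) supplies the compact support in z, so `opA` is an instance of `Ls` even when
A has no support condition. -/
theorem contDiff_opA (hA : IsSymbol m A) (hu : IsTest u) : ContDiff ℝ ∞ (opA A u) :=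
  (smooth2_Ls (hu.amp_mul hA) 1).fst 0

theorem shiftA_add : shiftA (u + v) = shiftA u + shiftA v := rfl

theorem shiftA_smul (c : ℂ) : shiftA (c • u) = c • shiftA u := rfl

theorem opA_add (hA : IsSymbol m A) (hu : IsTest u) (hv : IsTest v) :
    opA A (u + v) = opA A u + opA A v := by
  funext x
  simp only [opA, Pi.add_apply, shiftA_add, add_mul]
  rw [Ls_add (hu.amp_mul hA) (hv.amp_mul hA)]; rfl

theorem opA_smul (c : ℂ) : opA A (c • u) = c • opA A u := by
  funext x
  simp only [opA, Pi.smul_apply, shiftA_smul, smul_mul_assoc]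
  rw [Ls_const_smul]; rfl

theorem opA_add_left (hA : IsSymbol m A) (hB : IsSymbol m' B) (hu : IsTest u) :
    opA (A + B) u = opA A u + opA B u := by
  funext x
  simp only [opA, Pi.add_apply, mul_add]
  rw [Ls_add (hu.amp_mul hA) (hu.amp_mul hB)]; rfl

/-- The operator with amplitude `A(x, y - x, ξ)` on test functions. -/
noncomputable def opL (hA : IsSymbol m A) : TestOp n where
  toFun u := opA A u
  map_add' u v := opA_add hA (isTest_coe u) (isTest_coe v)
  map_smul' c _ := opA_smul c

theorem opL_apply (hA : IsSymbol m A) (u : TestFn n) : opL hA u = opA A u := rfl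

theorem hatA_shiftA_mul (A : Rn n × Rn n → Rn n → ℂ) (u : Rn n → ℂ) (x ζ η : Rn n) :
    hatA (shiftA u * A) x ζ η = ∫ y, ch ζ (x - y) * A (x, y - x) η * u y := by
  rw [hatA_eq_ch, ← integral_sub_right_eq_self _ x]
  congr 1
  funext y
  simp only [shiftA, base, Pi.mul_apply, neg_sub, add_sub_cancel]
  ring

theorem opA_eq_of_shiftA_mul (h : ∀ z η, u (x + z) * A (x, z) η = v (x + z) * B (x, z) η) :
    opA A u x = opA B v x := by
  have : ∀ ζ η, hatA (shiftA u * A) x ζ η = hatA (shiftA v * B) x ζ η := by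
    intro ζ η
    rw [hatA_eq_ch, hatA_eq_ch]
    congr 1
    funext z
    congr 1
    exact h z η
  simp only [opA_eq, this]

theorem integrable_opA (hA : IsSymbol m A) (hu : IsTest u) (x : Rn n) :
    Integrable fun ζ => hatA (shiftA u * A) x ζ ((2 * Real.pi) • ζ) := by
  simpa using integrable_hatA_shift (hu.amp_mul hA) 1 x 0

/-- After integration in y the integrand decays rapidly in ξ, so the regularizing cutoff is removed
by dominated convergence. The substitution ξ = 2πζ absorbs the factor (2π)^{-n}. -/
theorem hasAmplitude_opL (hA : IsSymbol m A) :
    HasAmplitude (opL hA) (fun p ξ => A (p.1, p.2 - p.1) ξ) := by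
  intro u x χ hχ
  have hu := isTest_coe u
  have h2 : (0 : ℝ) < 2 * Real.pi := by positivity
  have e : ∀ ε : ℝ, (((2 * Real.pi) ^ n : ℝ) : ℂ)⁻¹ * ∫ ξ : Rn n, ∫ y : Rn n,
      Complex.exp (Complex.I * ((inner ℝ (x - y) ξ : ℝ) : ℂ)) * χ (ε • ξ) *
        A (x, y - x) ξ * u y =
      ∫ ζ, χ (ε • (2 * Real.pi) • ζ) * hatA (shiftA u * A) x ζ ((2 * Real.pi) • ζ) := by
    intro ε
    have h3 := Measure.integral_comp_smul (volume : Measure (Rn n)) (fun ξ : Rn n => ∫ y : Rn n,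
      Complex.exp (Complex.I * ((inner ℝ (x - y) ξ : ℝ) : ℂ)) * χ (ε • ξ) *
        A (x, y - x) ξ * u y) (2 * Real.pi)
    rw [abs_of_nonneg (by positivity), finrank_euclideanSpace_fin, Complex.real_smul] at h3
    push_cast at h3 ⊢
    rw [← h3]
    congr 1
    funext ζ
    rw [hatA_shiftA_mul, ← integral_const_mul]
    congr 1
    funext y
    have : Complex.exp (Complex.I * ((inner ℝ (x - y) ((2 * Real.pi) • ζ) : ℝ) : ℂ)) =
        ch ζ (x - y) := by
      rw [ch, inner_smul_right, mul_comm]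
    rw [this]
    ring
  simp only [e]
  rw [opL_apply, opA_eq]
  obtain ⟨C, hC⟩ := hχ.2.1.exists_bound_of_continuous hχ.1.continuous
  refine tendsto_integral_filter_of_dominated_convergence
    (fun ζ => C * ‖hatA (shiftA u * A) x ζ ((2 * Real.pi) • ζ)‖) ?_ ?_
    ((integrable_opA hA hu x).norm.const_mul C) ?_
  · refine Filter.Eventually.of_forall fun ε => ?_
    exact (hχ.1.continuous.comp (by fun_prop)).aestronglyMeasurable.mul
      (integrable_opA hA hu x).aestronglyMeasurable
  · refine Filter.Eventually.of_forall fun ε => Filter.Eventually.of_forall fun ζ => ?_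
    rw [norm_mul]
    exact mul_le_mul_of_nonneg_right (hC _) (norm_nonneg _)
  · refine Filter.Eventually.of_forall fun ζ => ?_
    have h4 : Filter.Tendsto (fun ε : ℝ => ε • (2 * Real.pi) • ζ) (𝓝[>] 0) (𝓝 0) := by
      have : Continuous fun ε : ℝ => ε • (2 * Real.pi) • ζ := by fun_prop
      have h5 := this.tendsto 0
      rw [zero_smul] at h5
      exact h5.mono_left nhdsWithin_le_nhds
    have h6 : Filter.Tendsto (fun ε : ℝ => χ (ε • (2 * Real.pi) • ζ)) (𝓝[>] 0) (𝓝 1) :=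
      tendsto_const_nhds.congr' ((h4.eventually hχ.2.2).mono fun ε h => h.symm)
    simpa using h6.mul_const (hatA (shiftA u * A) x ζ ((2 * Real.pi) • ζ))

/-- A smooth even cutoff that is `1` on the ball of radius `R` and has support in the ball of
radius `2R`. -/
theorem exists_bump (n : ℕ) {R : ℝ} (hR : 0 < R) : ∃ ψ : Rn n → ℝ, ContDiff ℝ ∞ ψ ∧
    (∀ z, ‖z‖ ≤ R → ψ z = 1) ∧ (∀ z, 2 * R ≤ ‖z‖ → ψ z = 0) ∧ (∀ z, ψ (-z) = ψ z) ∧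
    ∀ z, 0 ≤ ψ z ∧ ψ z ≤ 1 := by
  let f : ContDiffBump (0 : Rn n) := ⟨R, 2 * R, hR, by linarith⟩
  refine ⟨f, f.contDiff, fun z hz => f.one_of_mem_closedBall (by simpa using hz),
    fun z hz => f.zero_of_le_dist (by simpa using hz), f.neg, fun z => ⟨f.nonneg, f.le_one⟩⟩

theorem exists_isCutoff (n : ℕ) : ∃ χ : Rn n → ℂ, IsCutoff χ := by
  obtain ⟨ψ, h1, h2, h3, -⟩ := exists_bump n one_pos
  have hc : ContDiff ℝ ∞ fun z => (ψ z : ℂ) := Complex.ofRealCLM.contDiff.comp h1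
  refine ⟨fun z => ψ z, hc, (isTest_of_radius (M := 2) hc fun z hz => ?_).cpt, ?_⟩
  · rw [h3 z (by linarith), Complex.ofReal_zero]
  · filter_upwards [Metric.closedBall_mem_nhds (0 : Rn n) one_pos] with z hz
    rw [h2 z (by simpa using hz), Complex.ofReal_one]

theorem HasAmplitude.unique {P P' : TestOp n} {a : Rn n × Rn n → Rn n → ℂ} (h : HasAmplitude P a)
    (h' : HasAmplitude P' a) : P = P' := by
  obtain ⟨χ, hχ⟩ := exists_isCutoff n
  ext u x
  exact tendsto_nhds_unique (h u x χ hχ) (h' u x χ hχ)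

end Operators

/-! ### Left symbols, adjoints and squares of operators. -/

section Composition

open MeasureTheory FourierTransform

variable {n : ℕ} {A B : Rn n × Rn n → Rn n → ℂ} {m m' : ℝ} {u v : Rn n → ℂ}

theorem ch_sub_left (ζ η x : Rn n) : ch (ζ - η) x = ch ζ x * ch η (-x) := by
  rw [sub_eq_add_neg, ch_add_left, ch_neg_left]

/-- The Fourier transform of a product is the convolution of the Fourier transforms. -/
theorem integral_fourier_sub_mul_fourier {f g : Rn n → ℂ} (hf : Integrable f) (hg : Integrable g)
    (hgc : Continuous g) (hg' : Integrable (𝓕 g)) (η : Rn n) :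
    ∫ ζ, 𝓕 f (η - ζ) * 𝓕 g ζ = 𝓕 (fun z => f z * g z) η := by
  -- This function has Fourier transform ζ ↦ 𝓕 f (η - ζ); moving the second transform onto `h` and
  -- inverting yields the claim.
  set h : Rn n → ℂ := fun z => ch η z * f (-z) with hh
  have hch : Continuous (ch η) := (contDiff_ch η).continuous
  have hhi : Integrable h :=
    hf.comp_neg.bdd_mul (c := 1) hch.aestronglyMeasurable
      (Filter.Eventually.of_forall fun z => (norm_ch η z).le)
  have h1 : ∀ ζ, 𝓕 h ζ = 𝓕 f (η - ζ) := by
    intro ζ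
    rw [fourier_eq_ch, fourier_eq_ch, ← integral_neg_eq_self]
    congr 1
    funext z
    simp only [hh, neg_neg, ch_sub_left]
    ring
  have h2 := VectorFourier.integral_fourierIntegral_smul_eq_flip (L := innerₗ (Rn n))
    (μ := volume) (ν := volume) Real.continuous_fourierChar continuous_inner hhi hg'
  have h3 : ∀ z, 𝓕 (𝓕 g) z = g (-z) := by
    intro z
    have := congrFun (hgc.fourierInv_fourier_eq hg hg') (-z)
    rw [Real.fourierInv_eq_fourier_neg, neg_neg] at this
    exact this
  have h4 : ∫ ζ, 𝓕 h ζ • 𝓕 g ζ = ∫ z, h z • 𝓕 (𝓕 g) z := by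
    rw [flip_innerₗ] at h2
    exact h2
  simp only [h1, h3, smul_eq_mul] at h4
  rw [h4, fourier_eq_ch, ← integral_neg_eq_self]
  congr 1
  funext z
  simp only [hh, neg_neg]
  ring

/-- A left symbol as an amplitude. -/
noncomputable abbrev leftA (p : Rn n → Rn n → ℂ) : Rn n × Rn n → Rn n → ℂ :=
  pull (ContinuousLinearMap.fst ℝ (Rn n) (Rn n)) p

/-- A right symbol as an amplitude. -/
noncomputable abbrev rightA (p : Rn n → Rn n → ℂ) : Rn n × Rn n → Rn n → ℂ :=
  pull (ContinuousLinearMap.fst ℝ (Rn n) (Rn n) + ContinuousLinearMap.snd ℝ (Rn n) (Rn n)) p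

theorem opA_leftA (p : Rn n → Rn n → ℂ) (u : Rn n → ℂ) (x : Rn n) :
    opA (leftA p) u x = ∫ ζ, p x ((2 * Real.pi) • ζ) * 𝓕 (fun z => u (x + z)) ζ := by
  rw [opA_eq]
  congr 1
  funext ζ
  rw [hatA_eq_ch, fourier_eq_ch, ← integral_const_mul]
  congr 1
  funext z
  simp only [shiftA, base, Pi.mul_apply, pull, ContinuousLinearMap.coe_fst']
  ring

theorem IsTest.comp_add_left (hu : IsTest u) (x : Rn n) : IsTest fun z => u (x + z) := by
  refine ⟨hu.smooth.comp (contDiff_const.add contDiff_id), ?_⟩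
  exact hu.cpt.comp_homeomorph (Homeomorph.addLeft x)

theorem IsTest.fourier_decay (hu : IsTest u) (x : Rn n) (L : ℝ) :
    ∃ C, 0 ≤ C ∧ ∀ ζ, ‖𝓕 (fun z => u (x + z)) ζ‖ ≤ C * jb ζ ^ (-L) := by
  obtain ⟨C, hC0, hC⟩ := norm_hatA_decay hu.amp_shiftA L ‖x‖
  exact ⟨C, hC0, fun ζ => by simpa [hatA, shiftA, base] using hC x ζ 0 le_rfl⟩

theorem IsTest.continuous_fourier (hu : IsTest u) : Continuous (𝓕 u) :=
  VectorFourier.fourierIntegral_continuous Real.continuous_fourierChar continuous_inner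
    hu.integrable

/-- An amplitude of compact support in the displacement can be replaced by its left symbol. -/
theorem opA_leftA_Ls (hA : Amp m A) (hu : IsTest u) : opA (leftA (Ls 1 A)) u = opA A u := by
  funext x
  -- Decay n + 1 makes both frequency integrals converge; the extra |m| pays for the growth of A at
  -- 2πη, where η = (η - ζ) + ζ.
  set L : ℝ := n + 1 + |m| with hL
  set U : Rn n → ℂ := 𝓕 (fun z => u (x + z)) with hU
  have hux := hu.comp_add_left x
  have hUc : Continuous U := hux.continuous_fourier
  obtain ⟨C, hC0, hC⟩ := norm_hatA_decay hA L ‖x‖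
  obtain ⟨C', hC0', hC'⟩ := hu.fourier_decay x L
  have hUi : Integrable U := by
    refine ((integrable_jb_rpow (n := n) (s := L) ?_).const_mul C').mono' hUc.aestronglyMeasurable
      (Filter.Eventually.of_forall hC')
    rw [hL]; linarith [abs_nonneg m]
  rw [opA_leftA, opA_eq]
  have e1 : ∀ ζ, Ls 1 A x ((2 * Real.pi) • ζ) * U ζ =
      ∫ η, hatA A x (η - ζ) ((2 * Real.pi) • η) * U ζ := by
    intro ζ
    rw [Ls, ← integral_mul_const, ← integral_sub_right_eq_self _ ζ]
    congr 1
    funext η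
    congr 2
    module
  simp only [e1, ← hU]
  rw [integral_integral_swap]
  · congr 1
    -- For fixed η the integral over ζ is a convolution of Fourier transforms, namely the transform
    -- of A(x,z)u(x + z) in z.
    funext η
    have := integral_fourier_sub_mul_fourier
      (integrable_disp hA.smooth hA.zSupp x ((2 * Real.pi) • η)) hux.integrable
      hux.smooth.continuous hUi η
    refine this.trans ?_
    rw [hatA]
    refine congrArg (fun f : Rn n → ℂ => 𝓕 f η) (funext fun z => ?_)
    simp only [shiftA, base, Pi.mul_apply]
    ring
  · have hJ := (integrable_jb_nat n)
    have hJJ := Integrable.convolution_integrand (μ := (volume : Measure (Rn n)))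
      (ContinuousLinearMap.mul ℝ ℝ) hJ hJ
    have hbd := (hJJ.const_mul (C * C' * (2 ^ |m| * (1 + 2 * Real.pi) ^ |m|))).swap
    have hcont : Continuous (Function.uncurry fun ζ η : Rn n =>
        hatA A x (η - ζ) ((2 * Real.pi) • η) * U ζ) := by
      refine ((continuous_hatA hA.smooth hA.zSupp).comp
        (g := fun p : Rn n × Rn n × Rn n => hatA A p.1 p.2.1 p.2.2)
        (f := fun q : Rn n × Rn n => (x, q.2 - q.1, (2 * Real.pi) • q.2)) (by fun_prop)).mul
        (hUc.comp continuous_fst)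
    refine hbd.mono' hcont.aestronglyMeasurable (Filter.Eventually.of_forall ?_)
    rintro ⟨ζ, η⟩
    simp only [Function.uncurry, Function.comp_apply, Prod.swap, ContinuousLinearMap.mul_apply']
    rw [norm_mul]
    have p1 := jb_pos (η - ζ)
    have p2 := jb_pos ζ
    have p3 := jb_rpow_pos (η - ζ) (-L)
    have p4 := jb_rpow_pos ζ (-L)
    have h1 := hC x (η - ζ) ((2 * Real.pi) • η) le_rfl
    have h2 := hC' ζ
    have h3 : jb ((2 * Real.pi) • η) ^ m ≤
        2 ^ |m| * (1 + 2 * Real.pi) ^ |m| * (jb (η - ζ) ^ |m| * jb ζ ^ |m|) := by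
      have h4 : jb ((2 * Real.pi) • η) ≤ (1 + 2 * Real.pi) * (2 * jb (η - ζ) * jb ζ) := by
        refine (jb_smul_le _ _).trans ?_
        rw [abs_of_pos (by positivity)]
        have := jb_add_le (η - ζ) ζ
        rw [sub_add_cancel] at this
        gcongr
      calc jb ((2 * Real.pi) • η) ^ m ≤ jb ((2 * Real.pi) • η) ^ |m| :=
            jb_rpow_le_rpow _ (le_abs_self m)
        _ ≤ ((1 + 2 * Real.pi) * (2 * jb (η - ζ) * jb ζ)) ^ |m| :=
            Real.rpow_le_rpow (jb_pos _).le h4 (abs_nonneg m)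
        _ = _ := by
            rw [Real.mul_rpow (by positivity) (by positivity),
              Real.mul_rpow (by positivity) (by positivity),
              Real.mul_rpow (by positivity) (by positivity)]
            ring
    have e2 : ∀ θ : Rn n, jb θ ^ (-((n : ℝ) + 1)) = jb θ ^ (-L) * jb θ ^ |m| := by
      intro θ
      rw [← Real.rpow_add (jb_pos θ), hL]
      congr 1; ring
    rw [e2, e2]
    calc ‖hatA A x (η - ζ) ((2 * Real.pi) • η)‖ * ‖U ζ‖
        ≤ (C * jb (η - ζ) ^ (-L) * jb ((2 * Real.pi) • η) ^ m) * (C' * jb ζ ^ (-L)) := by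
          gcongr
          exact (norm_nonneg _).trans h1
      _ ≤ (C * jb (η - ζ) ^ (-L) * (2 ^ |m| * (1 + 2 * Real.pi) ^ |m| *
          (jb (η - ζ) ^ |m| * jb ζ ^ |m|))) * (C' * jb ζ ^ (-L)) := by gcongr
      _ = _ := by ring

/-- With ζ outermost, the inner double integral treats x and y symmetrically, which makes the
adjoint visible. -/
theorem integral_opA_mul (hA : IsSymbol m A) (hu : IsTest u) (hv : IsTest v) :
    ∫ x, opA A u x * v x =
      ∫ ζ, ∫ x, ∫ y, ch ζ (x - y) * A (x, y - x) ((2 * Real.pi) • ζ) * u y * v x := by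
  have e1 : ∀ x, opA A u x * v x =
      ∫ ζ, hatA (shiftA u * A) x ζ ((2 * Real.pi) • ζ) * v x := fun x => by
    rw [opA_eq, integral_mul_const]
  have e2 : ∀ ζ x, hatA (shiftA u * A) x ζ ((2 * Real.pi) • ζ) * v x =
      ∫ y, ch ζ (x - y) * A (x, y - x) ((2 * Real.pi) • ζ) * u y * v x := fun ζ x => by
    rw [hatA_shiftA_mul, integral_mul_const]
  simp only [e1, ← e2]
  refine integral_integral_swap ?_
  obtain ⟨M, -, hM⟩ := hv.exists_radius
  have hAu := hu.amp_mul hA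
  obtain ⟨C, hC0, hC⟩ := norm_hatA_shift_le hAu (n + 1) M 1
  have hbd : Integrable (fun p : Rn n × Rn n => ‖v p.1‖ * (C * jb p.2 ^ (-((n : ℝ) + 1))))
      (volume.prod volume) :=
    Integrable.mul_prod hv.integrable.norm ((integrable_jb_nat n).const_mul C)
  have hcont : Continuous (Function.uncurry fun x ζ : Rn n =>
      hatA (shiftA u * A) x ζ ((2 * Real.pi) • ζ) * v x) :=
    ((continuous_hatA hAu.smooth hAu.zSupp).comp
      (g := fun p : Rn n × Rn n × Rn n => hatA (shiftA u * A) p.1 p.2.1 p.2.2)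
      (f := fun q : Rn n × Rn n => (q.1, q.2, (2 * Real.pi) • q.2)) (by fun_prop)).mul
      (hv.smooth.continuous.comp continuous_fst)
  refine hbd.mono' hcont.aestronglyMeasurable (Filter.Eventually.of_forall ?_)
  rintro ⟨x, ζ⟩
  simp only [Function.uncurry]
  rw [norm_mul, mul_comm]
  by_cases hx : M < ‖x‖
  · simp [hM x hx]
  · refine mul_le_mul_of_nonneg_left ?_ (norm_nonneg _)
    have := hC x ζ 0 1 (not_lt.1 hx) (by simp)
    simpa [jb] using this

/-- The formal adjoint. -/
theorem integral_opA_mul_conj (hA : IsSymbol m A) (hB : IsSymbol m' B)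
    (h : ∀ x y ξ, A (x, y - x) ξ = (starRingEnd ℂ) (B (y, x - y) ξ)) (hu : IsTest u)
    (hv : IsTest v) :
    ∫ x, opA A u x * (starRingEnd ℂ) (v x) = ∫ x, u x * (starRingEnd ℂ) (opA B v x) := by
  have e : ∫ x, u x * (starRingEnd ℂ) (opA B v x) =
      (starRingEnd ℂ) (∫ x, opA B v x * (starRingEnd ℂ) (u x)) := by
    rw [← integral_conj]
    congr 1; funext x
    rw [map_mul, Complex.conj_conj, mul_comm]
  rw [e, integral_opA_mul hA hu hv.conj, integral_opA_mul hB hv hu.conj, ← integral_conj]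
  congr 1
  funext ζ
  rw [← integral_conj]
  simp only [← integral_conj]
  rw [integral_integral_swap]
  · congr 1; funext x; congr 1; funext y
    simp only [map_mul, Complex.conj_conj, ← ch_neg, neg_sub, ← h]
    ring
  · have hcont : Continuous (Function.uncurry fun x y : Rn n =>
        ch ζ (x - y) * A (x, y - x) ((2 * Real.pi) • ζ) * u y * (starRingEnd ℂ) (v x)) := by
      refine Continuous.mul (Continuous.mul (Continuous.mul ?_ ?_) ?_) ?_
      · exact (contDiff_ch ζ).continuous.comp (by fun_prop)
      · exact hA.smooth.continuous.comp (g := fun z : (Rn n × Rn n) × Rn n => A z.1 z.2)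
          (f := fun q : Rn n × Rn n => ((q.1, q.2 - q.1), (2 * Real.pi) • ζ)) (by fun_prop)
      · exact hu.smooth.continuous.comp continuous_snd
      · exact hv.conj.smooth.continuous.comp continuous_fst
    obtain ⟨M, -, hM⟩ := hu.exists_radius
    obtain ⟨M', -, hM'⟩ := hv.exists_radius
    refine hcont.integrable_of_hasCompactSupport (HasCompactSupport.intro
      ((isCompact_closedBall (0 : Rn n) M').prod (isCompact_closedBall (0 : Rn n) M)) ?_)
    rintro ⟨x, y⟩ hxy
    simp only [Function.uncurry]
    by_cases hx : M' < ‖x‖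
    · simp [hM' x hx]
    by_cases hy : M < ‖y‖
    · simp [hM y hy]
    exact absurd ⟨by simpa using hx, by simpa using hy⟩ hxy

theorem opA_zero (A : Rn n × Rn n → Rn n → ℂ) (x : Rn n) : opA A 0 x = 0 := by
  have := congrFun (opA_smul (A := A) (u := (0 : Rn n → ℂ)) 0) x
  simpa using this

theorem opA_eq_zero {x : Rn n} (h : ∀ z ξ, u (x + z) * A (x, z) ξ = 0) : opA A u x = 0 := by
  rw [← opA_zero A x]
  exact opA_eq_of_shiftA_mul fun z η => by simp [h]

/-- The action on exponentials. -/
theorem opA_eq_ch_mul {x ζ : Rn n}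
    (h : ∀ z ξ, A (x, z) ξ ≠ 0 → u (x + z) = ch ζ (x + z)) :
    opA A u x = ch ζ x * Ls 1 A x ((2 * Real.pi) • ζ) := by
  -- Translating the integration variable by ζ turns the exponential into a shift of the frequency
  -- in A by 2πζ.
  rw [opA_eq, Ls, ← integral_const_mul, ← integral_add_right_eq_self _ ζ]
  congr 1
  funext η
  rw [hatA_eq_ch, hatA_eq_ch, ← integral_const_mul]
  have e : (2 * Real.pi) • (η + ζ) = (2 * Real.pi) • ζ + (2 * Real.pi * 1) • η := by module
  rw [e]
  generalize (2 * Real.pi) • ζ + (2 * Real.pi * 1) • η = ξ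
  congr 1
  funext z
  by_cases h0 : A (x, z) ξ = 0
  · simp [h0]
  · simp only [shiftA, base, Pi.mul_apply, h z _ h0, ch_add, ch_add_left]
    linear_combination (ch η (-z) * ch ζ x * A (x, z) ξ) *
      ch_mul_ch_neg ζ z

theorem opA_support {R M : ℝ} (hR : ∀ x z ξ, R < ‖z‖ → A (x, z) ξ = 0)
    (hM : ∀ x, M < ‖x‖ → u x = 0) {x : Rn n} (hx : M + R < ‖x‖) : opA A u x = 0 := by
  refine opA_eq_zero fun z ξ => ?_
  by_cases hz : R < ‖z‖
  · simp [hR x z ξ hz]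
  · rw [hM, zero_mul]
    have := norm_sub_le (x + z) z
    rw [add_sub_cancel_right] at this
    linarith

theorem isTest_opA {R : ℝ} (hA : IsSymbol m A) (hR : ∀ x z ξ, R < ‖z‖ → A (x, z) ξ = 0)
    (hu : IsTest u) : IsTest (opA A u) := by
  obtain ⟨M, -, hM⟩ := hu.exists_radius
  exact isTest_of_radius (contDiff_opA hA hu) fun x hx => opA_support hR hM hx

/-- The square of a symmetric operator whose left symbol is `q` has amplitude
`q(x, ξ) \overline{q(y, ξ)}`. -/
theorem opA_opA {R : ℝ} (hR0 : 0 ≤ R) (hA : Amp m A) (hR : ∀ x z ξ, R < ‖z‖ → A (x, z) ξ = 0)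
    (h : ∀ x y ξ, A (x, y - x) ξ = (starRingEnd ℂ) (A (y, x - y) ξ)) (hu : IsTest u) :
    opA A (opA A u) = opA (leftA (Ls 1 A) * cj (rightA (Ls 1 A))) u := by
  obtain ⟨M, hM0, hM⟩ := hu.exists_radius
  have hv := isTest_opA hA.1 hR hu
  -- Exponentials are not test functions. This cutoff is 1 on the support of `opA A u` and on all
  -- points within R of the support of u, so it is invisible to both operators.
  obtain ⟨ψ, h1, h2, h3, -, -⟩ := exists_bump n (show 0 < M + R + 1 by linarith)
  have hψ : IsTest fun x => (ψ x : ℂ) :=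
    isTest_of_radius (M := 2 * (M + R + 1)) (Complex.ofRealCLM.contDiff.comp h1)
      fun x hx => by rw [h3 x hx.le, Complex.ofReal_zero]
  -- With the outer operator in left form, the inner one enters only through the Fourier transform
  -- of `opA A u`. By symmetry it is moved onto the exponential, where it multiplies by its left
  -- symbol; the conjugate of that gives the right factor.
  rw [← opA_leftA_Ls hA hv]
  funext x
  rw [opA_leftA, opA_eq]
  congr 1
  funext ζ
  have hψc : IsTest ((fun x => (ψ x : ℂ)) * ch ζ) := hψ.mul (contDiff_ch ζ)
  have e1 : 𝓕 (fun z => opA A u (x + z)) ζ =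
      ch ζ x * ∫ y, opA A u y * (starRingEnd ℂ) (((fun x => (ψ x : ℂ)) * ch ζ) y) := by
    rw [fourier_eq_ch, ← integral_const_mul, ← integral_sub_right_eq_self _ x]
    congr 1
    funext y
    rw [add_sub_cancel, neg_sub]
    by_cases hy : M + R < ‖y‖
    · simp [opA_support hR hM hy]
    · simp only [Pi.mul_apply]
      rw [h2 y (by linarith), Complex.ofReal_one, one_mul, ← ch_neg, sub_eq_add_neg, ch_add]
      ring
  rw [e1, integral_opA_mul_conj hA.1 hA.1 h hu hψc, hatA_shiftA_mul, ← mul_assoc,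
    ← integral_const_mul]
  congr 1
  funext y
  by_cases hy : M < ‖y‖
  · simp [hM y hy]
  · rw [opA_eq_ch_mul (ζ := ζ)]
    · simp only [map_mul, ← ch_neg, pull, cj, Pi.mul_apply, ContinuousLinearMap.coe_fst',
        add_apply, ContinuousLinearMap.coe_snd', add_sub_cancel]
      rw [sub_eq_add_neg, ch_add]
      ring
    · intro z ξ hz
      have hz' : ‖z‖ ≤ R := not_lt.1 fun h' => hz (hR _ _ _ h')
      simp only [Pi.mul_apply]
      rw [h2 _ (by linarith [norm_add_le y z]), Complex.ofReal_one, one_mul]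

end Composition

/-! ### Symmetric operators have real leading symbols. -/

section Realness

open MeasureTheory FourierTransform

variable {n : ℕ} {A B : Rn n × Rn n → Rn n → ℂ} {m μ : ℝ} {u v : Rn n → ℂ}

theorem rpow_le_add_of_mem {a b y : ℝ} (ha : 0 < a) (h1 : a ≤ y) (h2 : y ≤ b) (s : ℝ) :
    y ^ s ≤ a ^ s + b ^ s := by
  have hb : 0 < b := ha.trans_le (h1.trans h2)
  rcases le_total 0 s with hs | hs
  · have := Real.rpow_le_rpow (ha.le.trans h1) h2 hs
    have := Real.rpow_pos_of_pos ha s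
    linarith
  · have := Real.rpow_le_rpow_of_nonpos ha h1 hs
    have := Real.rpow_pos_of_pos hb s
    linarith

theorem exists_jb_smul_rpow_le {ξ : Rn n} (hξ : ξ ≠ 0) (s : ℝ) :
    ∃ C : ℝ, 0 ≤ C ∧ ∀ t : ℝ, 1 ≤ t → jb (t • ξ) ^ s ≤ C * t ^ s := by
  have h0 : 0 < ‖ξ‖ := norm_pos_iff.2 hξ
  have hj := jb_pos ξ
  refine ⟨‖ξ‖ ^ s + (2 * jb ξ) ^ s, by positivity, fun t ht => ?_⟩
  have ht0 : 0 < t := by linarith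
  have h1 : ‖ξ‖ ≤ jb (t • ξ) / t := by
    rw [le_div_iff₀ ht0]
    have := norm_le_jb (t • ξ)
    rwa [norm_smul, Real.norm_of_nonneg ht0.le, mul_comm] at this
  have h2 : jb (t • ξ) / t ≤ 2 * jb ξ := by
    rw [div_le_iff₀ ht0]
    refine (jb_smul_le t ξ).trans ?_
    rw [abs_of_pos ht0]
    nlinarith
  have h3 := rpow_le_add_of_mem h0 h1 h2 s
  rwa [Real.div_rpow (jb_pos _).le ht0.le, div_le_iff₀ (Real.rpow_pos_of_pos ht0 s)] at h3

/-- The quadratic form of an operator on the oscillating functions `φ(x) e^{i⟨x,ξ⟩}`. -/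
theorem integral_opA_oscillating {φ : Rn n → ℝ} (ξ : Rn n) :
    ∫ x, opA A ((fun x => (φ x : ℂ)) * ch ((2 * Real.pi)⁻¹ • ξ)) x *
        (starRingEnd ℂ) (((fun x => (φ x : ℂ)) * ch ((2 * Real.pi)⁻¹ • ξ)) x) =
      ∫ x, (φ x : ℂ) * Ls 1 (shiftA (fun x => (φ x : ℂ)) * A) x ξ := by
  congr 1
  funext x
  set ζ := (2 * Real.pi)⁻¹ • ξ with hζ
  have h1 : opA A ((fun x => (φ x : ℂ)) * ch ζ) x =
      opA (shiftA (fun x => (φ x : ℂ)) * A) (ch ζ) x := by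
    refine opA_eq_of_shiftA_mul fun z η => ?_
    simp only [shiftA, base, Pi.mul_apply]
    ring
  have h2 : (2 * Real.pi) • ζ = ξ := by
    rw [hζ, smul_inv_smul₀ (by positivity)]
  rw [h1, opA_eq_ch_mul fun _ _ _ => rfl, h2, Pi.mul_apply, map_mul, ← ch_neg, Complex.conj_ofReal]
  linear_combination (φ x * Ls 1 (shiftA (fun x => (φ x : ℂ)) * A) x ξ) * ch_mul_ch_neg ζ x

/-- On φ(x)e^{it⟨x,ξ⟩} the quadratic form is t^μ ∫ φ² s(x,ξ) + O(t^{μ-1}). Its imaginary part is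
zero, so dividing by t^μ and letting t → ∞ kills the integral of φ² Im s. -/
theorem integral_sq_mul_im_eq_zero {s : Rn n → Rn n → ℂ} (hA : IsSymbol μ A)
    (hs : EvHom μ s) (hd : IsSymbol (μ - 1) (diagPart A - s))
    (hsym : ∀ u, IsTest u → (∫ x, opA A u x * (starRingEnd ℂ) (u x)).im = 0) {ξ : Rn n}
    (hξ0 : ξ ≠ 0) (hξ : ∀ x (t : ℝ), 1 ≤ t → s x (t • ξ) = ((t ^ μ : ℝ) : ℂ) * s x ξ)
    {φ : Rn n → ℝ} (hφ : IsTest fun x => (φ x : ℂ)) :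
    ∫ x, φ x ^ 2 * (s x ξ).im = 0 := by
  set Φ : Rn n → ℂ := fun x => (φ x : ℂ) with hΦ
  have hA' := hφ.amp_mul hA
  -- All lower order errors at once: left symbol minus diagonal value, and diagonal value minus
  -- leading term.
  set d : Rn n → Rn n → ℂ := Ls 1 (shiftA Φ * A) - base n Φ * s with hd'
  have hds : IsSymbol (μ - 1) d := by
    have h1 := (isSymbol_Ls_sub_diagPart hA').add (hd.base_mul hφ.smooth)
    refine (congrArg (IsSymbol (μ - 1)) ?_).mp h1
    funext x θ
    simp only [hd', Pi.add_apply, Pi.sub_apply, Pi.mul_apply, pull, shiftA, base,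
      ContinuousLinearMap.inl_apply, add_zero]
    ring
  obtain ⟨M, -, hM⟩ := hφ.exists_radius
  obtain ⟨C, hC⟩ := hds.symBound M
  obtain ⟨C', hC0', hC'⟩ := exists_jb_smul_rpow_le hξ0 (μ - 1)
  set c := ∫ x, φ x ^ 2 * (s x ξ).im with hc
  have hφc : Continuous φ := by
    have := Complex.continuous_re.comp hφ.smooth.continuous
    simpa [hΦ, Function.comp_def] using this
  have hi1 : ∀ ξ, Integrable fun x => Φ x * (Φ x * s x ξ) := fun ξ =>
    (hφ.mul (hφ.smooth.mul (hs.smooth.fst ξ))).integrable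
  have hi2 : ∀ ξ, Integrable fun x => Φ x * d x ξ := fun ξ =>
    (hφ.mul (hds.smooth.fst ξ)).integrable
  have key : ∀ t : ℝ, 1 ≤ t → t ^ μ * c = -(∫ x, Φ x * d x (t • ξ)).im := by
    intro t ht
    have h1 := hsym _ (hφ.mul (contDiff_ch ((2 * Real.pi)⁻¹ • (t • ξ))))
    rw [integral_opA_oscillating] at h1
    change (∫ x, Φ x * Ls 1 (shiftA Φ * A) x (t • ξ)).im = 0 at h1
    have h2 : ∀ x, Φ x * Ls 1 (shiftA Φ * A) x (t • ξ) =
        Φ x * (Φ x * s x (t • ξ)) + Φ x * d x (t • ξ) := by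
      intro x
      simp only [hd', Pi.sub_apply, Pi.mul_apply, base]
      ring
    simp only [h2] at h1
    rw [integral_add (hi1 _) (hi2 _), Complex.add_im] at h1
    have h3 : (∫ x, Φ x * (Φ x * s x (t • ξ))).im = t ^ μ * c := by
      rw [← Complex.imCLM_apply, ← ContinuousLinearMap.integral_comp_comm _ (hi1 _), hc,
        ← integral_const_mul]
      congr 1
      funext x
      rw [Complex.imCLM_apply, hξ x t ht]
      simp only [hΦ, Complex.im_ofReal_mul]
      ring
    rw [h3] at h1
    linarith
  have hbound : ∀ t : ℝ, 1 ≤ t → |c| * t ≤ (∫ x, ‖Φ x‖) * (|C| * C') := by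
    intro t ht
    have ht0 : 0 < t := by linarith
    have hp := Real.rpow_pos_of_pos ht0 (μ - 1)
    have h1 : |t ^ μ * c| ≤ (∫ x, ‖Φ x‖) * (|C| * (C' * t ^ (μ - 1))) := by
      rw [key t ht, abs_neg]
      refine (Complex.abs_im_le_norm _).trans ?_
      rw [← integral_mul_const]
      refine norm_integral_le_of_norm_le (hφ.integrable.norm.mul_const _)
        (Filter.Eventually.of_forall fun x => ?_)
      rw [norm_mul]
      by_cases hx : M < ‖x‖
      · simp [hM x hx]
      · refine mul_le_mul_of_nonneg_left ?_ (norm_nonneg _)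
        refine (hC x (t • ξ) (not_lt.1 hx)).trans ?_
        have := jb_rpow_pos (t • ξ) (μ - 1)
        gcongr
        · exact le_abs_self C
        · exact hC' t ht
    have h2 : t ^ μ = t ^ (μ - 1) * t := by
      rw [← Real.rpow_add_one ht0.ne']; ring_nf
    rw [abs_mul, abs_of_pos (Real.rpow_pos_of_pos ht0 μ), h2] at h1
    have h3 : t ^ (μ - 1) * (|c| * t) ≤ t ^ (μ - 1) * ((∫ x, ‖Φ x‖) * (|C| * C')) := by
      linarith
    exact le_of_mul_le_mul_left h3 hp
  by_contra hne
  have hcp : 0 < |c| := abs_pos.2 hne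
  set D := (∫ x, ‖Φ x‖) * (|C| * C') with hD
  have hD0 : 0 ≤ D := mul_nonneg (integral_nonneg fun _ => norm_nonneg _) (by positivity)
  have := hbound (D / |c| + 1) (by linarith [div_nonneg hD0 hcp.le])
  rw [mul_add, mul_div_cancel₀ _ hcp.ne'] at this
  linarith

/-- The principal symbol of a symmetric operator is real. -/
theorem im_eq_zero_of_symmetric {s : Rn n → Rn n → ℂ} (hA : IsSymbol μ A)
    (hs : EvHom μ s) (hd : IsSymbol (μ - 1) (diagPart A - s))
    (hsym : ∀ u, IsTest u → (∫ x, opA A u x * (starRingEnd ℂ) (u x)).im = 0) :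
    ∃ ρ : ℝ, 0 < ρ ∧ ∀ x ξ, ρ < ‖ξ‖ → (s x ξ).im = 0 := by
  obtain ⟨hs1, ρ, hρ, hs2⟩ := id hs
  refine ⟨ρ, hρ, fun x₀ ξ hξ => ?_⟩
  by_contra hne
  -- The constant factor makes f(x₀) a positive square, so the sign of the imaginary part needs no
  -- case distinction.
  set f : Rn n → ℝ := fun x => (s x ξ).im * (s x₀ ξ).im with hf
  have hfc : Continuous f :=
    (Complex.continuous_im.comp (hs1.fst ξ).continuous).mul continuous_const
  have hf0 : 0 < f x₀ := mul_self_pos.2 hne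
  obtain ⟨δ, hδ, hball⟩ := Metric.isOpen_iff.1 (isOpen_lt continuous_const hfc) x₀ hf0
  let φ : ContDiffBump x₀ := ⟨δ / 2, δ, by linarith, by linarith⟩
  have hφ : IsTest fun x => (φ x : ℂ) :=
    ⟨Complex.ofRealCLM.contDiff.comp φ.contDiff, φ.hasCompactSupport.comp_left Complex.ofReal_zero⟩
  have h1 := integral_sq_mul_im_eq_zero hA hs hd hsym
    (norm_pos_iff.1 (hρ.trans hξ)) (fun x t ht => hs2 x ξ t hξ ht) hφ
  have h2 : 0 < ∫ x, φ x ^ 2 * f x := by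
    have hc : Continuous fun x => φ x ^ 2 * f x := (φ.continuous.pow 2).mul hfc
    refine hc.integral_pos_of_hasCompactSupport_nonneg_nonzero (x := x₀) ?_ ?_ ?_
    · refine φ.hasCompactSupport.mono fun x hx => ?_
      simp only [Function.mem_support] at hx ⊢
      intro h0; simp [h0] at hx
    · intro x
      by_cases hx : dist x x₀ < δ
      · exact mul_nonneg (sq_nonneg _) (le_of_lt (hball hx))
      · simp [φ.zero_of_le_dist (not_lt.1 hx)]
    · have : φ x₀ = 1 := φ.one_of_mem_closedBall (Metric.mem_closedBall_self (by simp [φ]; linarith))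
      simpa [this] using hf0.ne'
  simp only [hf, ← mul_assoc] at h2
  rw [integral_mul_const, h1, zero_mul] at h2
  exact lt_irrefl _ h2

end Realness

/-! ### Smooth kernels as amplitudes of order -∞. -/

section SmoothKernel

open MeasureTheory FourierTransform

variable {n : ℕ}

/-- Operators with a smooth kernel have an amplitude of order `-∞`. -/
theorem exists_amplitude_of_kernel {K : Rn n × Rn n → ℂ} (hK : ContDiff ℝ ∞ K) :
    ∃ A : Rn n × Rn n → Rn n → ℂ, (∀ m, IsSymbol m A) ∧
      ∀ u, IsTest u → ∀ x, opA A u x = ∫ y, K (x, y) * u y := by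
  obtain ⟨ψ, h1, h2, h3, -, h5⟩ := exists_bump n one_pos
  have hψ0 : 0 < ∫ z, ψ z := by
    refine h1.continuous.integral_pos_of_hasCompactSupport_nonneg_nonzero (x := 0) ?_
      (fun z => (h5 z).1) (by simp [h2])
    exact HasCompactSupport.intro (isCompact_closedBall (0 : Rn n) 2) fun z hz =>
      h3 z (by simpa using (not_le.1 (by simpa using hz : ¬ ‖z‖ ≤ 2)).le)
  set c := ∫ z, ψ z with hc
  -- The exponential cancels the phase of the operator, and c⁻¹ψ has integral 1 in ζ = ξ/2π, so the
  -- ξ-integral returns K. Compact support in ξ puts A in S^{-∞}.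
  set A : Rn n × Rn n → Rn n → ℂ := fun p ξ =>
    K (p.1, p.1 + p.2) * (ch ((2 * Real.pi)⁻¹ • ξ) p.2 * ((c⁻¹ * ψ ((2 * Real.pi)⁻¹ • ξ) : ℝ) : ℂ))
    with hA
  have hsm : Smooth2 A := by
    have e1 : ContDiff ℝ ∞ fun z : (Rn n × Rn n) × Rn n => K (z.1.1, z.1.1 + z.1.2) :=
      hK.comp (g := K) (f := fun z : (Rn n × Rn n) × Rn n => (z.1.1, z.1.1 + z.1.2)) (by fun_prop)
    have e2 : ContDiff ℝ ∞ fun z : (Rn n × Rn n) × Rn n => ch ((2 * Real.pi)⁻¹ • z.2) z.1.2 := by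
      unfold ch
      have h1 : ContDiff ℝ ∞ fun z : (Rn n × Rn n) × Rn n =>
          ((2 * Real.pi * inner ℝ z.1.2 ((2 * Real.pi)⁻¹ • z.2) : ℝ) : ℂ) :=
        Complex.ofRealCLM.contDiff.comp (contDiff_const.mul (ContDiff.inner ℝ (by fun_prop) (by fun_prop)))
      exact (h1.mul contDiff_const).cexp
    have e3 : ContDiff ℝ ∞ fun z : (Rn n × Rn n) × Rn n =>
        ((c⁻¹ * ψ ((2 * Real.pi)⁻¹ • z.2) : ℝ) : ℂ) := by
      refine Complex.ofRealCLM.contDiff.comp (contDiff_const.mul ?_)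
      exact h1.comp (g := ψ) (f := fun z : (Rn n × Rn n) × Rn n => (2 * Real.pi)⁻¹ • z.2)
        (by fun_prop)
    exact e1.mul (e2.mul e3)
  refine ⟨A, fun m => (EvHom.of_support hsm (ρ := 2 * Real.pi * 2) (by positivity)
    fun p ξ hξ => ?_).isSymbol, fun u hu x => ?_⟩
  · have : ψ ((2 * Real.pi)⁻¹ • ξ) = 0 := by
      refine h3 _ ?_
      rw [norm_smul, norm_inv, Real.norm_of_nonneg (by positivity), le_inv_mul_iff₀ (by positivity)]
      linarith
    simp only [hA, this, mul_zero, Complex.ofReal_zero]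
  · rw [opA_eq]
    have e : ∀ ζ, hatA (shiftA u * A) x ζ ((2 * Real.pi) • ζ) =
        ((c⁻¹ * ψ ζ : ℝ) : ℂ) * ∫ y, K (x, y) * u y := by
      intro ζ
      rw [hatA_shiftA_mul, ← integral_const_mul]
      congr 1
      funext y
      simp only [hA, inv_smul_smul₀ (by positivity : 2 * Real.pi ≠ 0), add_sub_cancel]
      have := ch_mul_ch_neg ζ (x - y)
      rw [neg_sub] at this
      linear_combination (K (x, y) * ((c⁻¹ * ψ ζ : ℝ) : ℂ) * u y) * this
    simp only [e]
    rw [integral_mul_const, integral_complex_ofReal, integral_const_mul, ← hc,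
      inv_mul_cancel₀ hψ0.ne', Complex.ofReal_one, one_mul]

end SmoothKernel

/-! ### Words in partial derivatives, finitely many of each length. -/

section Words

variable {X : Type} [NormedAddCommGroup X] [NormedSpace ℝ X] [FiniteDimensional ℝ X] {n : ℕ}
  {a b : X → Rn n → ℂ} {m : ℝ}

variable (X n) in
/-- Indices of the partial derivatives in `X × ℝⁿ`. -/
abbrev DerivIndex : Type := Fin (Module.finrank ℝ X) ⊕ Fin (Module.finrank ℝ (Rn n))

/-- Partial derivatives. -/
noncomputable def partialD : DerivIndex X n → (X → Rn n → ℂ) → X → Rn n → ℂ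
  | .inl i, a => dX (Module.finBasis ℝ X i) a
  | .inr i, a => dT (Module.finBasis ℝ (Rn n) i) a

/-- Iterated partial derivatives. -/
noncomputable def iterD : List (DerivIndex X n) → (X → Rn n → ℂ) → X → Rn n → ℂ
  | [], a => a
  | i :: w, a => iterD w (partialD i a)

/-- The number of derivatives in the fiber variable. -/
def fiberOrder : List (DerivIndex X n) → ℝ
  | [] => 0
  | .inl _ :: w => fiberOrder w
  | .inr _ :: w => fiberOrder w + 1

theorem Smooth2.partialD (ha : Smooth2 a) (i : DerivIndex X n) : Smooth2 (partialD i a) := by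
  cases i with
  | inl i => exact ha.dX _
  | inr i => exact ha.dT _

theorem partialD_sub (ha : Smooth2 a) (hb : Smooth2 b) (i : DerivIndex X n) :
    partialD i (a - b) = partialD i a - partialD i b := by
  cases i with
  | inl i => exact dX_sub ha hb _
  | inr i => exact dT_sub ha hb _

theorem partialD_add (ha : Smooth2 a) (hb : Smooth2 b) (i : DerivIndex X n) :
    partialD i (a + b) = partialD i a + partialD i b := by
  cases i with
  | inl i => exact dX_add ha hb _
  | inr i => exact dT_add ha hb _

theorem iterD_sub (ha : Smooth2 a) (hb : Smooth2 b) (w : List (DerivIndex X n)) :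
    iterD w (a - b) = iterD w a - iterD w b := by
  induction w generalizing a b with
  | nil => rfl
  | cons i w ih => rw [iterD, partialD_sub ha hb, ih (ha.partialD i) (hb.partialD i)]; rfl

theorem iterD_add (ha : Smooth2 a) (hb : Smooth2 b) (w : List (DerivIndex X n)) :
    iterD w (a + b) = iterD w a + iterD w b := by
  induction w generalizing a b with
  | nil => rfl
  | cons i w ih => rw [iterD, partialD_add ha hb, ih (ha.partialD i) (hb.partialD i)]; rfl

theorem IsSymbol.iterD (ha : IsSymbol m a) (w : List (DerivIndex X n)) :
    IsSymbol (m - fiberOrder w) (iterD w a) := by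
  induction w generalizing m a with
  | nil => simpa [fiberOrder, _root_.iterD] using ha
  | cons i w ih =>
    cases i with
    | inl i => exact ih (ha.dX _)
    | inr i =>
      have := ih (ha.dT (Module.finBasis ℝ (Rn n) i))
      rwa [fiberOrder, show m - (fiberOrder w + 1) = m - 1 - fiberOrder w by ring]

theorem partialD_eq_zero {ρ : ℝ} (h : ∀ x θ, ‖θ‖ < ρ → a x θ = 0) (i : DerivIndex X n) (x : X)
    (θ : Rn n) (hθ : ‖θ‖ < ρ) : partialD i a x θ = 0 := by
  cases i with
  | inl i =>
    have : (fun x' => a x' θ) = fun _ => 0 := funext fun x' => h x' θ hθ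
    simp [partialD, dX, this]
  | inr i =>
    have : a x =ᶠ[𝓝 θ] fun _ => 0 := by
      filter_upwards [(isOpen_lt continuous_norm continuous_const).mem_nhds hθ] with θ' h'
      exact h x θ' h'
    simp only [partialD, dT]
    rw [this.fderiv_eq]
    simp

theorem iterD_eq_zero {ρ : ℝ} (h : ∀ x θ, ‖θ‖ < ρ → a x θ = 0) (w : List (DerivIndex X n)) (x : X)
    (θ : Rn n) (hθ : ‖θ‖ < ρ) : iterD w a x θ = 0 := by
  induction w generalizing a with
  | nil => exact h x θ hθ
  | cons i w ih => exact ih (partialD_eq_zero h i)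

end Words

/-! ### Sums that are locally finite in ξ. -/

section LocallyFinite

variable {X : Type} [NormedAddCommGroup X] [NormedSpace ℝ X] [FiniteDimensional ℝ X] {n : ℕ}
  {m : ℝ} {f : ℕ → X → Rn n → ℂ}

/-- The sum of a sequence of functions that is locally finite in the fiber variable. -/
noncomputable def fiberSum (f : ℕ → X → Rn n → ℂ) : X → Rn n → ℂ := fun x θ => ∑' j, f j x θ

theorem fiberSum_eq_sum (h : ∀ (j : ℕ) x θ, ‖θ‖ < (j : ℝ) → f j x θ = 0) {M : ℕ} {θ : Rn n}
    (hθ : ‖θ‖ < M) (x : X) : fiberSum f x θ = (∑ j ∈ Finset.range M, f j) x θ := by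
  rw [fiberSum, Finset.sum_apply, Finset.sum_apply]
  refine tsum_eq_sum fun j hj => h j x θ (hθ.trans_le ?_)
  exact_mod_cast not_lt.1 fun h' => hj (Finset.mem_range.2 h')

theorem fiberSum_eventuallyEq (h : ∀ (j : ℕ) x θ, ‖θ‖ < (j : ℝ) → f j x θ = 0) {M : ℕ} {θ : Rn n}
    (hθ : ‖θ‖ < M) :
    ∀ᶠ θ' in 𝓝 θ, ∀ x : X, fiberSum f x θ' = (∑ j ∈ Finset.range M, f j) x θ' := by
  filter_upwards [(isOpen_lt continuous_norm continuous_const).mem_nhds hθ] with θ' h' x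
  exact fiberSum_eq_sum h h' x

theorem smooth2_fiberSum (hs : ∀ j, Smooth2 (f j))
    (h : ∀ (j : ℕ) x θ, ‖θ‖ < (j : ℝ) → f j x θ = 0) : Smooth2 (fiberSum f) := by
  rw [Smooth2, contDiff_iff_contDiffAt]
  rintro ⟨x, θ⟩
  obtain ⟨M, hM⟩ := exists_nat_gt ‖θ‖
  have h1 : Smooth2 (∑ j ∈ Finset.range M, f j) := Smooth2.sum fun j _ => hs j
  refine (ContDiff.contDiffAt h1).congr_of_eventuallyEq ?_
  have := (continuous_snd.tendsto (x, θ)).eventually (fiberSum_eventuallyEq (f := f) h hM)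
  filter_upwards [this] with p hp
  exact hp p.1

theorem partialD_fiberSum (hs : ∀ j, Smooth2 (f j))
    (h : ∀ (j : ℕ) x θ, ‖θ‖ < (j : ℝ) → f j x θ = 0) (i : DerivIndex X n) :
    partialD i (fiberSum f) = fiberSum fun j => partialD i (f j) := by
  funext x θ
  obtain ⟨M, hM⟩ := exists_nat_gt ‖θ‖
  rw [fiberSum_eq_sum (fun j => partialD_eq_zero (h j) i) hM]
  cases i with
  | inl i =>
    have e : (fun x' => fiberSum f x' θ) = fun x' => (∑ j ∈ Finset.range M, f j) x' θ :=
      funext fun x' => fiberSum_eq_sum h hM x'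
    simp only [partialD]
    rw [← dX_sum fun j _ => hs j, dX, e]; rfl
  | inr i =>
    have e : fiberSum f x =ᶠ[𝓝 θ] (∑ j ∈ Finset.range M, f j) x :=
      (fiberSum_eventuallyEq h hM).mono fun θ' h' => h' x
    simp only [partialD]
    rw [← dT_sum fun j _ => hs j, dT, e.fderiv_eq]; rfl

/-- The class of such sums is closed under partial derivatives, because prefixing a letter to `w`
turns the bounds for `f` into bounds for its derivative. -/
theorem isSymbol_fiberSum (hs : ∀ j, Smooth2 (f j))
    (h : ∀ (j : ℕ) x θ, ‖θ‖ < (j : ℝ) → f j x θ = 0)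
    (hb : ∀ w r, ∃ C : ℕ → ℝ, Summable C ∧ ∀ j x θ, ‖x‖ ≤ r →
      ‖iterD w (f j) x θ‖ ≤ C j * jb θ ^ (m - fiberOrder w)) : IsSymbol m (fiberSum f) := by
  refine isSymbol_of_closed_basis (S := fun m a => ∃ f : ℕ → X → Rn n → ℂ, (∀ j, Smooth2 (f j)) ∧
    (∀ (j : ℕ) x θ, ‖θ‖ < (j : ℝ) → f j x θ = 0) ∧
    (∀ w r, ∃ C : ℕ → ℝ, Summable C ∧ ∀ j x θ, ‖x‖ ≤ r →
      ‖iterD w (f j) x θ‖ ≤ C j * jb θ ^ (m - fiberOrder w)) ∧ a = fiberSum f) ?_ ?_ ?_ ?_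
    ⟨f, hs, h, hb, rfl⟩
  · rintro m _ ⟨f, hs, h, -, rfl⟩
    exact smooth2_fiberSum hs h
  · rintro m _ ⟨f, hs, h, hb, rfl⟩ r
    obtain ⟨C, hC, hfC⟩ := hb [] r
    simp only [iterD, fiberOrder, sub_zero] at hfC
    refine ⟨∑' j, C j, fun x θ hx => ?_⟩
    obtain ⟨M, hM⟩ := exists_nat_gt ‖θ‖
    have hp := jb_rpow_pos θ m
    have hC0 : ∀ j, 0 ≤ C j := fun j =>
      nonneg_of_mul_nonneg_left ((norm_nonneg _).trans (hfC j x θ hx)) hp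
    rw [fiberSum_eq_sum h hM, Finset.sum_apply, Finset.sum_apply]
    calc _ ≤ ∑ j ∈ Finset.range M, C j * jb θ ^ m :=
          norm_sum_le_of_le _ fun j _ => hfC j x θ hx
      _ ≤ _ := by
          rw [← Finset.sum_mul]
          exact mul_le_mul_of_nonneg_right (hC.sum_le_tsum _ fun j _ => hC0 j) hp.le
  · rintro m _ ⟨f, hs, h, hb, rfl⟩ i
    refine ⟨fun j => partialD (.inl i) (f j), fun j => (hs j).partialD _,
      fun j => partialD_eq_zero (h j) _, fun w r => hb (.inl i :: w) r,
      partialD_fiberSum hs h (.inl i)⟩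
  · rintro m _ ⟨f, hs, h, hb, rfl⟩ i
    refine ⟨fun j => partialD (.inr i) (f j), fun j => (hs j).partialD _,
      fun j => partialD_eq_zero (h j) _, fun w r => ?_, partialD_fiberSum hs h (.inr i)⟩
    have := hb (.inr i :: w) r
    rwa [fiberOrder, show m - (fiberOrder w + 1) = m - 1 - fiberOrder w by ring] at this

end LocallyFinite

/-! ### Borel summation of symbols. -/

section Borel

variable {X : Type} [NormedAddCommGroup X] [NormedSpace ℝ X] [FiniteDimensional ℝ X] {n : ℕ}
  {m : ℝ} {a : X → Rn n → ℂ} {κ χ : Rn n → ℂ}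

/-- The function `R^{-k} κ(ξ/R)`. -/
noncomputable def dilate (k : ℕ) (R : ℝ) (κ : Rn n → ℂ) : Rn n → ℂ :=
  fun ξ => ((R⁻¹ ^ k : ℝ) : ℂ) * κ (R⁻¹ • ξ)

theorem contDiff_dilate (hκ : ContDiff ℝ ∞ κ) (k : ℕ) (R : ℝ) : ContDiff ℝ ∞ (dilate k R κ) :=
  contDiff_const.mul (hκ.comp (by fun_prop))

theorem fderiv_dilate (hκ : ContDiff ℝ ∞ κ) (k : ℕ) (R : ℝ) (w ξ : Rn n) :
    fderiv ℝ (dilate k R κ) ξ w = dilate (k + 1) R (fun ξ => fderiv ℝ κ ξ w) ξ := by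
  have h1 : HasFDerivAt (fun ξ : Rn n => R⁻¹ • ξ) (R⁻¹ • ContinuousLinearMap.id ℝ (Rn n)) ξ :=
    (hasFDerivAt_id ξ).const_smul R⁻¹
  have h2 := ((hκ.differentiable (by simp)) (R⁻¹ • ξ)).hasFDerivAt.comp ξ h1
  have h3 := h2.const_mul ((R⁻¹ ^ k : ℝ) : ℂ)
  refine (congrArg (fun L : Rn n →L[ℝ] ℂ => L w) h3.fderiv).trans ?_
  simp [dilate, pow_succ]
  ring

theorem isTest_fderiv (hκ : IsTest κ) (w : Rn n) : IsTest fun ξ => fderiv ℝ κ ξ w :=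
  ⟨(hκ.smooth.fderiv_right (by simp)).clm_apply contDiff_const,
    hκ.cpt.fderiv_apply (𝕜 := ℝ) w⟩

theorem exists_norm_dilate_le (hκ : IsTest κ) (k : ℕ) :
    ∃ C : ℝ, 0 ≤ C ∧ ∀ (R : ℝ) (ξ : Rn n), 1 ≤ R → ‖dilate k R κ ξ‖ ≤ C * jb ξ ^ (-(k : ℝ)) := by
  obtain ⟨M, hM0, hM⟩ := hκ.exists_radius
  obtain ⟨D, hD⟩ := hκ.cpt.exists_bound_of_continuous hκ.smooth.continuous
  have hD0 : 0 ≤ D := (norm_nonneg _).trans (hD 0)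
  refine ⟨D * (1 + M) ^ k, by positivity, fun R ξ hR => ?_⟩
  have hR0 : 0 < R := by linarith
  have hj := jb_pos ξ
  by_cases hξ : M < ‖R⁻¹ • ξ‖
  · rw [dilate, hM _ hξ, mul_zero, norm_zero]; positivity
  · rw [norm_smul, norm_inv, Real.norm_of_nonneg hR0.le, not_lt, inv_mul_le_iff₀ hR0] at hξ
    have h1 : jb ξ ≤ (1 + M) * R := (jb_le_one_add_norm ξ).trans (by nlinarith)
    have h2 : R⁻¹ ≤ (1 + M) * (jb ξ)⁻¹ := by
      rw [inv_le_iff_one_le_mul₀ hR0, mul_assoc, mul_comm, mul_assoc]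
      rw [← div_eq_inv_mul, one_le_div hj]
      linarith
    rw [dilate, norm_mul, Complex.norm_real, Real.norm_of_nonneg (by positivity), Real.rpow_neg hj.le,
      Real.rpow_natCast]
    calc R⁻¹ ^ k * ‖κ (R⁻¹ • ξ)‖ ≤ ((1 + M) * (jb ξ)⁻¹) ^ k * D := by
          gcongr
          exact hD _
      _ = _ := by rw [mul_pow, inv_pow]; ring

/-- The constant is uniform in R: each fiber derivative of κ(ξ/R) gives a factor R⁻¹, and on the
support, where |ξ| ≤ MR, this is O(⟨ξ⟩⁻¹). The exponent k in `dilate` records these factors during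
the induction. -/
theorem exists_norm_iterD_dilate_mul_le (hκ : IsTest κ) (k : ℕ) (ha : IsSymbol m a)
    (w : List (DerivIndex X n)) (r : ℝ) : ∃ C : ℝ, 0 ≤ C ∧ ∀ R x ξ, 1 ≤ R → ‖x‖ ≤ r →
      ‖iterD w (fiber X (dilate k R κ) * a) x ξ‖ ≤ C * jb ξ ^ (m - k - fiberOrder w) := by
  induction w generalizing κ k m a with
  | nil =>
    obtain ⟨C, hC0, hC⟩ := exists_norm_dilate_le hκ k
    obtain ⟨D, hD⟩ := ha.symBound r
    refine ⟨C * |D|, by positivity, fun R x ξ hR hx => ?_⟩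
    have hj := jb_pos ξ
    have h1 : ‖a x ξ‖ ≤ |D| * jb ξ ^ m := (hD x ξ hx).trans (by gcongr; exact le_abs_self D)
    simp only [iterD, fiberOrder, sub_zero, Pi.mul_apply, fiber, norm_mul]
    calc _ ≤ (C * jb ξ ^ (-(k : ℝ))) * (|D| * jb ξ ^ m) := by gcongr; exact hC R ξ hR
      _ = _ := by rw [show m - (k : ℝ) = -(k : ℝ) + m by ring, Real.rpow_add hj]; ring
  | cons i w ih =>
    cases i with
    | inl i =>
      obtain ⟨C, hC0, hC⟩ := ih hκ k (ha.dX (Module.finBasis ℝ X i))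
      refine ⟨C, hC0, fun R x ξ hR hx => ?_⟩
      have e : partialD (.inl i) (fiber X (dilate k R κ) * a) =
          fiber X (dilate k R κ) * dX (Module.finBasis ℝ X i) a := by
        rw [partialD, dX_mul (smooth2_fiber (contDiff_dilate hκ.smooth k R)) ha.smooth]
        have : dX (Module.finBasis ℝ X i) (fiber X (dilate k R κ)) = 0 := by
          funext x θ
          simp [dX, fiber]
        rw [this, zero_mul, zero_add]
      rw [iterD, e]
      exact hC R x ξ hR hx
    | inr i =>
      set v := Module.finBasis ℝ (Rn n) i with hv
      obtain ⟨C, hC0, hC⟩ := ih hκ k (ha.dT v)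
      obtain ⟨C', hC0', hC'⟩ := ih (isTest_fderiv hκ v) (k + 1) ha
      refine ⟨C' + C, by positivity, fun R x ξ hR hx => ?_⟩
      have hs := contDiff_dilate hκ.smooth k R
      have e : partialD (.inr i) (fiber X (dilate k R κ) * a) =
          fiber X (dilate (k + 1) R fun ξ => fderiv ℝ κ ξ v) * a +
            fiber X (dilate k R κ) * dT v a := by
        rw [partialD, dT_mul (smooth2_fiber hs) ha.smooth]
        congr 2
        funext x θ
        exact fderiv_dilate hκ.smooth k R v θ
      rw [iterD, e, iterD_add]
      · refine (norm_add_le _ _).trans ?_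
        have h1 := hC R x ξ hR hx
        have h2 := hC' R x ξ hR hx
        rw [show m - 1 - (k : ℝ) - fiberOrder w = m - k - (fiberOrder w + 1) by ring] at h1
        rw [show m - ((k + 1 : ℕ) : ℝ) - fiberOrder w = m - k - (fiberOrder w + 1) by
          push_cast; ring] at h2
        rw [fiberOrder, add_mul]
        exact add_le_add h2 h1
      · exact (smooth2_fiber (contDiff_dilate (isTest_fderiv hκ v).smooth _ R)).mul ha.smooth
      · exact (smooth2_fiber hs).mul (ha.smooth.dT v)

/-- Cutting a symbol off near `ξ = 0`. -/
noncomputable def cutNear (χ : Rn n → ℂ) (R : ℝ) (a : X → Rn n → ℂ) : X → Rn n → ℂ :=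
  a - fiber X (dilate 0 R χ) * a

theorem cutNear_apply (R : ℝ) (x : X) (ξ : Rn n) :
    cutNear χ R a x ξ = (1 - χ (R⁻¹ • ξ)) * a x ξ := by
  simp [cutNear, fiber, dilate]; ring

theorem cutNear_eq_zero (hχ1 : ∀ ξ, ‖ξ‖ ≤ 1 → χ ξ = 1) {R : ℝ} (hR : 0 < R) (x : X) (ξ : Rn n)
    (hξ : ‖ξ‖ < R) : cutNear χ R a x ξ = 0 := by
  rw [cutNear_apply, hχ1, sub_self, zero_mul]
  rw [norm_smul, norm_inv, Real.norm_of_nonneg hR.le, inv_mul_le_iff₀ hR, mul_one]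
  exact hξ.le

theorem smooth2_cutNear (hχ : IsTest χ) (ha : Smooth2 a) (R : ℝ) : Smooth2 (cutNear χ R a) :=
  ha.sub ((smooth2_fiber (contDiff_dilate hχ.smooth 0 R)).mul ha)

theorem isSymbol_cutNear_sub (hχ : IsTest χ) (ha : Smooth2 a) {R : ℝ} (hR : 1 ≤ R) (m : ℝ) :
    IsSymbol m (cutNear χ R a - a) := by
  obtain ⟨M, hM0, hM⟩ := hχ.exists_radius
  have hR0 : 0 < R := by linarith
  refine (EvHom.of_support ((smooth2_cutNear hχ ha R).sub ha) (ρ := R * (M + 1)) (by positivity)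
    fun x ξ hξ => ?_).isSymbol
  rw [Pi.sub_apply, Pi.sub_apply, cutNear_apply, hM, sub_zero, one_mul, sub_self]
  rw [norm_smul, norm_inv, Real.norm_of_nonneg hR0.le, lt_inv_mul_iff₀ hR0]
  nlinarith

/-- The function lives on |ξ| ≥ R, where giving up one order gains a factor ⟨ξ⟩⁻¹ ≤ R⁻¹, which is
arbitrarily small. -/
theorem eventually_norm_iterD_cutNear_le (hχ : IsTest χ) (hχ1 : ∀ ξ, ‖ξ‖ ≤ 1 → χ ξ = 1)
    (ha : IsSymbol m a) (w : List (DerivIndex X n)) (r : ℝ) {ε : ℝ} (hε : 0 < ε) :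
    ∀ᶠ R in Filter.atTop, ∀ x ξ, ‖x‖ ≤ r →
      ‖iterD w (cutNear χ R a) x ξ‖ ≤ ε * jb ξ ^ (m + 1 - fiberOrder w) := by
  obtain ⟨C, hC0, hC⟩ := exists_norm_iterD_dilate_mul_le hχ 0 ha w r
  obtain ⟨D, hD⟩ := (ha.iterD w).symBound r
  filter_upwards [Filter.eventually_ge_atTop 1, Filter.eventually_ge_atTop ((|D| + C) / ε)]
    with R h1 h2 x ξ hx
  have hR0 : 0 < R := by linarith
  have hj := jb_pos ξ
  by_cases hξ : ‖ξ‖ < R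
  · rw [iterD_eq_zero (cutNear_eq_zero hχ1 hR0) w x ξ hξ, norm_zero]
    positivity
  · have h3 : |D| + C ≤ ε * jb ξ := by
      rw [div_le_iff₀ hε] at h2
      have := norm_le_jb ξ
      nlinarith
    have h4 : ‖iterD w a x ξ‖ ≤ |D| * jb ξ ^ (m - fiberOrder w) :=
      (hD x ξ hx).trans (by gcongr; exact le_abs_self D)
    have h5 := hC R x ξ h1 hx
    rw [Nat.cast_zero, sub_zero] at h5
    rw [cutNear, iterD_sub ha.smooth ((smooth2_fiber (contDiff_dilate hχ.smooth 0 R)).mul ha.smooth)]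
    calc _ ≤ |D| * jb ξ ^ (m - fiberOrder w) + C * jb ξ ^ (m - fiberOrder w) :=
          (norm_sub_le _ _).trans (add_le_add h4 h5)
      _ = (|D| + C) * jb ξ ^ (m - fiberOrder w) := by ring
      _ ≤ ε * jb ξ * jb ξ ^ (m - fiberOrder w) := by gcongr
      _ = _ := by
          rw [show m + 1 - fiberOrder w = m - fiberOrder w + 1 by ring, Real.rpow_add_one hj.ne']
          ring

/-- Asymptotic summation of symbols. -/
theorem exists_asymptotic_sum {c : ℕ → X → Rn n → ℂ} (hc : ∀ j : ℕ, IsSymbol (m - j) (c j))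
    (hre : ∀ j x ξ, (c j x ξ).im = 0) :
    ∃ q : X → Rn n → ℂ, (∀ x ξ, (q x ξ).im = 0) ∧
      ∀ N : ℕ, IsSymbol (m - N) (q - ∑ j ∈ Finset.range N, c j) := by
  obtain ⟨ψ, h1, h2, h3, -, -⟩ := exists_bump n one_pos
  set χ : Rn n → ℂ := fun ξ => ψ ξ with hχd
  have hχ : IsTest χ := isTest_of_radius (M := 2) (Complex.ofRealCLM.contDiff.comp h1)
    fun z hz => by rw [hχd]; simp [h3 z (by linarith)]
  have hχ1 : ∀ ξ, ‖ξ‖ ≤ 1 → χ ξ = 1 := fun ξ hξ => by simp [hχd, h2 ξ hξ]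
  -- Diagonal choice: the j-th radius handles the finitely many words of length at most j on |x| ≤
  -- j. Requiring j ≤ R makes the sum locally finite.
  have key : ∀ j : ℕ, ∃ R : ℝ, 1 ≤ R ∧ (j : ℝ) ≤ R ∧
      ∀ w ∈ {w : List (DerivIndex X n) | w.length ≤ j}, ∀ x ξ, ‖x‖ ≤ (j : ℝ) →
        ‖iterD w (cutNear χ R (c j)) x ξ‖ ≤ (1 / 2) ^ j * jb ξ ^ (m - j + 1 - fiberOrder w) := by
    intro j
    have h4 := (Filter.eventually_all_finite (List.finite_length_le (DerivIndex X n) j)).2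
      fun w _ => eventually_norm_iterD_cutNear_le hχ hχ1 (hc j) w j
        (show (0 : ℝ) < (1 / 2) ^ j by positivity)
    obtain ⟨R, ⟨hR1, hR2⟩, hR3⟩ := (((Filter.eventually_ge_atTop (1 : ℝ)).and
      (Filter.eventually_ge_atTop (j : ℝ))).and h4).exists
    exact ⟨R, hR1, hR2, hR3⟩
  choose R hR1 hR2 hR3 using key
  set f : ℕ → X → Rn n → ℂ := fun j => cutNear χ (R j) (c j) with hf
  have hfs : ∀ j, Smooth2 (f j) := fun j => smooth2_cutNear hχ (hc j).smooth _
  have hf0 : ∀ (j : ℕ) x θ, ‖θ‖ < (j : ℝ) → f j x θ = 0 := fun j x θ hθ =>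
    cutNear_eq_zero hχ1 (by linarith [hR1 j]) x θ (hθ.trans_le (hR2 j))
  have hfc : ∀ j (m' : ℝ), IsSymbol m' (f j - c j) := fun j m' =>
    isSymbol_cutNear_sub hχ (hc j).smooth (hR1 j) m'
  have hfS : ∀ j : ℕ, IsSymbol (m - j) (f j) := fun j => by
    simpa using (hfc j (m - j)).add (hc j)
  refine ⟨fiberSum f, fun x ξ => ?_, fun N => ?_⟩
  · obtain ⟨M, hM⟩ := exists_nat_gt ‖ξ‖
    rw [fiberSum_eq_sum hf0 hM, Finset.sum_apply, Finset.sum_apply, Complex.im_sum]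
    refine Finset.sum_eq_zero fun j _ => ?_
    simp [hf, cutNear_apply, hχd, hre]
  · set g : ℕ → X → Rn n → ℂ := fun j => if j < N then 0 else f j with hg
    have hgs : ∀ j, Smooth2 (g j) := fun j => by
      by_cases hj : j < N
      · simpa [hg, hj] using smooth2_zero
      · simpa [hg, hj] using hfs j
    have hg0 : ∀ (j : ℕ) x θ, ‖θ‖ < (j : ℝ) → g j x θ = 0 := fun j x θ hθ => by
      by_cases hj : j < N
      · simp [hg, hj]
      · simpa [hg, hj] using hf0 j x θ hθ
    have hgS : ∀ j : ℕ, IsSymbol (m - N) (g j) := fun j => by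
      by_cases hj : j < N
      · simpa [hg, hj] using isSymbol_zero
      · have : (N : ℝ) ≤ j := by exact_mod_cast not_lt.1 hj
        simpa [hg, hj] using (hfS j).mono (by linarith)
    have h5 : IsSymbol (m - N) (fiberSum g) := by
      refine isSymbol_fiberSum hgs hg0 fun w r => ?_
      choose D hD using fun j => ((hgS j).iterD w).symBound r
      -- From J on, the diagonal bounds cover w and r, and j ≥ N + 1 compensates the order lost in
      -- `key`: m - j + 1 ≤ m - N. The finitely many earlier terms use their own constants.
      obtain ⟨J, hJ⟩ := exists_nat_ge (max r (max (w.length : ℝ) (N + 1)))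
      refine ⟨fun j => if j < J then D j else (1 / 2) ^ j, ?_, fun j x θ hx => ?_⟩
      · refine (summable_geometric_two).congr_cofinite ?_
        refine (Finset.finite_toSet (Finset.range J)).subset fun j hj => ?_
        by_contra hj'
        simp only [Finset.coe_range, Set.mem_Iio] at hj'
        simp [hj'] at hj
      · by_cases hj : j < J
        · simpa [hj] using hD j x θ hx
        · have hjJ : (J : ℝ) ≤ j := by exact_mod_cast not_lt.1 hj
          have j1 : r ≤ j := (le_max_left _ _).trans (hJ.trans hjJ)
          have j2 : (w.length : ℝ) ≤ j :=
            (le_max_left _ _).trans ((le_max_right _ _).trans (hJ.trans hjJ))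
          have j3 : (N + 1 : ℝ) ≤ j :=
            (le_max_right _ _).trans ((le_max_right _ _).trans (hJ.trans hjJ))
          have hjN : ¬ j < N := by
            intro h'
            have : (j : ℝ) < N := by exact_mod_cast h'
            linarith
          simp only [hj, if_false, hg, hjN]
          refine (hR3 j w (by exact_mod_cast j2) x θ (hx.trans j1)).trans ?_
          exact mul_le_mul_of_nonneg_left (jb_rpow_le_rpow θ (by linarith)) (by positivity)
    have h6 : IsSymbol (m - N) (∑ j ∈ Finset.range N, (f j - c j)) :=
      IsSymbol.sum fun j _ => hfc j _
    refine (congrArg (IsSymbol (m - N)) ?_).mp (h5.add h6)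
    funext x ξ
    obtain ⟨M, hM⟩ := exists_nat_gt ‖ξ‖
    have hM' : ‖ξ‖ < (max M N : ℕ) := hM.trans_le (by exact_mod_cast le_max_left M N)
    have h7 : (∑ j ∈ Finset.range (max M N), g j) + ∑ j ∈ Finset.range N, f j =
        ∑ j ∈ Finset.range (max M N), f j := by
      have e1 : ∑ j ∈ Finset.range N, f j =
          ∑ j ∈ Finset.range (max M N), if j < N then f j else 0 := by
        rw [← Finset.sum_filter]
        congr 1
        ext j
        simp only [Finset.mem_range, Finset.mem_filter]
        exact ⟨fun h => ⟨h.trans_le (le_max_right _ _), h⟩, fun h => h.2⟩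
      rw [e1, ← Finset.sum_add_distrib]
      refine Finset.sum_congr rfl fun j _ => ?_
      by_cases hj : j < N <;> simp [hg, hj]
    have h8 := congrFun (congrFun h7 x) ξ
    simp only [Pi.add_apply, Pi.sub_apply, Finset.sum_sub_distrib] at h8 ⊢
    rw [fiberSum_eq_sum hg0 hM', fiberSum_eq_sum hf0 hM', ← h8]
    ring

end Borel

/-! ### Classical expansions with homogeneous and eventually homogeneous terms. -/

section Expansions

variable {n : ℕ} {m μ : ℝ} {b s p q : Rn n → Rn n → ℂ} {φ : Rn n → ℂ}

theorem smooth2_one_sub_cutoff_mul (hφ : IsCutoff φ)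
    (hb : ContDiffOn ℝ ∞ (fun z : Rn n × Rn n => b z.1 z.2) {z | z.2 ≠ 0}) :
    Smooth2 fun x ξ => (1 - φ ξ) * b x ξ := by
  rw [Smooth2, contDiff_iff_contDiffAt]
  rintro ⟨x, ξ⟩
  by_cases hξ : ξ = 0
  · subst hξ
    have h1 := (continuous_snd.tendsto ((x, 0) : Rn n × Rn n)).eventually hφ.2.2
    refine (contDiffAt_const (c := (0 : ℂ))).congr_of_eventuallyEq ?_
    filter_upwards [h1] with z hz
    rw [hz, sub_self, zero_mul]
  · have ho : IsOpen {z : Rn n × Rn n | z.2 ≠ 0} := isOpen_ne_fun continuous_snd continuous_const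
    have h1 := hb.contDiffAt (ho.mem_nhds (show (x, ξ) ∈ _ from hξ))
    exact ((contDiff_const.sub (hφ.1.comp contDiff_snd)).contDiffAt).mul h1

theorem IsCutoff.exists_radius (hφ : IsCutoff φ) : ∃ M, 0 ≤ M ∧ ∀ ξ, M < ‖ξ‖ → φ ξ = 0 :=
  IsTest.exists_radius ⟨hφ.1, hφ.2.1⟩

theorem evHom_one_sub_cutoff_mul (hφ : IsCutoff φ) (hb : IsHomogeneousFn μ b) :
    EvHom μ fun x ξ => (1 - φ ξ) * b x ξ := by
  obtain ⟨M, hM0, hM⟩ := hφ.exists_radius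
  refine ⟨smooth2_one_sub_cutoff_mul hφ hb.1, M + 1, by linarith, fun x ξ t hξ ht => ?_⟩
  have h0 : ξ ≠ 0 := norm_pos_iff.1 (by linarith)
  have h1 : M < ‖t • ξ‖ := by
    rw [norm_smul, Real.norm_of_nonneg (by linarith)]
    nlinarith
  beta_reduce
  rw [hM _ h1, hM ξ (by linarith), sub_zero, one_mul, one_mul, hb.2 x ξ t h0 (by linarith)]

/-- An eventually homogeneous function agrees with a homogeneous function away from `ξ = 0`. -/
theorem EvHom.exists_homogeneous (hs : EvHom μ s) : ∃ b : Rn n → Rn n → ℂ,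
    IsHomogeneousFn μ b ∧ ∃ ρ : ℝ, ∀ x ξ, ρ < ‖ξ‖ → b x ξ = s x ξ := by
  obtain ⟨hs1, ρ, hρ, hs2⟩ := hs
  set ρ' := ρ + 1 with hρ'
  have hp : 0 < ρ' := by linarith
  -- Homogeneous extension from the sphere of radius ρ + 1, which lies strictly inside the region of
  -- homogeneity.
  refine ⟨fun x ξ => (((‖ξ‖ / ρ') ^ μ : ℝ) : ℂ) * s x ((ρ' / ‖ξ‖) • ξ), ⟨?_, ?_⟩, ρ', ?_⟩
  · have hne : ∀ z ∈ {z : Rn n × Rn n | z.2 ≠ 0}, ‖z.2‖ ≠ 0 := fun z hz => norm_ne_zero_iff.2 hz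
    have hn : ContDiffOn ℝ ∞ (fun z : Rn n × Rn n => ‖z.2‖) {z | z.2 ≠ 0} := fun z hz =>
      ((contDiffAt_norm ℝ hz).comp z contDiffAt_snd).contDiffWithinAt
    have h1 : ContDiffOn ℝ ∞ (fun z : Rn n × Rn n => (‖z.2‖ / ρ') ^ μ) {z | z.2 ≠ 0} :=
      (hn.div_const ρ').rpow_const_of_ne fun z hz => div_ne_zero (hne z hz) hp.ne'
    have h2 : ContDiffOn ℝ ∞ (fun z : Rn n × Rn n => (ρ' / ‖z.2‖) • z.2) {z | z.2 ≠ 0} :=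
      (contDiffOn_const.div hn hne).smul contDiffOn_snd
    refine (Complex.ofRealCLM.contDiff.comp_contDiffOn h1).mul ?_
    exact ContDiff.comp_contDiffOn (g := fun z : Rn n × Rn n => s z.1 z.2)
      (f := fun z : Rn n × Rn n => (z.1, (ρ' / ‖z.2‖) • z.2)) hs1 (contDiffOn_fst.prodMk h2)
  · intro x ξ t hξ ht
    have hξ' : 0 < ‖ξ‖ := norm_pos_iff.2 hξ
    have e1 : (ρ' / ‖t • ξ‖) • t • ξ = (ρ' / ‖ξ‖) • ξ := by
      rw [smul_smul, norm_smul, Real.norm_of_nonneg ht.le]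
      congr 1
      field_simp
    have e2 : (‖t • ξ‖ / ρ') ^ μ = t ^ μ * (‖ξ‖ / ρ') ^ μ := by
      rw [norm_smul, Real.norm_of_nonneg ht.le, mul_div_assoc, Real.mul_rpow ht.le (by positivity)]
    simp only [e1, e2]
    push_cast
    ring
  · intro x ξ hξ
    have hξ' : 0 < ‖ξ‖ := hp.trans hξ
    have h1 : ρ < ‖(ρ' / ‖ξ‖) • ξ‖ := by
      rw [norm_smul, Real.norm_of_nonneg (by positivity), div_mul_cancel₀ _ hξ'.ne']
      linarith
    have h2 := hs2 x _ (‖ξ‖ / ρ') h1 ((one_le_div hp).2 hξ.le)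
    rw [smul_smul, show ‖ξ‖ / ρ' * (ρ' / ‖ξ‖) = 1 by field_simp, one_smul] at h2
    exact h2.symm

theorem EvHom.cl_of_sub_nat {s : Rn n → Rn n → ℂ} {j : ℕ} (hs : EvHom (m - j) s) (N : ℕ) :
    Cl N m s :=
  (Cl.of_sub_nat (N := N) hs.cl).of_le (Nat.le_add_right N j)

theorem cl_of_expansion {s : ℕ → Rn n → Rn n → ℂ} (hs : ∀ j : ℕ, EvHom (m - j) (s j)) {N : ℕ}
    (h : IsSymbol (m - N) (p - ∑ j ∈ Finset.range N, s j)) : Cl N m p := by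
  simpa using h.cl.add (Cl.sum fun j (_ : j ∈ Finset.range N) => (hs j).cl_of_sub_nat N)

theorem HasClassicalExpansion.cl {b : ℕ → Rn n → Rn n → ℂ} (h : HasClassicalExpansion m p b)
    (N : ℕ) : Cl N m p := by
  obtain ⟨hb, φ, hφ, h⟩ := h
  refine cl_of_expansion (s := fun j x ξ => (1 - φ ξ) * b j x ξ)
    (fun j => evHom_one_sub_cutoff_mul hφ (hb j)) ((congrArg (IsSymbol (m - N)) ?_).mp (h N))
  funext x ξ
  simp

theorem cl_sub_one_of_isSymbol (h : ∀ N, Cl N m p) (hp : IsSymbol (m - 1) p) (N : ℕ) :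
    Cl N (m - 1) p :=
  (h (N + 1)).of_isSymbol_sub_one hp

theorem cl_sub_nat_of_isSymbol (h : ∀ N, Cl N m p) {k : ℕ} (hp : IsSymbol (m - k) p) (N : ℕ) :
    Cl N (m - k) p := by
  induction k generalizing N with
  | zero => simpa using h N
  | succ k ih =>
    have e : m - ((k + 1 : ℕ) : ℝ) = m - k - 1 := by push_cast; ring
    rw [e] at hp ⊢
    exact cl_sub_one_of_isSymbol (ih (hp.mono (by linarith))) hp N

theorem exists_leading_term (h : ∀ N, Cl N m p) :
    ∃ s, EvHom m s ∧ IsSymbol (m - 1) (p - s) ∧ ∀ N, Cl N (m - 1) (p - s) := by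
  obtain ⟨s, hs, h1⟩ := h 1
  exact ⟨s, hs, h1, cl_sub_one_of_isSymbol (fun N => (h N).sub hs.cl) h1⟩

/-- Leading terms are split off recursively; the recursion carries the remainder with the proof that
it is classical to all lengths at its own order. -/
theorem exists_evHom_expansion (h : ∀ N, Cl N m p) : ∃ s : ℕ → Rn n → Rn n → ℂ,
    (∀ j : ℕ, EvHom (m - j) (s j)) ∧
      ∀ N : ℕ, IsSymbol (m - N) (p - ∑ j ∈ Finset.range N, s j) := by
  choose f hf1 hf2 hf3 using fun (k : ℕ) (q : {q : Rn n → Rn n → ℂ // ∀ N, Cl N (m - k) q}) =>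
    exists_leading_term q.2
  have e : ∀ k : ℕ, m - (k : ℝ) - 1 = m - ((k + 1 : ℕ) : ℝ) := fun k => by push_cast; ring
  let r : (k : ℕ) → {q : Rn n → Rn n → ℂ // ∀ N, Cl N (m - k) q} := fun k =>
    Nat.rec ⟨p, by simpa using h⟩ (fun k q => ⟨q.1 - f k q, by rw [← e]; exact hf3 k q⟩) k
  refine ⟨fun k => f k (r k), fun k => hf1 k (r k), fun N => ?_⟩
  have hr : ∀ N, (r N).1 = p - ∑ j ∈ Finset.range N, f j (r j) := by
    intro N
    induction N with
    | zero => simp [r]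
    | succ N ih =>
      rw [Finset.sum_range_succ, ← sub_sub, ← ih]
  rw [← hr]
  exact (r N).2 0

/-- Each eventually homogeneous term differs from a cut-off homogeneous one by a function of bounded
support in ξ. -/
theorem exists_classicalExpansion (h : ∀ N, Cl N m p) : ∃ b, HasClassicalExpansion m p b := by
  obtain ⟨s, hs, hp⟩ := exists_evHom_expansion h
  choose b hb ρ hρ using fun j => (hs j).exists_homogeneous
  obtain ⟨φ, hφ⟩ := exists_isCutoff n
  obtain ⟨M, hM0, hM⟩ := hφ.exists_radius
  refine ⟨b, hb, φ, hφ, fun N => ?_⟩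
  have h1 : ∀ j, IsSymbol (m - N) (s j - fun x ξ => (1 - φ ξ) * b j x ξ) := by
    intro j
    refine (EvHom.of_support ((hs j).smooth.sub (smooth2_one_sub_cutoff_mul hφ (hb j).1))
      (ρ := |ρ j| + M + 1) (by positivity) fun x ξ hξ => ?_).isSymbol
    have := le_abs_self (ρ j)
    have := abs_nonneg (ρ j)
    simp only [Pi.sub_apply]
    rw [hM ξ (by linarith), hρ j x ξ (by linarith)]
    ring
  refine (congrArg (IsSymbol (m - N)) ?_).mp
    ((hp N).add (IsSymbol.sum fun j (_ : j ∈ Finset.range N) => h1 j))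
  funext x ξ
  simp

end Expansions

/-! ### The symmetric quantization and its square. -/

section SymmetricQuantization

open MeasureTheory

variable {n : ℕ} {m μ μ' : ℝ} {p q q' : Rn n → Rn n → ℂ} {u : Rn n → ℂ} {ψ χ : Rn n → ℝ}

/-- A function of the displacement as an amplitude. -/
def dispA (ψ : Rn n → ℝ) : Rn n × Rn n → Rn n → ℂ := base n fun p => (ψ p.2 : ℂ)

/-- The symmetric amplitude `ψ(y - x) (q(x, ξ) + q(y, ξ)) / 2`. -/
noncomputable def symA (ψ : Rn n → ℝ) (q : Rn n → Rn n → ℂ) : Rn n × Rn n → Rn n → ℂ :=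
  dispA ψ * ((1 / 2 : ℂ) • (leftA q + rightA q))

/-- The left symbol of the operator with amplitude `symA ψ q`. -/
noncomputable def symL (ψ : Rn n → ℝ) (q : Rn n → Rn n → ℂ) : Rn n → Rn n → ℂ := Ls 1 (symA ψ q)

/-- The left symbol of the product of the operators with amplitudes `symA ψ q` and `symA ψ q'`. -/
noncomputable def prodL (ψ χ : Rn n → ℝ) (q q' : Rn n → Rn n → ℂ) : Rn n → Rn n → ℂ :=
  Ls 1 (dispA χ * (leftA (symL ψ q) * cj (rightA (symL ψ q'))))

/-- Smooth cutoffs in the displacement that are `1` near the diagonal. -/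
structure IsDispCutoff (R : ℝ) (ψ : Rn n → ℝ) : Prop where
  smooth : ContDiff ℝ ∞ ψ
  one : ∀ z, ‖z‖ ≤ R → ψ z = 1
  zero : ∀ z, 2 * R < ‖z‖ → ψ z = 0
  even : ∀ z, ψ (-z) = ψ z
  nonneg : 0 ≤ R

variable {R R' : ℝ}

theorem IsDispCutoff.contDiff_ofReal (hψ : IsDispCutoff R ψ) : ContDiff ℝ ∞ fun z => (ψ z : ℂ) :=
  Complex.ofRealCLM.contDiff.comp hψ.smooth

theorem IsDispCutoff.contDiff_snd (hψ : IsDispCutoff R ψ) :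
    ContDiff ℝ ∞ fun p : Rn n × Rn n => (ψ p.2 : ℂ) :=
  hψ.contDiff_ofReal.comp _root_.contDiff_snd

theorem IsDispCutoff.isTest (hψ : IsDispCutoff R ψ) : IsTest fun z => (ψ z : ℂ) :=
  isTest_of_radius hψ.contDiff_ofReal fun z hz => by rw [hψ.zero z hz, Complex.ofReal_zero]

theorem IsDispCutoff.amp (hψ : IsDispCutoff R ψ) {A : Rn n × Rn n → Rn n → ℂ}
    (hA : IsSymbol μ A) : Amp μ (dispA ψ * A) := by
  refine ⟨hA.base_mul hψ.contDiff_snd, fun r => ⟨2 * R, fun x z ξ _ hz => ?_⟩⟩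
  simp [dispA, base, hψ.zero z hz]

theorem IsDispCutoff.cl (hψ : IsDispCutoff R ψ) {A : Rn n × Rn n → Rn n → ℂ} {N : ℕ}
    (hA : Cl N μ A) : Cl N μ (Ls 1 (dispA ψ * A)) :=
  (hA.base_mul hψ.contDiff_snd).Ls (hψ.amp hA.isSymbol).zSupp

theorem IsDispCutoff.isSymbol_sub (hψ : IsDispCutoff R ψ) {A : Rn n × Rn n → Rn n → ℂ}
    (hA : IsSymbol μ A) : IsSymbol (μ - 1) (Ls 1 (dispA ψ * A) - diagPart A) := by
  refine (congrArg (IsSymbol (μ - 1)) ?_).mp (isSymbol_Ls_sub_diagPart (hψ.amp hA))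
  congr 1
  funext x ξ
  simp [pull, dispA, base, hψ.one 0 (by simpa using hψ.nonneg)]

theorem IsSymbol.half_add (hq : IsSymbol μ q) :
    IsSymbol μ ((1 / 2 : ℂ) • (leftA q + rightA q)) :=
  ((hq.pull _).add (hq.pull _)).const_smul _

theorem IsSymbol.amp_symA (hq : IsSymbol μ q) (hψ : IsDispCutoff R ψ) : Amp μ (symA ψ q) :=
  hψ.amp hq.half_add

theorem IsSymbol.symL (hq : IsSymbol μ q) (hψ : IsDispCutoff R ψ) : IsSymbol μ (symL ψ q) :=
  isSymbol_Ls (hq.amp_symA hψ)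

theorem Cl.symL {N : ℕ} (hq : Cl N μ q) (hψ : IsDispCutoff R ψ) : Cl N μ (symL ψ q) :=
  hψ.cl (((hq.pull _).add (hq.pull _)).const_smul _)

theorem IsSymbol.symL_sub (hq : IsSymbol μ q) (hψ : IsDispCutoff R ψ) :
    IsSymbol (μ - 1) (_root_.symL ψ q - q) := by
  refine (congrArg (IsSymbol (μ - 1)) ?_).mp (hψ.isSymbol_sub hq.half_add)
  congr 1
  funext x ξ
  change (1 / 2 : ℂ) * (q x ξ + q (x + 0) ξ) = q x ξ
  rw [add_zero]
  ring

theorem symA_add (ψ : Rn n → ℝ) (q q' : Rn n → Rn n → ℂ) :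
    symA ψ (q + q') = symA ψ q + symA ψ q' := by
  funext p ξ
  simp [symA, pull]
  ring

theorem symL_add (hψ : IsDispCutoff R ψ) (hq : IsSymbol μ q) (hq' : IsSymbol μ' q') :
    symL ψ (q + q') = symL ψ q + symL ψ q' := by
  rw [symL, symA_add, Ls_add (hq.amp_symA hψ) (hq'.amp_symA hψ)]; rfl

theorem isSymbol_prod_amp (hψ : IsDispCutoff R ψ) (hq : IsSymbol μ q) (hq' : IsSymbol μ' q') :
    IsSymbol (μ + μ') (leftA (symL ψ q) * cj (rightA (symL ψ q'))) :=
  ((hq.symL hψ).pull _).mul ((hq'.symL hψ).pull _).cj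

theorem isSymbol_prodL (hψ : IsDispCutoff R ψ) (hχ : IsDispCutoff R' χ) (hq : IsSymbol μ q)
    (hq' : IsSymbol μ' q') : IsSymbol (μ + μ') (prodL ψ χ q q') :=
  isSymbol_Ls (hχ.amp (isSymbol_prod_amp hψ hq hq'))

theorem Cl.prodL {N : ℕ} (hψ : IsDispCutoff R ψ) (hχ : IsDispCutoff R' χ) (hq : Cl N μ q)
    (hq' : Cl N μ' q') : Cl N (μ + μ') (prodL ψ χ q q') :=
  hχ.cl (((hq.symL hψ).pull _).mul ((hq'.symL hψ).pull _).cj)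

/-- Three errors of relative order -1 are added: passing to the diagonal, and replacing each of the
two left symbols by q and q'. -/
theorem isSymbol_prodL_sub (hψ : IsDispCutoff R ψ) (hχ : IsDispCutoff R' χ) (hq : IsSymbol μ q)
    (hq' : IsSymbol μ' q') : IsSymbol (μ + μ' - 1) (prodL ψ χ q q' - q * cj q') := by
  have h1 := hχ.isSymbol_sub (isSymbol_prod_amp hψ hq hq')
  have h2 := (hq.symL_sub hψ).mul (hq'.symL hψ).cj
  have h3 := hq.mul (hq'.symL_sub hψ).cj
  rw [show μ - 1 + μ' = μ + μ' - 1 by ring] at h2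
  rw [← add_sub_assoc] at h3
  refine (congrArg (IsSymbol (μ + μ' - 1)) ?_).mp ((h1.add h2).add h3)
  funext x ξ
  simp [prodL, pull, cj]
  ring

theorem prodL_add_add (hψ : IsDispCutoff R ψ) (hχ : IsDispCutoff R' χ) (hq : IsSymbol μ q)
    (hq' : IsSymbol μ' q') : prodL ψ χ (q + q') (q + q') =
      prodL ψ χ q q + (prodL ψ χ q q' + prodL ψ χ q' q + prodL ψ χ q' q') := by
  have a1 := hχ.amp (isSymbol_prod_amp hψ hq hq)
  have a2 := hχ.amp (isSymbol_prod_amp hψ hq hq')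
  have a3 := hχ.amp (isSymbol_prod_amp hψ hq' hq)
  have a4 := hχ.amp (isSymbol_prod_amp hψ hq' hq')
  -- The four amplitudes are given a common order so that their sums are amplitudes.
  set M := max (max (μ + μ) (μ + μ')) (max (μ' + μ) (μ' + μ')) with hM
  replace a1 := a1.mono (show _ ≤ M from (le_max_left _ _).trans (le_max_left _ _))
  replace a2 := a2.mono (show _ ≤ M from (le_max_right _ _).trans (le_max_left _ _))
  replace a3 := a3.mono (show _ ≤ M from (le_max_left _ _).trans (le_max_right _ _))
  replace a4 := a4.mono (show _ ≤ M from (le_max_right _ _).trans (le_max_right _ _))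
  simp only [prodL]
  rw [← Ls_add a2 a3, ← Ls_add (a2.add a3) a4, ← Ls_add a1 ((a2.add a3).add a4),
    symL_add hψ hq hq']
  congr 1
  funext x ξ
  simp [pull, cj]
  ring

theorem symA_support (hψ : IsDispCutoff R ψ) (q : Rn n → Rn n → ℂ) (x z ξ : Rn n)
    (hz : 2 * R < ‖z‖) : symA ψ q (x, z) ξ = 0 := by
  simp [symA, dispA, base, hψ.zero z hz]

theorem symA_symm (hψ : IsDispCutoff R ψ) (hre : ∀ x ξ, (q x ξ).im = 0) (x y ξ : Rn n) :
    symA ψ q (x, y - x) ξ = (starRingEnd ℂ) (symA ψ q (y, x - y) ξ) := by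
  have h1 : ∀ x ξ, (starRingEnd ℂ) (q x ξ) = q x ξ := fun x ξ =>
    Complex.conj_eq_iff_im.2 (hre x ξ)
  have h2 : ψ (y - x) = ψ (x - y) := by rw [← hψ.even, neg_sub]
  have h3 : (starRingEnd ℂ) (1 / 2 : ℂ) = 1 / 2 := by rw [map_div₀, map_one, map_ofNat]
  change (ψ (y - x) : ℂ) * ((1 / 2 : ℂ) * (q x ξ + q (x + (y - x)) ξ)) =
    (starRingEnd ℂ) ((ψ (x - y) : ℂ) * ((1 / 2 : ℂ) * (q y ξ + q (y + (x - y)) ξ)))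
  rw [map_mul, map_mul, map_add, h1, h1, h2, h3, Complex.conj_ofReal, add_sub_cancel,
    add_sub_cancel, add_comm (q y ξ)]

theorem isTest_opA_symA (hψ : IsDispCutoff R ψ) (hq : IsSymbol μ q) (hu : IsTest u) :
    IsTest (opA (symA ψ q) u) :=
  isTest_opA (hq.amp_symA hψ).1 (symA_support hψ q) hu

theorem opA_symA_congr (hψ : IsDispCutoff R ψ) {v : Rn n → ℂ} {x : Rn n}
    (h : ∀ z, ‖z‖ ≤ 2 * R → u (x + z) = v (x + z)) :
    opA (symA ψ q) u x = opA (symA ψ q) v x := by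
  refine opA_eq_of_shiftA_mul fun z η => ?_
  by_cases hz : 2 * R < ‖z‖
  · simp [symA_support hψ q x z η hz]
  · rw [h z (not_lt.1 hz)]

/-- The square of the operator with amplitude `symA ψ q`. -/
theorem opA_symA_opA_symA (hψ : IsDispCutoff R ψ) (hχ : IsDispCutoff (4 * R) χ)
    (hq : IsSymbol μ q) (hre : ∀ x ξ, (q x ξ).im = 0) (hu : IsTest u) :
    opA (symA ψ q) (opA (symA ψ q) u) = opA (leftA (prodL ψ χ q q)) u := by
  have hB := isSymbol_prod_amp hψ hq hq
  rw [prodL, opA_leftA_Ls (hχ.amp hB) hu]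
  funext x
  -- Two applications of Q reach a distance of at most 2R + 2R, so the value at x does not change
  -- when u is cut off by χ around x. This is why χ must be 1 up to 4R.
  set w : Rn n → ℂ := u * fun y => (χ (-x + y) : ℂ) with hw
  have hwt : IsTest w := hu.mul (hχ.isTest.comp_add_left (-x)).smooth
  have h1 : opA (dispA χ * (leftA (symL ψ q) * cj (rightA (symL ψ q)))) u x =
      opA (leftA (symL ψ q) * cj (rightA (symL ψ q))) w x := by
    refine opA_eq_of_shiftA_mul fun z η => ?_
    simp only [hw, Pi.mul_apply, dispA, base, neg_add_cancel_left]
    ring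
  have h2 := congrFun (opA_opA (by linarith [hψ.nonneg]) (hq.amp_symA hψ) (symA_support hψ q)
    (symA_symm hψ hre) hwt) x
  rw [h1]
  refine Eq.trans ?_ h2
  refine opA_symA_congr hψ fun z hz => opA_symA_congr hψ fun z' hz' => ?_
  have h3 : ‖z + z'‖ ≤ 4 * R := by linarith [norm_add_le z z']
  simp only [hw, Pi.mul_apply]
  rw [show -x + (x + z + z') = z + z' by abel, hχ.one _ h3, Complex.ofReal_one, mul_one]

end SymmetricQuantization

/-! ### Successive approximation of the square root. -/

section SquareRoot

open MeasureTheory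

variable {n : ℕ} {m μ : ℝ} {p q : Rn n → Rn n → ℂ} {ψ χ : Rn n → ℝ} {R : ℝ}
  {A : Rn n × Rn n → Rn n → ℂ}

/-- The quadratic form of the operator with amplitude `A` is real. -/
def HasRealForm (A : Rn n × Rn n → Rn n → ℂ) : Prop :=
  ∀ u, IsTest u → (∫ x, opA A u x * (starRingEnd ℂ) (u x)).im = 0

theorem integrable_opA_mul_conj (hA : IsSymbol μ A) {u : Rn n → ℂ} (hu : IsTest u) :
    Integrable fun x => opA A u x * (starRingEnd ℂ) (u x) := by
  have := (hu.conj.mul (contDiff_opA hA hu)).integrable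
  rwa [mul_comm] at this

theorem im_eq_zero_of_eq_conj {z : ℂ} (h : z = (starRingEnd ℂ) z) : z.im = 0 :=
  Complex.conj_eq_iff_im.1 h.symm

/-- The form of Q² at u is the squared norm of Qu. -/
theorem hasRealForm_prodL (hψ : IsDispCutoff R ψ) (hχ : IsDispCutoff (4 * R) χ)
    (hq : IsSymbol μ q) (hre : ∀ x ξ, (q x ξ).im = 0) :
    HasRealForm (leftA (prodL ψ χ q q)) := by
  intro u hu
  have hA := (hq.amp_symA hψ).1
  have hv := isTest_opA_symA hψ hq hu
  rw [← opA_symA_opA_symA hψ hχ hq hre hu,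
    integral_opA_mul_conj hA hA (symA_symm hψ hre) hv hu]
  refine im_eq_zero_of_eq_conj ?_
  rw [← integral_conj]
  congr 1
  funext x
  rw [map_mul, Complex.conj_conj, mul_comm]

theorem HasRealForm.sub_prodL (hψ : IsDispCutoff R ψ) (hχ : IsDispCutoff (4 * R) χ)
    (hA : IsSymbol m A) (hp : IsSymbol m p) (hq : IsSymbol μ q) (hre : ∀ x ξ, (q x ξ).im = 0)
    (h : HasRealForm (A + leftA p)) : HasRealForm (A + leftA (p - prodL ψ χ q q)) := by
  intro u hu
  set M := max m (μ + μ) with hM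
  have hF : IsSymbol M (prodL ψ χ q q) := (isSymbol_prodL hψ hχ hq hq).mono (le_max_right _ _)
  have hpM : IsSymbol M p := hp.mono (le_max_left _ _)
  have hB : IsSymbol M (A + leftA (p - prodL ψ χ q q)) :=
    (hA.mono (le_max_left _ _)).add ((hpM.sub hF).pull _)
  have e : A + leftA p = (A + leftA (p - prodL ψ χ q q)) + leftA (prodL ψ χ q q) := by
    funext z ξ
    simp [pull]
    ring
  have h1 := h u hu
  rw [e, opA_add_left hB (hF.pull _) hu] at h1
  simp only [Pi.add_apply, add_mul] at h1
  rw [integral_add (integrable_opA_mul_conj hB hu) (integrable_opA_mul_conj (hF.pull _) hu),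
    Complex.add_im, hasRealForm_prodL hψ hχ hq hre u hu, add_zero] at h1
  exact h1

/-- A positive elliptic principal part: `c` is a real square root of the principal symbol up to
lower order terms and `e` is the inverse of `2c` for large `ξ`. -/
structure IsRootPair (m : ℝ) (c e : Rn n → Rn n → ℂ) : Prop where
  root : EvHom (m / 2) c
  inv : EvHom (-(m / 2)) e
  root_re : ∀ x ξ, (c x ξ).im = 0
  inv_re : ∀ x ξ, (e x ξ).im = 0
  two_mul : ∃ ρ : ℝ, ∀ x ξ, ρ < ‖ξ‖ → 2 * c x ξ * e x ξ = 1

variable {c e : Rn n → Rn n → ℂ}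

/-- Correction of an approximate square root by a term of lower order. -/
theorem exists_correction (hψ : IsDispCutoff R ψ) (hχ : IsDispCutoff (4 * R) χ)
    (hA : ∀ μ, IsSymbol μ A) (hp : ∀ K, Cl K m p) (hsym : HasRealForm (A + leftA p))
    (hc : IsRootPair m c e) (hre : ∀ x ξ, (q x ξ).im = 0) (hq : ∀ K, Cl K (m / 2) q)
    (hqc : IsSymbol (m / 2 - 1) (q - c)) {N : ℕ} (hN : 1 ≤ N)
    (hr : IsSymbol (m - N) (p - prodL ψ χ q q)) :
    ∃ d, EvHom (m / 2 - N) d ∧ (∀ x ξ, (d x ξ).im = 0) ∧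
      IsSymbol (m - ((N + 1 : ℕ) : ℝ)) (p - prodL ψ χ (q + d) (q + d)) := by
  have hqS : IsSymbol (m / 2) q := (hq 0).isSymbol
  have hrC : ∀ K, Cl K m (p - prodL ψ χ q q) := fun K => by
    have := Cl.prodL hψ hχ (hq K) (hq K)
    rw [add_halves] at this
    exact (hp K).sub this
  obtain ⟨s, hs, hs1, -⟩ := exists_leading_term (cl_sub_nat_of_isSymbol hrC hr)
  have hreal := hsym.sub_prodL hψ hχ (hA m) (hp 0).isSymbol hqS hre
  -- Although P and Q² have order m, their difference has order m - N, so the leading term detected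
  -- by the quadratic form is s.
  obtain ⟨ρ, hρ, him⟩ := im_eq_zero_of_symmetric ((hA (m - N)).add (hr.pull _)) hs
    ((congrArg (IsSymbol (m - N - 1)) (by funext x ξ; simp [pull]; ring)).mp
      (((hA (m - N - 1)).pull (ContinuousLinearMap.inl ℝ (Rn n) (Rn n))).add hs1)) hreal
  -- This is Re s/(2c) for large ξ. Taking the real part makes d real for all ξ, and it equals
  -- s/(2c) where s is real.
  set d : Rn n → Rn n → ℂ := e * ((1 / 2 : ℂ) • (s + cj s)) with hd
  have hdE : EvHom (m / 2 - N) d := by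
    have := hc.inv.mul ((hs.add hs.cj).const_smul (1 / 2 : ℂ))
    rwa [show -(m / 2) + (m - N) = m / 2 - N by ring] at this
  have hsre : ∀ x ξ, (1 / 2 : ℂ) * (s x ξ + (starRingEnd ℂ) (s x ξ)) = ((s x ξ).re : ℂ) := by
    intro x ξ
    rw [Complex.add_conj]
    push_cast; ring
  have hdx : ∀ x ξ, d x ξ = e x ξ * ((s x ξ).re : ℂ) := fun x ξ => by
    rw [← hsre]; rfl
  have hdre : ∀ x ξ, (d x ξ).im = 0 := fun x ξ => by
    rw [hdx, Complex.im_mul_ofReal, hc.inv_re, zero_mul]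
  refine ⟨d, hdE, hdre, ?_⟩
  have hdS := hdE.isSymbol
  set M : ℝ := m - ((N + 1 : ℕ) : ℝ) with hM
  have hMe : M = m - N - 1 := by rw [hM]; push_cast; ring
  have t1 : IsSymbol M (p - prodL ψ χ q q - s) := by rwa [hMe]
  have t2 : IsSymbol M (s - c * cj d - d * cj c) := by
    obtain ⟨ρ', hρ'⟩ := hc.two_mul
    refine (EvHom.of_support ((hs.smooth.sub (hc.root.smooth.mul hdE.smooth.cj)).sub
      (hdE.smooth.mul hc.root.smooth.cj)) (ρ := ρ + |ρ'|) (by positivity) fun x ξ hξ => ?_).isSymbol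
    have h1 := hρ' x ξ (by linarith [le_abs_self ρ'])
    have h2 : (starRingEnd ℂ) (d x ξ) = d x ξ := Complex.conj_eq_iff_im.2 (hdre x ξ)
    have h3 : (starRingEnd ℂ) (c x ξ) = c x ξ := Complex.conj_eq_iff_im.2 (hc.root_re x ξ)
    have h4 : ((s x ξ).re : ℂ) = s x ξ :=
      Complex.ext rfl (by simp [him x ξ (by linarith [abs_nonneg ρ'])])
    have h5 := hdx x ξ
    rw [h4] at h5
    change s x ξ - c x ξ * (starRingEnd ℂ) (d x ξ) - d x ξ * (starRingEnd ℂ) (c x ξ) = 0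
    rw [h2, h3, h5]
    linear_combination -(s x ξ) * h1
  have e1 : m / 2 + (m / 2 - N) - 1 = M := by rw [hMe]; ring
  have e2 : m / 2 - N + m / 2 - 1 = M := by rw [hMe]; ring
  have e3 : m / 2 - 1 + (m / 2 - N) = M := by rw [hMe]; ring
  have e4 : m / 2 - N + (m / 2 - 1) = M := by rw [hMe]; ring
  have t3 := isSymbol_prodL_sub hψ hχ hqS hdS
  have t4 := isSymbol_prodL_sub hψ hχ hdS hqS
  have t5 := hqc.mul hdS.cj
  have t6 := hdS.mul hqc.cj
  -- The quadratic term has order m - 2N ≤ m - N - 1; here N ≥ 1 is needed.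
  have t7 : IsSymbol M (prodL ψ χ d d) := (isSymbol_prodL hψ hχ hdS hdS).mono (by
    have : (1 : ℝ) ≤ N := by exact_mod_cast hN
    rw [hMe]; linarith)
  rw [e1] at t3
  rw [e2] at t4
  rw [e3] at t5
  rw [e4] at t6
  rw [prodL_add_add hψ hχ hqS hdS]
  refine (congrArg (IsSymbol M) ?_).mp ((t1.add t2).sub ((((t3.add t4).add t5).add t6).add t7))
  funext x ξ
  simp [cj]
  ring

/-- Iterates `exists_correction` from c and sums the corrections asymptotically. The invariant keeps
q - c of order m/2 - 1, so that c may stand for q in the cross terms; at stage N the error has order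
m - (N + 1), hence the correction has degree m/2 - (N + 1). -/
theorem exists_square_root (hψ : IsDispCutoff R ψ) (hχ : IsDispCutoff (4 * R) χ)
    (hA : ∀ μ, IsSymbol μ A) (hp : ∀ K, Cl K m p) (hsym : HasRealForm (A + leftA p))
    (hc : IsRootPair m c e) (hpc : IsSymbol (m - 1) (p - c * c)) :
    ∃ q : Rn n → Rn n → ℂ, (∀ x ξ, (q x ξ).im = 0) ∧ (∀ K, Cl K (m / 2) q) ∧
      ∀ μ, IsSymbol μ (p - prodL ψ χ q q) := by
  let Inv : ℕ → (Rn n → Rn n → ℂ) → Prop := fun N q => (∀ x ξ, (q x ξ).im = 0) ∧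
    (∀ K, Cl K (m / 2) q) ∧ IsSymbol (m / 2 - 1) (q - c) ∧
      IsSymbol (m - ((N + 1 : ℕ) : ℝ)) (p - prodL ψ χ q q)
  have h0 : Inv 0 c := by
    refine ⟨hc.root_re, fun K => hc.root.cl, by simpa using isSymbol_zero, ?_⟩
    have h1 := isSymbol_prodL_sub hψ hχ hc.root.isSymbol hc.root.isSymbol
    rw [add_halves] at h1
    have h2 : cj c = c := by
      funext x ξ
      exact Complex.conj_eq_iff_im.2 (hc.root_re x ξ)
    rw [h2] at h1
    simpa using hpc.sub h1
  have hstep : ∀ N (q : {q // Inv N q}), ∃ d, EvHom (m / 2 - ((N + 1 : ℕ) : ℝ)) d ∧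
      (∀ x ξ, (d x ξ).im = 0) ∧ Inv (N + 1) (q.1 + d) := by
    rintro N ⟨q, hre, hq, hqc, hr⟩
    obtain ⟨d, hd, hdre, hd'⟩ := exists_correction hψ hχ hA hp hsym hc hre hq hqc
      (Nat.le_add_left 1 N) hr
    refine ⟨d, hd, hdre, fun x ξ => by simp [hre, hdre], fun K =>
      (hq K).add (hd.cl_of_sub_nat K), ?_, hd'⟩
    have h1 : IsSymbol (m / 2 - 1) d := hd.isSymbol.mono (by
      push_cast; linarith [Nat.cast_nonneg (α := ℝ) N])
    simpa [add_sub_right_comm] using hqc.add h1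
  choose f hf1 hf2 hf3 using hstep
  let r : (N : ℕ) → {q // Inv N q} := fun N =>
    Nat.rec ⟨c, h0⟩ (fun N q => ⟨q.1 + f N q, hf3 N q⟩) N
  let d : ℕ → Rn n → Rn n → ℂ := fun j => Nat.casesOn j c fun j => f j (r j)
  have hdE : ∀ j : ℕ, EvHom (m / 2 - j) (d j) := by
    intro j
    cases j with
    | zero =>
      change EvHom _ c
      simpa using hc.root
    | succ j => exact hf1 j (r j)
  have hdre : ∀ j x ξ, (d j x ξ).im = 0 := by
    intro j
    cases j with
    | zero => exact hc.root_re
    | succ j => exact hf2 j (r j)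
  have hr : ∀ N, (r N).1 = ∑ j ∈ Finset.range (N + 1), d j := by
    intro N
    induction N with
    | zero => simp [r, d]
    | succ N ih => rw [Finset.sum_range_succ, ← ih]
  obtain ⟨q, hqre, hq⟩ := exists_asymptotic_sum (fun j => (hdE j).isSymbol) hdre
  refine ⟨q, hqre, fun K => cl_of_expansion hdE (hq K), fun μ => ?_⟩
  -- The sum is compared with the partial sum of stage N: the difference has order m/2 - (N + 1), so
  -- every product involving it has order at most μ.
  obtain ⟨N, hN⟩ := exists_nat_ge (m - μ)
  have h1 := (r N).2.2.2.2
  have h2 := hq (N + 1)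
  rw [← hr] at h2
  have hrS := ((r N).2.2.1 0).isSymbol
  generalize (r N).1 = w at h1 h2 hrS
  have hM : m - ((N + 1 : ℕ) : ℝ) ≤ μ := by push_cast; linarith
  have t1 := (isSymbol_prodL hψ hχ hrS h2).mono (show _ ≤ μ by linarith)
  have t2 := (isSymbol_prodL hψ hχ h2 hrS).mono (show _ ≤ μ by linarith)
  have t3 := (isSymbol_prodL hψ hχ h2 h2).mono (show _ ≤ μ by
    have : (0 : ℝ) ≤ ((N + 1 : ℕ) : ℝ) := Nat.cast_nonneg _
    linarith)
  have h3 := prodL_add_add hψ hχ hrS h2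
  rw [add_sub_cancel] at h3
  rw [h3, ← sub_sub]
  exact (h1.mono hM).sub ((t1.add t2).add t3)

end SquareRoot

/-! ### The square root of the principal symbol. -/

section Root

variable {n : ℕ} {m : ℝ} {σ : Rn n → Rn n → ℂ}

theorem isHomogeneousFn_rpow (hσ : IsHomogeneousFn m σ)
    (hpos : ∀ x ξ : Rn n, ξ ≠ 0 → 0 < (σ x ξ).re) (s : ℝ) :
    IsHomogeneousFn (m * s) fun x ξ => (((σ x ξ).re ^ s : ℝ) : ℂ) := by
  refine ⟨?_, fun x ξ t hξ ht => ?_⟩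
  · have h1 : ContDiffOn ℝ ∞ (fun z : Rn n × Rn n => (σ z.1 z.2).re) {z | z.2 ≠ 0} :=
      Complex.reCLM.contDiff.comp_contDiffOn hσ.1
    exact Complex.ofRealCLM.contDiff.comp_contDiffOn
      (h1.rpow_const_of_ne fun z hz => (hpos z.1 z.2 hz).ne')
  · beta_reduce
    rw [hσ.2 x ξ t hξ ht, Complex.re_ofReal_mul,
      Real.mul_rpow (Real.rpow_nonneg ht.le m) (hpos x ξ hξ).le, ← Real.rpow_mul ht.le]
    push_cast
    rfl

/-- The witnesses are (1 - ψ)σ^{1/2} and (1 - ψ)σ^{-1/2}/2; the cutoff vanishes for |ξ| > 2. -/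
theorem exists_isRootPair (hσ : IsHomogeneousFn m σ)
    (hpos : ∀ x ξ : Rn n, ξ ≠ 0 → 0 < (σ x ξ).re ∧ (σ x ξ).im = 0) :
    ∃ c e, IsRootPair m c e ∧ ∃ ρ : ℝ, ∀ x ξ, ρ < ‖ξ‖ → c x ξ * c x ξ = σ x ξ := by
  have hpos' := fun x ξ h => (hpos x ξ h).1
  obtain ⟨ψ, h1, h2, h3, -, -⟩ := exists_bump n one_pos
  have hφ : IsCutoff fun ξ : Rn n => (ψ ξ : ℂ) := by
    have hc : ContDiff ℝ ∞ fun ξ : Rn n => (ψ ξ : ℂ) := Complex.ofRealCLM.contDiff.comp h1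
    refine ⟨hc, (isTest_of_radius (M := 2) hc fun z hz => ?_).cpt, ?_⟩
    · rw [h3 z (by linarith), Complex.ofReal_zero]
    · filter_upwards [Metric.closedBall_mem_nhds (0 : Rn n) one_pos] with z hz
      rw [h2 z (by simpa using hz), Complex.ofReal_one]
  have hc := evHom_one_sub_cutoff_mul hφ (isHomogeneousFn_rpow hσ hpos' (1 / 2))
  have he := (evHom_one_sub_cutoff_mul hφ (isHomogeneousFn_rpow hσ hpos' (-(1 / 2)))).const_smul
    (1 / 2 : ℂ)
  rw [show m * (1 / 2) = m / 2 by ring] at hc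
  rw [show m * (-(1 / 2)) = -(m / 2) by ring] at he
  have hlarge : ∀ ξ : Rn n, 2 < ‖ξ‖ → ξ ≠ 0 ∧ ψ ξ = 0 := fun ξ hξ =>
    ⟨norm_pos_iff.1 (by linarith), h3 ξ (by linarith)⟩
  refine ⟨_, _, ⟨hc, he, fun x ξ => ?_, fun x ξ => ?_, 2, fun x ξ hξ => ?_⟩, 2, fun x ξ hξ => ?_⟩
  · rw [← Complex.ofReal_one, ← Complex.ofReal_sub, ← Complex.ofReal_mul, Complex.ofReal_im]
  · have : ((1 / 2 : ℂ) • fun (x ξ : Rn n) => (1 - (ψ ξ : ℂ)) *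
        (((σ x ξ).re ^ (-(1 / 2) : ℝ) : ℝ) : ℂ)) x ξ =
        ((1 / 2 * ((1 - ψ ξ) * (σ x ξ).re ^ (-(1 / 2) : ℝ)) : ℝ) : ℂ) := by
      simp
    rw [this, Complex.ofReal_im]
  · obtain ⟨h0, h4⟩ := hlarge ξ hξ
    have h5 := hpos' x ξ h0
    have h6 : (σ x ξ).re ^ (1 / 2 : ℝ) * (σ x ξ).re ^ (-(1 / 2) : ℝ) = 1 := by
      rw [← Real.rpow_add h5, add_neg_cancel, Real.rpow_zero]
    simp only [Pi.smul_apply, smul_eq_mul, h4, Complex.ofReal_zero, sub_zero, one_mul]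
    have h7 : (((σ x ξ).re ^ (1 / 2 : ℝ) : ℝ) : ℂ) * (((σ x ξ).re ^ (-(1 / 2) : ℝ) : ℝ) : ℂ) = 1 := by
      rw [← Complex.ofReal_mul, h6, Complex.ofReal_one]
    linear_combination h7
  · obtain ⟨h0, h4⟩ := hlarge ξ hξ
    have h5 := hpos' x ξ h0
    have h6 : (σ x ξ).re ^ (1 / 2 : ℝ) * (σ x ξ).re ^ (1 / 2 : ℝ) = (σ x ξ).re := by
      rw [← Real.rpow_add h5, add_halves, Real.rpow_one]
    simp only [h4, Complex.ofReal_zero, sub_zero, one_mul]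
    rw [← Complex.ofReal_mul, h6]
    exact Complex.ext rfl (by simp [(hpos x ξ h0).2])

theorem isSymbol_sub_root {p c : Rn n → Rn n → ℂ} {b : ℕ → Rn n → Rn n → ℂ}
    (hp : HasClassicalExpansion m p b) (hc : Smooth2 c) {ρ : ℝ}
    (h : ∀ x ξ, ρ < ‖ξ‖ → c x ξ * c x ξ = b 0 x ξ) : IsSymbol (m - 1) (p - c * c) := by
  obtain ⟨hb, φ, hφ, hp⟩ := hp
  have hs := evHom_one_sub_cutoff_mul hφ (hb 0)
  obtain ⟨M, hM0, hM⟩ := hφ.exists_radius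
  have h1 : IsSymbol (m - 1) ((fun x ξ => (1 - φ ξ) * b 0 x ξ) - c * c) := by
    refine (EvHom.of_support (hs.smooth.sub (hc.mul hc)) (ρ := |ρ| + M + 1) (by positivity)
      fun x ξ hξ => ?_).isSymbol
    have := le_abs_self ρ
    have := abs_nonneg ρ
    simp only [Pi.sub_apply, Pi.mul_apply]
    rw [hM ξ (by linarith), h x ξ (by linarith)]
    ring
  have h2 := hp 1
  rw [Nat.cast_one] at h2
  refine (congrArg (IsSymbol (m - 1)) ?_).mp (h2.add h1)
  funext x ξ
  simp

end Root

/-! ### The operator Q and its properties. -/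

section Operator

open MeasureTheory

variable {n : ℕ} {m μ : ℝ} {q : Rn n → Rn n → ℂ} {ψ : Rn n → ℝ} {R : ℝ}

theorem exists_isDispCutoff (n : ℕ) (hR : 0 < R) : ∃ ψ : Rn n → ℝ, IsDispCutoff R ψ := by
  obtain ⟨ψ, h1, h2, h3, h4, -⟩ := exists_bump n hR
  exact ⟨ψ, h1, h2, fun z hz => h3 z hz.le, h4, hR.le⟩

/-- The symmetric quantization of `q` as an operator on test functions. -/
noncomputable def symOp (hψ : IsDispCutoff R ψ) (hq : IsSymbol μ q) : TestFn n →ₗ[ℂ] TestFn n where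
  toFun u := (isTest_opA_symA hψ hq (isTest_coe u)).toTestFn
  map_add' u v := TestFunction.ext fun x =>
    congrFun (opA_add (hq.amp_symA hψ).1 (isTest_coe u) (isTest_coe v)) x
  map_smul' c u := TestFunction.ext fun x =>
    congrFun (opA_smul (A := symA ψ q) (u := (u : Rn n → ℂ)) c) x

/-- Pulling back along (x,y) ↦ (x,y - x) gives an ordinary amplitude. The left symbol is exact, so
the smooth kernel in the definition is zero. -/
theorem symOp_mem_psiDOcl (hψ : IsDispCutoff R ψ) (hq : IsSymbol μ q) (hcl : ∀ K, Cl K μ q) :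
    testIncl n ∘ₗ symOp hψ hq ∈ PsiDOcl n μ := by
  have hA := (hq.amp_symA hψ).1
  have hL := hq.symL hψ
  have e : testIncl n ∘ₗ symOp hψ hq = opL hA := rfl
  refine ⟨⟨_, hA.pull ((ContinuousLinearMap.fst ℝ (Rn n) (Rn n)).prod
    (ContinuousLinearMap.snd ℝ (Rn n) (Rn n) - ContinuousLinearMap.fst ℝ (Rn n) (Rn n))),
    hasAmplitude_opL hA⟩, ?_⟩
  obtain ⟨b, hb⟩ := exists_classicalExpansion fun K => (hcl K).symL hψ
  refine ⟨symL ψ q, b, ⟨hL, opL (hL.pull (ContinuousLinearMap.fst ℝ (Rn n) (Rn n))),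
    hasAmplitude_opL _, 0, contDiff_const, fun u x => ?_⟩, hb⟩
  have h1 : opA (leftA (symL ψ q)) u = opA (symA ψ q) u :=
    opA_leftA_Ls (hq.amp_symA hψ) (isTest_coe u)
  have h2 : (testIncl n ∘ₗ symOp hψ hq) u = opL (hL.pull (ContinuousLinearMap.fst ℝ (Rn n) (Rn n))) u :=
    h1.symm
  simp [h2]

/-- The kernel support is closed and lies in the strip |x - y| ≤ 2R, so over a compact set in either
variable it is closed and bounded. -/
theorem isProperlySupported_symOp (hψ : IsDispCutoff R ψ) (hq : IsSymbol μ q) :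
    IsProperlySupported (testIncl n ∘ₗ symOp hψ hq) := by
  set P := testIncl n ∘ₗ symOp hψ hq with hP
  have hdist : ∀ z ∈ kernelSupport P, dist z.1 z.2 ≤ 2 * R := by
    intro z hz
    by_contra! hlt
    set δ := (dist z.1 z.2 - 2 * R) / 2 with hδ
    have hδ0 : 0 < δ := by rw [hδ]; linarith
    obtain ⟨u, hu, x, hx, hne⟩ := hz _ (Metric.ball_mem_nhds z.1 hδ0) _ (Metric.ball_mem_nhds z.2 hδ0)
    refine hne (opA_eq_zero (A := symA ψ q) fun w ξ => ?_)
    by_cases hw : 2 * R < ‖w‖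
    · rw [symA_support hψ q x w ξ hw, mul_zero]
    · rw [image_eq_zero_of_notMem_tsupport (f := (u : Rn n → ℂ)), zero_mul]
      intro hmem
      have h1 := Metric.mem_ball.1 (hu hmem)
      have h2 := Metric.mem_ball.1 hx
      have h3 : dist x (x + w) ≤ 2 * R := by simpa using not_lt.1 hw
      have h4 := dist_triangle4 z.1 x (x + w) z.2
      rw [dist_comm z.1 x] at h4
      linarith
  have hclosed : IsClosed (kernelSupport P) := by
    rw [← isOpen_compl_iff, isOpen_iff_mem_nhds]
    intro z hz
    simp only [kernelSupport, Set.mem_compl_iff, Set.mem_ofPred_eq] at hz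
    push Not at hz
    obtain ⟨U, hU, V, hV, h⟩ := hz
    have hU' := (continuous_fst.tendsto z).eventually (eventually_mem_nhds_iff.2 hU)
    have hV' := (continuous_snd.tendsto z).eventually (eventually_mem_nhds_iff.2 hV)
    filter_upwards [hU', hV'] with y hyU hyV hy
    obtain ⟨u, hu, x, hx, hne⟩ := hy U hyU V hyV
    exact hne (h u hu x hx)
  intro K hK
  obtain ⟨M, hM⟩ := hK.isBounded.subset_closedBall (0 : Rn n)
  have hcpt := (isCompact_closedBall (0 : Rn n) (M + 2 * R)).prod
    (isCompact_closedBall (0 : Rn n) (M + 2 * R))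
  have hR := hψ.nonneg
  constructor
  · refine hcpt.of_isClosed_subset (hclosed.inter (hK.isClosed.preimage continuous_fst)) ?_
    rintro z ⟨hz, hzK⟩
    have h1 := Metric.mem_closedBall.1 (hM hzK)
    have h2 := dist_triangle z.2 z.1 0
    rw [dist_comm z.2 z.1] at h2
    have := hdist z hz
    exact ⟨Metric.mem_closedBall.2 (by linarith), Metric.mem_closedBall.2 (by linarith)⟩
  · refine hcpt.of_isClosed_subset (hclosed.inter (hK.isClosed.preimage continuous_snd)) ?_
    rintro z ⟨hz, hzK⟩
    have h1 := Metric.mem_closedBall.1 (hM hzK)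
    have h2 := dist_triangle z.1 z.2 0
    have := hdist z hz
    exact ⟨Metric.mem_closedBall.2 (by linarith), Metric.mem_closedBall.2 (by linarith)⟩

theorem isSelfAdjointOp_symOp (hψ : IsDispCutoff R ψ) (hq : IsSymbol μ q)
    (hre : ∀ x ξ, (q x ξ).im = 0) : IsSelfAdjointOp (testIncl n ∘ₗ symOp hψ hq) := fun φ φ' =>
  integral_opA_mul_conj (hq.amp_symA hψ).1 (hq.amp_symA hψ).1 (symA_symm hψ hre) (isTest_coe φ)
    (isTest_coe φ')

end Operator

/-! ### Assembly of the main theorem. -/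

theorem theorem6p5 (n : ℕ) (m : ℝ) (P : TestOp n) (σ : Rn n → Rn n → ℂ)
    (hP : P ∈ PsiDOcl n m) (hsa : IsSelfAdjointOp P)
    (hσ : IsPrincipalSymbol m P σ)
    (hpos : ∀ x ξ : Rn n, ξ ≠ 0 → 0 < (σ x ξ).re ∧ (σ x ξ).im = 0) :
    ∃ Q : TestFn n →ₗ[ℂ] TestFn n,
      testIncl n ∘ₗ Q ∈ PsiDOcl n (m / 2) ∧
      IsProperlySupported (testIncl n ∘ₗ Q) ∧
      IsSelfAdjointOp (testIncl n ∘ₗ Q) ∧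
      P - testIncl n ∘ₗ Q ∘ₗ Q ∈ PsiDONegInfty n := by
  obtain ⟨p, b, ⟨hpS, P₀, hP₀, K, hK, hPK⟩, hexp, rfl⟩ := hσ
  obtain ⟨A, hA, hAK⟩ := exists_amplitude_of_kernel hK
  have hpA := hpS.pull (ContinuousLinearMap.fst ℝ (Rn n) (Rn n))
  have hP₀' : P₀ = opL hpA := hP₀.unique (hasAmplitude_opL hpA)
  -- P is represented exactly: its smooth kernel is absorbed into the amplitude A of order -∞.
  have hPu : ∀ u : TestFn n, P u = opA (A + leftA p) u := by
    intro u
    rw [opA_add_left (hA m) hpA (isTest_coe u)]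
    funext x
    have h1 := hPK u x
    rw [hP₀', LinearMap.sub_apply, Pi.sub_apply, sub_eq_iff_eq_add] at h1
    rw [h1, Pi.add_apply, hAK u (isTest_coe u)]
    rfl
  have hsym : HasRealForm (A + leftA p) := by
    intro u hu
    have h1 := hsa hu.toTestFn hu.toTestFn
    rw [hPu, hu.coe_toTestFn] at h1
    refine im_eq_zero_of_eq_conj ?_
    nth_rewrite 1 [h1]
    rw [← integral_conj]
    congr 1
    funext x
    rw [map_mul, Complex.conj_conj, mul_comm]
  have hb0 : IsHomogeneousFn m (b 0) := by simpa using hexp.1 0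
  obtain ⟨c, e, hce, ρ, hρ⟩ := exists_isRootPair hb0 hpos
  obtain ⟨ψ, hψ⟩ := exists_isDispCutoff n one_pos
  obtain ⟨χ, hχ⟩ := exists_isDispCutoff n (show (0 : ℝ) < 4 * 1 by norm_num)
  obtain ⟨q, hre, hcl, hq⟩ := exists_square_root hψ hχ hA hexp.cl hsym hce
    (isSymbol_sub_root hexp hce.root.smooth hρ)
  have hqS : IsSymbol (m / 2) q := (hcl 0).isSymbol
  refine ⟨symOp hψ hqS, symOp_mem_psiDOcl hψ hqS hcl, isProperlySupported_symOp hψ hqS,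
    isSelfAdjointOp_symOp hψ hqS hre, ?_⟩
  have hB : ∀ μ, IsSymbol μ (A + leftA (p - prodL ψ χ q q)) := fun μ =>
    (hA μ).add ((hq μ).pull _)
  have hF : IsSymbol m (prodL ψ χ q q) := by
    have := isSymbol_prodL hψ hχ hqS hqS
    rwa [add_halves] at this
  -- Both P and Q² are given exactly by amplitudes, so their difference has the amplitude in `hB`,
  -- which lies in every symbol class.
  have hPQ : P - testIncl n ∘ₗ symOp hψ hqS ∘ₗ symOp hψ hqS = opL (hB m) := by
    refine LinearMap.ext fun u => ?_
    have h1 : (testIncl n ∘ₗ symOp hψ hqS ∘ₗ symOp hψ hqS) u = opA (leftA (prodL ψ χ q q)) u :=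
      opA_symA_opA_symA hψ hχ hqS hre (isTest_coe u)
    have e : A + leftA p = (A + leftA (p - prodL ψ χ q q)) + leftA (prodL ψ χ q q) := by
      funext z ξ
      simp [pull]
      ring
    rw [LinearMap.sub_apply, h1, hPu, e, opA_add_left (hB m) (hF.pull _) (isTest_coe u),
      add_sub_cancel_right, opL_apply]
  rw [hPQ]
  exact ⟨_, fun μ => (hB μ).pull ((ContinuousLinearMap.fst ℝ (Rn n) (Rn n)).prod
    (ContinuousLinearMap.snd ℝ (Rn n) (Rn n) - ContinuousLinearMap.fst ℝ (Rn n) (Rn n))),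
    hasAmplitude_opL (hB m)⟩
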